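/- Let $d\in\mathbb N_0$, $\hbar>0$. For $w=p+iq\in\mathbb C^d$ ($p,q\in\mathbb R^d$) let $\rho(w)$ be the unitary operator $[\rho(w)f](x)=e^{\frac{i}{\hbar}(q\cdot x+\frac12 p\cdot q)}f(x+p)$ on $L^2(\mathbb R^d)$. Let $Mp(d)$ be the metaplectic group, i.e. the group of unitary operators on $L^2(\mathbb R^d)$ generated by the operators $f\mapsto \det(A)^{-1/2}f(A^{-1}x)$ ($A\in GL(d,\mathbb R)$), $f\mapsto e^{\frac{i}{2\hbar}x\cdot Cx}f(x)$ ($C$ real symmetric) and $i^{d/2}\mathcal F^{-1}$, where $\mathcal F^{-1}f(x)=(2\pi\hbar)^{-d/2}\int e^{\frac{i}{\hbar}x\cdot y}f(y)\,dy$ (both values of the square roots are allowed). For $g\in\mathbb U(d)$ a metaplectic operator of $g$ is an operator $\mu(g)\in Mp(d)$ such that $\mu(g)\rho(w)\mu(g)^{-1}=\rho(gw)$ for all $w\in\mathbb C^d$ (it is determined by $g$ up to a sign). Let $\hat B f(z)=(\pi\hbar)^{-d/4}\int_{\mathbb R^d} e^{\sqrt{2\pi/\hbar}\,z\cdot x-\frac{|x|^2}{2\hbar}-\frac{\pi}{2}z\cdot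 z}f(x)\,dx$ be the Bargmann transform, a unitary operator from $L^2(\mathbb R^d)$ onto the space of holomorphic functions on $\mathbb C^d$ that are square integrable with respect to $e^{-\pi|z|^2}dz$, so that $\hat B^*F(x)=\int_{\mathbb C^d}(\pi\hbar)^{-d/4}e^{\sqrt{2\pi/\hbar}\,\bar z\cdot x-\frac{|x|^2}{2\hbar}-\frac{\pi}{2}\bar z\cdot\bar z}F(z)e^{-\pi|z|^2}dz$ for every polynomial $F$. **Theorem.** Let $\theta_1,\dots,\theta_d$ be the eigenvalues of $g\in\mathbb U(d)$, counted with multiplicity. Then $g$ has a metaplectic operator, and for every metaplectic operator $\mu(g)$ of $g$ there is a square root of $\det(g)^{-1}$, denoted by $\det(g)^{-1/2}$, such that the following hold. 1. The point spectrum of $\mu(g)$ is $$\sigma_p(\mu(g))=\det(g)^{-1/2}\cdot\{\overline{\theta_1}^{\,n_1}\cdots\overline{\theta_d}^{\,n_d}\mid (n_1,\dots,n_d)\in\mathbb N_0^d\}.$$ 2. Let $\{v_j\}_{j=1}^d$ be a basis of $\mathbb C^d$ with $gv_j=\theta_jv_j$, let $\{e_j\}$ be the canonical basis and $\langle\cdot,\cdot\rangle$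 the canonical inner product, conjugate linear in the first variable. For $(n_1,\dots,n_d)\in\mathbb N_0^d$ let $q(z)=\prod_{k=1}^d\big(\sum_j\langle v_k,e_j\rangle z_j\big)^{n_k}$. Then $u=\hat B^*q\in L^2(\mathbb R^d)$ is an eigenvector of $\mu(g)$ with eigenvalue $\det(g)^{-1/2}\,\overline{\theta_1}^{\,n_1}\cdots\overline{\theta_d}^{\,n_d}$. 3. $g$ has an eigenvalue of the form $e^{2\pi i\alpha}$ with $\alpha\in\mathbb R$ irrational if and only if $\sigma(\mu(g))=\mathbb S^1$. 4. If $\theta_j=\exp(2\pi i p_j/q_j)$ with $p_j\in\mathbb Z$ and $q_j\in\mathbb N$, $q_j\ge 1$, for all $j$, then $$\sigma_p(\mu(g))=\sigma(\mu(g))=\det(g)^{-1/2}\cdot\{\exp(2\pi i n p/q)\mid n\in\mathbb N_0\},$$ where $q$ is the least common multiple of $q_1,\dots,q_d$ and $p$ is the greatest common divisor of $\frac{q|p_1|}{q_1},\dots,\frac{q|p_d|}{q_d}$ (with $p=0$ if all of these vanish). In particular, $\sigma(\mu(g))$ is a rotation of a finite subgroup of $\mathbb S^1$. -/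

import Mathlib

open MeasureTheory

namespace Metaplectic

noncomputable section

/-- The Hilbert space `L²(ℝᵈ)` of complex valued functions, with Lebesgue measure. -/
abbrev L2 (d : ℕ) : Type :=
  Lp ℂ 2 (volume : Measure (EuclideanSpace ℝ (Fin d)))

/-- The Weyl (Heisenberg translation) operator `exp((i/ℏ)(p·P + q·X))`, where `X` is
multiplication by `x` and `P = -iℏ∇`, acting on functions on `ℝᵈ`:
`f ↦ exp((i/ℏ)(q·x + p·q/2)) f(x + p)`.
The phase space point `(p, q) ∈ ℝ²ᵈ` is identified with `w = p + iq ∈ ℂᵈ`. -/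
def weyl {d : ℕ} (ℏ : ℝ) (w : Fin d → ℂ) (f : EuclideanSpace ℝ (Fin d) → ℂ) :
    EuclideanSpace ℝ (Fin d) → ℂ :=
  fun x =>
    Complex.exp (Complex.I / ℏ *
        ((∑ j, ((w j).im * x j + (w j).re * (w j).im / 2) : ℝ) : ℂ)) *
      f (x + WithLp.toLp 2 (fun j => (w j).re))

/-- `U ρ(w) U⁻¹ = ρ(S w)` for all `w`, with `ρ(w)` the Weyl operators: the unitary operator
`U` implements the linear transformation `S` of phase space. (`h` is the class of `ρ(w) f`.) -/
def Implements {d : ℕ} (ℏ : ℝ) (U : unitary (L2 d →L[ℂ] L2 d))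
    (S : (Fin d → ℂ) → (Fin d → ℂ)) : Prop :=
  ∀ (w : Fin d → ℂ) (f h : L2 d), (h =ᵐ[volume] weyl ℏ w f) →
    ((U : L2 d →L[ℂ] L2 d) h =ᵐ[volume] weyl ℏ (S w) ((U : L2 d →L[ℂ] L2 d) f))

/-- `U f (x) = (det A)^(-1/2) f(A⁻¹ x)` for an invertible real matrix `A`
(either value of the square root). -/
def IsLinearSubstitution {d : ℕ} (U : unitary (L2 d →L[ℂ] L2 d)) : Prop :=
  ∃ (A : Matrix (Fin d) (Fin d) ℝ) (c : ℂ), c ^ 2 * (A.det : ℂ) = 1 ∧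
    ∀ f : L2 d, (U : L2 d →L[ℂ] L2 d) f =ᵐ[volume]
      fun x => c * f (WithLp.toLp 2 (A⁻¹.mulVec (WithLp.ofLp x)))

/-- `U f (x) = exp((i/2ℏ) x·Cx) f(x)` for a real symmetric matrix `C`. -/
def IsChirp {d : ℕ} (ℏ : ℝ) (U : unitary (L2 d →L[ℂ] L2 d)) : Prop :=
  ∃ C : Matrix (Fin d) (Fin d) ℝ, C.IsSymm ∧
    ∀ f : L2 d, (U : L2 d →L[ℂ] L2 d) f =ᵐ[volume]
      fun x => Complex.exp (Complex.I / (2 * ℏ) * ((∑ j, ∑ k, x j * C j k * x k : ℝ) : ℂ)) * f x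

/-- `U = i^(d/2) 𝓕⁻¹` (either value of the square root), with
`𝓕⁻¹ f (x) = (2πℏ)^(-d/2) ∫ exp((i/ℏ) x·y) f(y) dy` for integrable `f ∈ L²`. -/
def IsNormalizedFourier {d : ℕ} (ℏ : ℝ) (U : unitary (L2 d →L[ℂ] L2 d)) : Prop :=
  ∃ c : ℂ, c ^ 2 = Complex.I ^ d ∧
    ∀ f : L2 d, Integrable f volume →
      (U : L2 d →L[ℂ] L2 d) f =ᵐ[volume]
        fun x => c * (((2 * Real.pi * ℏ) ^ (-(d : ℝ) / 2) : ℝ) : ℂ) *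
          ∫ y : EuclideanSpace ℝ (Fin d),
            Complex.exp (Complex.I / ℏ * ((∑ j, x j * y j : ℝ) : ℂ)) * f y

/-- The metaplectic group `Mp(d)`, as a group of unitary operators on `L²(ℝᵈ)`, with Planck
constant `ℏ`: it is generated by the metaplectic operators of the standard generators of the
real symplectic group. -/
def metaplecticGroup (ℏ : ℝ) (d : ℕ) : Subgroup (unitary (L2 d →L[ℂ] L2 d)) :=
  Subgroup.closure {U | IsLinearSubstitution U ∨ IsChirp ℏ U ∨ IsNormalizedFourier ℏ U}

/-- `U` is (one of the two values `±μ_ℏ(g)` of) the metaplectic operator of the unitary matrix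
`g`, which acts on phase space `ℝ²ᵈ ≅ ℂᵈ`, `(p, q) ↦ p + iq`, as a symplectic map. -/
def IsMetaplecticOperator {d : ℕ} (ℏ : ℝ) (g : Matrix.unitaryGroup (Fin d) ℂ)
    (U : unitary (L2 d →L[ℂ] L2 d)) : Prop :=
  U ∈ metaplecticGroup ℏ d ∧ Implements ℏ U (fun w => (g : Matrix (Fin d) (Fin d) ℂ).mulVec w)

/-- The kernel `K(z, x) = (πℏ)^(-d/4) exp(√(2π/ℏ) z·x - |x|²/(2ℏ) - (π/2) z·z)` of the Bargmann
transform `(B f)(z) = ∫ K(z, x) f(x) dx`, a unitary operator from `L²(ℝᵈ)` onto the space of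
holomorphic functions on `ℂᵈ` that are square integrable for `exp(-π|z|²) dz`. For `ℏ = 1/(2π)`
it is `2^(d/4) exp(2π z·x - π|x|² - (π/2) z·z)`. -/
def bargmannKernel {d : ℕ} (ℏ : ℝ) (z : Fin d → ℂ) (x : EuclideanSpace ℝ (Fin d)) : ℂ :=
  (((Real.pi * ℏ) ^ (-(d : ℝ) / 4) : ℝ) : ℂ) *
    Complex.exp (((Real.sqrt (2 * Real.pi / ℏ) : ℝ) : ℂ) * (∑ j, z j * (x j : ℂ))
      - ((∑ j, x j ^ 2 : ℝ) : ℂ) / (2 * ℏ) - Real.pi / 2 * ∑ j, z j ^ 2)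

/-- The adjoint of the Bargmann transform:
`(B* F)(x) = ∫ conj(K(z, x)) F(z) exp(-π|z|²) dz`. -/
def bargmannAdjoint {d : ℕ} (ℏ : ℝ) (F : (Fin d → ℂ) → ℂ) : EuclideanSpace ℝ (Fin d) → ℂ :=
  fun x => ∫ z : Fin d → ℂ,
    star (bargmannKernel ℏ z x) * F z * ((Real.exp (-Real.pi * ∑ j, ‖z j‖ ^ 2) : ℝ) : ℂ)

/-- The polynomial `q(z) = ∏ₖ (∑ⱼ ⟨vₖ, eⱼ⟩ zⱼ) ^ nₖ` (the inner product is conjugate linear in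
the first variable). -/
def eigenPolynomial {d : ℕ} (v : Fin d → EuclideanSpace ℂ (Fin d)) (n : Fin d → ℕ)
    (z : Fin d → ℂ) : ℂ :=
  ∏ k, (∑ j, inner ℂ (v k) (EuclideanSpace.single j (1 : ℂ)) * z j) ^ n k

/-- The point spectrum (set of eigenvalues) of a bounded operator. -/
def pointSpectrum {d : ℕ} (T : L2 d →L[ℂ] L2 d) : Set ℂ :=
  {a | Module.End.HasEigenvalue (T : L2 d →ₗ[ℂ] L2 d) a}

end

end Metaplectic

/-!
# The spectrum of metaplectic operators of unitary matrices

Everything is decided by the Gaussian ground state `exp(-|x|²/2ℏ)` and its translates, the coherent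
states.

*Existence.* A unitary matrix whose imaginary part is invertible is a product of two chirps, a
linear substitution and the Fourier transform, and every unitary matrix is a product of two of this
kind, one of them scalar (`exists_isMetaplecticOperator`).

*The square root of the determinant.* A frame `(X; Q)` of a positive Lagrangian subspace of `ℂ²ᵈ`
determines the two Gaussians `s exp(-(1/2ℏ) x·(i Q X⁻¹)x)` with `s² det X = 1`. Every element of the
metaplectic group implements some real symplectic matrix `S` and sends the pair of Gaussians of each
frame `F` to the pair of `S F`; this is checked on the generators (`exists_covers`). An operator
determines the map that it implements (`Implements.unique`), so that `S` is the real form of `g` if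
the operator implements `g`. This `S` maps the frame `(1; -i)` of the ground state to `(g; -i g)`,
which has the same quadratic form but `det X = det g`. Hence the ground state is multiplied by some
`ζ` with `ζ² det g = 1` (`exists_apply_groundState`).

*The Bargmann representation.* Translating the ground state shows that the operator maps the
coherent state at `z` to `ζ` times the coherent state at `g z`. Since the adjoint Bargmann transform
superposes coherent states, it acts as `F ↦ ζ F ∘ g⁻¹` (`apply_bargmannAdjoint`). A product of
powers of the linear forms `⟨v_k, ·⟩`, with `v_k` eigenvectors of `g`, is an eigenfunction of this
substitution with eigenvalue `∏ θ̄_k ^ n_k`, and by the reproducing formula, a consequence of the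
mean value property, its Bargmann adjoint does not vanish.

*Totality.* A function orthogonal to all these eigenvectors is orthogonal to the Bargmann adjoints
of all exponentials of linear forms, by expanding these in power series. These Bargmann
adjoints are the coherent states. Hence the product of the function with a Gaussian has Fourier
transform zero, and the function vanishes (`eq_zero_of_inner_bargmannAdjoint`). As eigenvectors of
distinct eigenvalues of a unitary operator are orthogonal, there are no further eigenvalues.

*The spectrum.* If all `θ_j` are roots of unity, there are finitely many eigenvalues `λ`, the
product `∏ (U - λ)` vanishes on a total set, and the spectrum consists of eigenvalues
(`spectrum_subset_of_finite`). Otherwise some `θ_j` is an irrational rotation, the eigenvalues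
are dense in the unit circle, and the spectrum, being closed, is the circle.
-/

namespace Metaplectic

noncomputable section

/-! ### Unitary operators from weighted changes of variables -/

/-- A unitary operator from a surjective linear isometry of `L²(ℝᵈ)`. -/
def unitaryOfIsometry {d : ℕ} (V : L2 d →ₗᵢ[ℂ] L2 d) (hV : Function.Surjective V) :
    unitary (L2 d →L[ℂ] L2 d) :=
  Unitary.linearIsometryEquiv.symm (LinearIsometryEquiv.ofSurjective V hV)

lemma unitaryOfIsometry_apply {d : ℕ} (V : L2 d →ₗᵢ[ℂ] L2 d) (hV : Function.Surjective V)
    (f : L2 d) : (unitaryOfIsometry V hV : L2 d →L[ℂ] L2 d) f = V f := rfl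

section weighted

variable {d : ℕ} {T : EuclideanSpace ℝ (Fin d) ≃ᵐ EuclideanSpace ℝ (Fin d)}
  {m : EuclideanSpace ℝ (Fin d) → ℂ} {r : ℝ}

lemma quasiMeasurePreserving_of_map_eq {c : ENNReal}
    (hT : Measure.map T volume = c • volume) :
    Measure.QuasiMeasurePreserving T volume volume :=
  ⟨T.measurable, by rw [hT]; exact Measure.smul_absolutelyContinuous⟩

lemma eLpNorm_weighted (hr : 0 < r) (hmr : ∀ x, ‖m x‖ = r)
    (hT : Measure.map T volume = ENNReal.ofReal (r ^ 2)⁻¹ • volume)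
    (f : EuclideanSpace ℝ (Fin d) → ℂ) :
    eLpNorm (fun x => m x * f (T x)) 2 volume = eLpNorm f 2 volume := by
  have h1 : eLpNorm (fun x => m x * f (T x)) 2 volume
      = eLpNorm ((r : ℂ) • (f ∘ T)) 2 volume := by
    refine eLpNorm_congr_norm_ae (Filter.Eventually.of_forall fun x => ?_)
    simp [hmr, abs_of_pos hr]
  rw [h1, eLpNorm_const_smul, ← T.measurableEmbedding.eLpNorm_map_measure, hT,
    eLpNorm_smul_measure_of_ne_top (by simp)]
  have h2 : ‖(r : ℂ)‖ₑ = ENNReal.ofReal r := by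
    rw [← ofReal_norm]; simp [abs_of_pos hr]
  rw [h2, smul_eq_mul, ← mul_assoc, ENNReal.ofReal_rpow_of_nonneg (by positivity) (by simp),
    ← ENNReal.ofReal_mul hr.le]
  have h3 : r * (r ^ 2)⁻¹ ^ (1 / (2 : ENNReal)).toReal = 1 := by
    have : (1 / (2 : ENNReal)).toReal = 1 / 2 := by simp
    rw [this, Real.inv_rpow (by positivity), ← Real.sqrt_eq_rpow, Real.sqrt_sq hr.le]
    field_simp
  rw [h3]; simp

lemma memLp_weighted (hm : Measurable m) (hr : 0 < r) (hmr : ∀ x, ‖m x‖ = r)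
    (hT : Measure.map T volume = ENNReal.ofReal (r ^ 2)⁻¹ • volume)
    {f : EuclideanSpace ℝ (Fin d) → ℂ} (hf : MemLp f 2 volume) :
    MemLp (fun x => m x * f (T x)) 2 volume :=
  ⟨hm.aestronglyMeasurable.mul
    (hf.1.comp_quasiMeasurePreserving (quasiMeasurePreserving_of_map_eq hT)), by
    rw [eLpNorm_weighted hr hmr hT]; exact hf.2⟩

/-- The operator `f ↦ m · (f ∘ T)` is unitary on `L²(ℝᵈ)` if the constant `|m|²` compensates
the Jacobian of `T`. -/
theorem exists_unitary_weighted (hm : Measurable m) (hr : 0 < r) (hmr : ∀ x, ‖m x‖ = r)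
    (hT : Measure.map T volume = ENNReal.ofReal (r ^ 2)⁻¹ • volume) :
    ∃ U : unitary (L2 d →L[ℂ] L2 d), ∀ f : L2 d,
      (U : L2 d →L[ℂ] L2 d) f =ᵐ[volume] fun x => m x * f (T x) := by
  have qT := quasiMeasurePreserving_of_map_eq hT
  let V : L2 d →ₗᵢ[ℂ] L2 d :=
    { toFun := fun f => (memLp_weighted hm hr hmr hT (Lp.memLp f)).toLp _
      map_add' := fun f g => by
        rw [← MemLp.toLp_add]
        refine MemLp.toLp_congr _ _ ?_
        filter_upwards [qT.ae (Lp.coeFn_add f g)] with x hx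
        simp only [Pi.add_apply] at hx ⊢
        rw [hx, mul_add]
      map_smul' := fun c f => by
        rw [RingHom.id_apply, ← MemLp.toLp_const_smul]
        refine MemLp.toLp_congr _ _ ?_
        filter_upwards [qT.ae (Lp.coeFn_smul c f)] with x hx
        simp only [Pi.smul_apply, smul_eq_mul] at hx ⊢
        rw [hx]; ring
      norm_map' := fun f => by
        simp only [LinearMap.coe_mk, AddHom.coe_mk]
        rw [Lp.norm_toLp, eLpNorm_weighted hr hmr hT, Lp.norm_def] }
  have hV : ∀ f, V f =ᵐ[volume] fun x => m x * f (T x) := fun f =>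
    MemLp.coeFn_toLp (memLp_weighted hm hr hmr hT (Lp.memLp f))
  -- the inverse is the weighted change of variables with `T⁻¹` and weight `1 / (m ∘ T⁻¹)`
  have hT' : Measure.map T.symm volume = ENNReal.ofReal (r⁻¹ ^ 2)⁻¹ • volume := by
    have h0 : volume = ENNReal.ofReal (r ^ 2)⁻¹ • Measure.map T.symm volume := by
      rw [← Measure.map_smul, ← hT, T.map_symm_map]
    have h1 : ENNReal.ofReal (r⁻¹ ^ 2)⁻¹ * ENNReal.ofReal (r ^ 2)⁻¹ = 1 := by
      rw [← ENNReal.ofReal_mul (by positivity)]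
      have : (r⁻¹ ^ 2)⁻¹ * (r ^ 2)⁻¹ = 1 := by field_simp
      rw [this, ENNReal.ofReal_one]
    conv_rhs => rw [h0]
    rw [smul_smul, h1, one_smul]
  have hm' : Measurable fun x => (m (T.symm x))⁻¹ := (hm.comp T.symm.measurable).inv
  have hV' : Function.Surjective V := by
    intro f
    have hf' := memLp_weighted hm' (inv_pos.2 hr) (fun x => by rw [norm_inv, hmr]) hT' (Lp.memLp f)
    refine ⟨hf'.toLp _, ?_⟩
    refine Lp.ext ((hV _).trans ?_)
    filter_upwards [qT.ae hf'.coeFn_toLp] with x hx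
    rw [hx, T.symm_apply_apply, mul_inv_cancel_left₀]
    intro h0
    have := hmr x
    rw [h0, norm_zero] at this
    exact hr.ne this
  exact ⟨unitaryOfIsometry V hV', fun f => by rw [unitaryOfIsometry_apply]; exact hV f⟩

end weighted

/-! ### The Weyl operators -/

lemma measurable_weyl_phase {d : ℕ} (ℏ : ℝ) (w : Fin d → ℂ) :
    Measurable fun x : EuclideanSpace ℝ (Fin d) => Complex.exp (Complex.I / ℏ *
        ((∑ j, ((w j).im * x j + (w j).re * (w j).im / 2) : ℝ) : ℂ)) := by
  apply Continuous.measurable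
  fun_prop

lemma norm_exp_I_div_mul (ℏ t : ℝ) : ‖Complex.exp (Complex.I / ℏ * (t : ℂ))‖ = 1 := by
  rw [Complex.norm_exp]
  have : (Complex.I / ℏ * (t : ℂ)) = ((t / ℏ : ℝ) : ℂ) * Complex.I := by
    push_cast; ring
  rw [this]
  simp

theorem exists_unitary_weyl {d : ℕ} (ℏ : ℝ) (w : Fin d → ℂ) :
    ∃ U : unitary (L2 d →L[ℂ] L2 d), ∀ f : L2 d,
      (U : L2 d →L[ℂ] L2 d) f =ᵐ[volume] weyl ℏ w f := by
  refine exists_unitary_weighted (T := MeasurableEquiv.addRight (WithLp.toLp 2 fun j => (w j).re))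
    (measurable_weyl_phase ℏ w) one_pos (fun x => norm_exp_I_div_mul ℏ _) ?_
  simpa using map_add_right_eq_self volume (WithLp.toLp 2 fun j => (w j).re)

/-- The Weyl operator `ρ(w)` as a unitary operator on `L²(ℝᵈ)`. -/
def weylOp {d : ℕ} (ℏ : ℝ) (w : Fin d → ℂ) : L2 d →L[ℂ] L2 d :=
  (exists_unitary_weyl ℏ w).choose

lemma weylOp_ae_eq {d : ℕ} (ℏ : ℝ) (w : Fin d → ℂ) (f : L2 d) :
    weylOp ℏ w f =ᵐ[volume] weyl ℏ w f :=
  (exists_unitary_weyl ℏ w).choose_spec f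

lemma weyl_congr {d : ℕ} (ℏ : ℝ) (w : Fin d → ℂ) {f g : EuclideanSpace ℝ (Fin d) → ℂ}
    (h : f =ᵐ[volume] g) : weyl ℏ w f =ᵐ[volume] weyl ℏ w g := by
  have := (measurePreserving_add_right volume
    (WithLp.toLp 2 fun j => (w j).re : EuclideanSpace ℝ (Fin d))).quasiMeasurePreserving.ae h
  filter_upwards [this] with x hx
  simp only [weyl]
  rw [hx]

lemma implements_iff {d : ℕ} {ℏ : ℝ} {U : unitary (L2 d →L[ℂ] L2 d)}
    {S : (Fin d → ℂ) → (Fin d → ℂ)} :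
    Implements ℏ U S ↔ ∀ w f, (U : L2 d →L[ℂ] L2 d) (weylOp ℏ w f) =
      weylOp ℏ (S w) ((U : L2 d →L[ℂ] L2 d) f) := by
  constructor
  · intro h w f
    exact Lp.ext ((h w f _ (weylOp_ae_eq ℏ w f)).trans (weylOp_ae_eq ℏ (S w) _).symm)
  · intro h w f k hk
    have : k = weylOp ℏ w f := Lp.ext (hk.trans (weylOp_ae_eq ℏ w f).symm)
    rw [this, h w f]
    exact weylOp_ae_eq ℏ (S w) _

lemma Implements.mul {d : ℕ} {ℏ : ℝ} {U V : unitary (L2 d →L[ℂ] L2 d)}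
    {S T : (Fin d → ℂ) → (Fin d → ℂ)} (hU : Implements ℏ U S) (hV : Implements ℏ V T) :
    Implements ℏ (U * V) (fun w => S (T w)) := by
  rw [implements_iff] at *
  intro w f
  have h := hU (T w) ((V : L2 d →L[ℂ] L2 d) f)
  rw [← hV w f] at h
  exact h

lemma unitary_inv_apply_apply {d : ℕ} (U : unitary (L2 d →L[ℂ] L2 d)) (f : L2 d) :
    ((U⁻¹ : unitary (L2 d →L[ℂ] L2 d)) : L2 d →L[ℂ] L2 d) ((U : L2 d →L[ℂ] L2 d) f) = f := by
  have : (U⁻¹ * U : unitary (L2 d →L[ℂ] L2 d)) = 1 := inv_mul_cancel U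
  exact congrArg (fun V : unitary (L2 d →L[ℂ] L2 d) => (V : L2 d →L[ℂ] L2 d) f) this

lemma unitary_apply_inv_apply {d : ℕ} (U : unitary (L2 d →L[ℂ] L2 d)) (f : L2 d) :
    (U : L2 d →L[ℂ] L2 d) (((U⁻¹ : unitary (L2 d →L[ℂ] L2 d)) : L2 d →L[ℂ] L2 d) f) = f := by
  simpa using unitary_inv_apply_apply U⁻¹ f

lemma Implements.inv {d : ℕ} {ℏ : ℝ} {U : unitary (L2 d →L[ℂ] L2 d)}
    {S T : (Fin d → ℂ) → (Fin d → ℂ)} (hU : Implements ℏ U S) (hST : ∀ w, S (T w) = w) :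
    Implements ℏ U⁻¹ T := by
  rw [implements_iff] at *
  intro w f
  have h := hU (T w) (((U⁻¹ : unitary (L2 d →L[ℂ] L2 d)) : L2 d →L[ℂ] L2 d) f)
  rw [hST, unitary_apply_inv_apply] at h
  rw [← h, unitary_inv_apply_apply]

end

end Metaplectic

namespace Metaplectic

noncomputable section

/-! ### Phase space maps and the operators implementing them -/

/-- The real linear map of phase space `ℂᵈ ≅ ℝ²ᵈ`, `p + iq ↔ (p, q)`, given by a real
`2d × 2d` matrix. -/
def phaseMap {d : ℕ} (S : Matrix (Fin d ⊕ Fin d) (Fin d ⊕ Fin d) ℝ) (w : Fin d → ℂ) :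
    Fin d → ℂ :=
  fun j => ⟨S.mulVec (Sum.elim (fun k => (w k).re) (fun k => (w k).im)) (Sum.inl j),
    S.mulVec (Sum.elim (fun k => (w k).re) (fun k => (w k).im)) (Sum.inr j)⟩

lemma phaseMap_mul {d : ℕ} (S T : Matrix (Fin d ⊕ Fin d) (Fin d ⊕ Fin d) ℝ) (w : Fin d → ℂ) :
    phaseMap (S * T) w = phaseMap S (phaseMap T w) := by
  have h : (Sum.elim (fun k => (phaseMap T w k).re) (fun k => (phaseMap T w k).im))
      = T.mulVec (Sum.elim (fun k => (w k).re) (fun k => (w k).im)) := by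
    ext (j | j) <;> rfl
  funext j
  apply Complex.ext <;> simp only [phaseMap] <;> rw [← Matrix.mulVec_mulVec] <;>
    exact congrFun (congrArg _ h.symm) _

lemma phaseMap_one {d : ℕ} (w : Fin d → ℂ) : phaseMap 1 w = w := by
  funext j
  apply Complex.ext <;> simp [phaseMap]

open scoped Matrix in
lemma weyl_apply {d : ℕ} (ℏ : ℝ) (w : Fin d → ℂ) (f : EuclideanSpace ℝ (Fin d) → ℂ)
    (x : EuclideanSpace ℝ (Fin d)) :
    weyl ℏ w f x = Complex.exp (Complex.I / ℏ *
      (((fun j => (w j).im) ⬝ᵥ WithLp.ofLp x +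
        ((fun j => (w j).re) ⬝ᵥ (fun j => (w j).im)) / 2 : ℝ) : ℂ)) *
      f (x + WithLp.toLp 2 (fun j => (w j).re)) := by
  simp only [weyl, dotProduct, Finset.sum_add_distrib, Finset.sum_div]

/-- An invertible real matrix as a measurable automorphism of `ℝᵈ`. -/
def matrixEquiv {d : ℕ} (A : Matrix (Fin d) (Fin d) ℝ) (hA : IsUnit A.det) :
    EuclideanSpace ℝ (Fin d) ≃ᵐ EuclideanSpace ℝ (Fin d) where
  toFun x := WithLp.toLp 2 (A.mulVec (WithLp.ofLp x))
  invFun x := WithLp.toLp 2 (A⁻¹.mulVec (WithLp.ofLp x))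
  left_inv x := by simp [Matrix.nonsing_inv_mul A hA]
  right_inv x := by simp [Matrix.mul_nonsing_inv A hA]
  measurable_toFun := by
    apply Continuous.measurable
    exact (PiLp.continuous_toLp 2 _).comp
      ((Continuous.matrix_mulVec continuous_const continuous_id).comp (PiLp.continuous_ofLp 2 _))
  measurable_invFun := by
    apply Continuous.measurable
    exact (PiLp.continuous_toLp 2 _).comp
      ((Continuous.matrix_mulVec continuous_const continuous_id).comp (PiLp.continuous_ofLp 2 _))

lemma matrixEquiv_apply {d : ℕ} (A : Matrix (Fin d) (Fin d) ℝ) (hA : IsUnit A.det)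
    (x : EuclideanSpace ℝ (Fin d)) :
    matrixEquiv A hA x = WithLp.toLp 2 (A.mulVec (WithLp.ofLp x)) := rfl

lemma map_matrixEquiv {d : ℕ} (A : Matrix (Fin d) (Fin d) ℝ) (hA : IsUnit A.det) :
    Measure.map (matrixEquiv A hA) volume = ENNReal.ofReal |A.det|⁻¹ • volume := by
  have h1 : (matrixEquiv A hA : EuclideanSpace ℝ (Fin d) → EuclideanSpace ℝ (Fin d))
      = Matrix.toEuclideanLin A := rfl
  have h2 : LinearMap.det (Matrix.toEuclideanLin A) = A.det := by
    simp
  rw [h1, Measure.map_linearMap_addHaar_eq_smul_addHaar volume (by rw [h2]; exact hA.ne_zero), h2,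
    abs_inv]

theorem exists_isLinearSubstitution {d : ℕ} (A : Matrix (Fin d) (Fin d) ℝ) (hA : IsUnit A.det) :
    ∃ U : unitary (L2 d →L[ℂ] L2 d), ∃ c : ℂ, c ^ 2 * (A.det : ℂ) = 1 ∧
    ∀ f : L2 d, (U : L2 d →L[ℂ] L2 d) f =ᵐ[volume]
      fun x => c * f (WithLp.toLp 2 (A⁻¹.mulVec (WithLp.ofLp x))) := by
  have hA0 : (A.det : ℂ) ≠ 0 := by exact_mod_cast hA.ne_zero
  obtain ⟨c, hc⟩ := IsAlgClosed.exists_pow_nat_eq ((A.det : ℂ)⁻¹) two_pos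
  have hcA : c ^ 2 * (A.det : ℂ) = 1 := by rw [hc, inv_mul_cancel₀ hA0]
  have hc0 : c ≠ 0 := by rintro rfl; simp at hcA
  have hAi : IsUnit (A⁻¹).det := Matrix.isUnit_nonsing_inv_det A hA
  have hn : (‖c‖ ^ 2)⁻¹ = |A⁻¹.det|⁻¹ := by
    have := congrArg norm hcA
    rw [norm_mul, norm_pow, Complex.norm_real, norm_one, Real.norm_eq_abs] at this
    rw [Matrix.det_nonsing_inv, Ring.inverse_eq_inv', abs_inv, inv_inv]
    exact inv_eq_of_mul_eq_one_right this
  obtain ⟨U, hU⟩ := exists_unitary_weighted (T := matrixEquiv A⁻¹ hAi) (m := fun _ => c)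
    measurable_const (norm_pos_iff.2 hc0) (fun _ => rfl) (by rw [hn]; exact map_matrixEquiv _ _)
  exact ⟨U, c, hcA, hU⟩

open scoped Matrix in
theorem implements_of_substitution {d : ℕ} (ℏ : ℝ) {U : unitary (L2 d →L[ℂ] L2 d)}
    {A : Matrix (Fin d) (Fin d) ℝ} {c : ℂ} (hc : c ^ 2 * (A.det : ℂ) = 1)
    (hU : ∀ f : L2 d, (U : L2 d →L[ℂ] L2 d) f =ᵐ[volume]
      fun x => c * f (WithLp.toLp 2 (A⁻¹.mulVec (WithLp.ofLp x)))) :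
    Implements ℏ U (phaseMap (Matrix.fromBlocks A 0 0 A⁻¹ᵀ)) := by
  have hA : IsUnit A.det := by
    rw [isUnit_iff_ne_zero]; rintro h; simp [h] at hc
  have hAi : IsUnit (A⁻¹).det := Matrix.isUnit_nonsing_inv_det A hA
  have hq : Measure.QuasiMeasurePreserving (matrixEquiv A⁻¹ hAi) volume volume :=
    quasiMeasurePreserving_of_map_eq (map_matrixEquiv _ _)
  intro w f h hh
  refine (hU h).trans (Filter.EventuallyEq.trans ?_ (weyl_congr _ _ (hU f)).symm)
  filter_upwards [hq.ae hh] with x hx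
  rw [matrixEquiv_apply] at hx
  rw [hx, weyl_apply, weyl_apply]
  have e1 : (fun j => (phaseMap (Matrix.fromBlocks A 0 0 A⁻¹ᵀ) w j).re)
      = A *ᵥ (fun j => (w j).re) := by
    funext j; simp [phaseMap, Matrix.fromBlocks_mulVec]
  have e2 : (fun j => (phaseMap (Matrix.fromBlocks A 0 0 A⁻¹ᵀ) w j).im)
      = A⁻¹ᵀ *ᵥ (fun j => (w j).im) := by
    funext j; simp [phaseMap, Matrix.fromBlocks_mulVec]
  rw [e1, e2]
  have e3 : ∀ y : Fin d → ℝ, (A⁻¹ᵀ *ᵥ (fun j => (w j).im)) ⬝ᵥ y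
      = (fun j => (w j).im) ⬝ᵥ A⁻¹ *ᵥ y := by
    intro y
    rw [Matrix.mulVec_transpose, Matrix.dotProduct_mulVec]
  have e4 : (A *ᵥ fun j => (w j).re) ⬝ᵥ (A⁻¹ᵀ *ᵥ fun j => (w j).im)
      = (fun j => (w j).re) ⬝ᵥ (fun j => (w j).im) := by
    rw [dotProduct_comm, e3, Matrix.mulVec_mulVec, Matrix.nonsing_inv_mul A hA, Matrix.one_mulVec,
      dotProduct_comm]
  rw [e3, e4]
  have e5 : WithLp.toLp 2 (A⁻¹ *ᵥ (WithLp.ofLp (x + WithLp.toLp 2 (A *ᵥ fun j => (w j).re))))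
      = WithLp.toLp 2 (A⁻¹ *ᵥ WithLp.ofLp x) + WithLp.toLp 2 fun j => (w j).re := by
    rw [WithLp.ofLp_add, Matrix.mulVec_add, WithLp.toLp_add, Matrix.mulVec_mulVec,
      Matrix.nonsing_inv_mul A hA, Matrix.one_mulVec]
  rw [e5]
  ring

open scoped Matrix in
lemma sum_sum_eq_dotProduct {d : ℕ} (C : Matrix (Fin d) (Fin d) ℝ) (x : Fin d → ℝ) :
    ∑ j, ∑ k, x j * C j k * x k = x ⬝ᵥ C *ᵥ x := by
  simp only [dotProduct, Matrix.mulVec, Finset.mul_sum, mul_assoc]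

theorem exists_isChirp {d : ℕ} (ℏ : ℝ) (C : Matrix (Fin d) (Fin d) ℝ) :
    ∃ U : unitary (L2 d →L[ℂ] L2 d), ∀ f : L2 d, (U : L2 d →L[ℂ] L2 d) f =ᵐ[volume]
      fun x => Complex.exp (Complex.I / (2 * ℏ) * ((∑ j, ∑ k, x j * C j k * x k : ℝ) : ℂ)) *
        f x := by
  refine exists_unitary_weighted (T := MeasurableEquiv.refl _) (Continuous.measurable (by fun_prop))
    one_pos (fun x => ?_) ?_
  · have := norm_exp_I_div_mul (2 * ℏ) (∑ j, ∑ k, x j * C j k * x k)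
    rw [← this]; push_cast; rfl
  · have : ⇑(MeasurableEquiv.refl (EuclideanSpace ℝ (Fin d))) = id := rfl
    rw [this, Measure.map_id]; simp

open scoped Matrix in
theorem implements_of_chirp {d : ℕ} {ℏ : ℝ} {U : unitary (L2 d →L[ℂ] L2 d)}
    {C : Matrix (Fin d) (Fin d) ℝ} (hC : C.IsSymm)
    (hU : ∀ f : L2 d, (U : L2 d →L[ℂ] L2 d) f =ᵐ[volume]
      fun x => Complex.exp (Complex.I / (2 * ℏ) * ((∑ j, ∑ k, x j * C j k * x k : ℝ) : ℂ)) * f x) :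
    Implements ℏ U (phaseMap (Matrix.fromBlocks 1 0 (-C) 1)) := by
  intro w f h hh
  refine (hU h).trans (Filter.EventuallyEq.trans ?_ (weyl_congr _ _ (hU f)).symm)
  filter_upwards [hh] with x hx
  rw [hx, weyl_apply, weyl_apply]
  have e1 : (fun j => (phaseMap (Matrix.fromBlocks 1 0 (-C) 1) w j).re)
      = (fun j => (w j).re) := by
    funext j; simp [phaseMap, Matrix.fromBlocks_mulVec]
  have e2 : (fun j => (phaseMap (Matrix.fromBlocks 1 0 (-C) 1) w j).im)
      = (fun j => (w j).im) - C *ᵥ (fun j => (w j).re) := by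
    funext j
    simp [phaseMap, Matrix.fromBlocks_mulVec, Matrix.neg_mulVec]
    rw [neg_add_eq_sub]
  rw [e1, e2, sum_sum_eq_dotProduct, sum_sum_eq_dotProduct]
  generalize (fun j => (w j).re) = p
  generalize (fun j => (w j).im) = q
  have hs : ∀ y z : Fin d → ℝ, (C *ᵥ y) ⬝ᵥ z = y ⬝ᵥ C *ᵥ z := by
    intro y z
    rw [Matrix.dotProduct_mulVec, ← Matrix.mulVec_transpose, hC.eq]
  rw [← mul_assoc, ← mul_assoc, ← Complex.exp_add, ← Complex.exp_add]
  congr 2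
  rw [WithLp.ofLp_add, WithLp.ofLp_toLp, Matrix.mulVec_add]
  generalize WithLp.ofLp x = y
  have h1 : y ⬝ᵥ C *ᵥ p = p ⬝ᵥ C *ᵥ y := by rw [← hs, dotProduct_comm]
  simp only [add_dotProduct, dotProduct_add, sub_dotProduct, dotProduct_sub, hs, h1]
  rcases eq_or_ne ℏ 0 with rfl | h0
  · simp
  have h0' : (ℏ : ℂ) ≠ 0 := by exact_mod_cast h0
  push_cast
  field_simp
  ring

end

end Metaplectic

namespace Metaplectic

noncomputable section

/-! ### The Fourier transform as a metaplectic generator -/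

open scoped FourierTransform in
lemma integral_fourierInv_mul_eq_of_integrable {d : ℕ} {φ f : EuclideanSpace ℝ (Fin d) → ℂ}
    (hφ : Integrable φ) (hf : Integrable f) :
    ∫ ξ, 𝓕⁻ φ ξ * f ξ = ∫ x, φ x * 𝓕⁻ f x := by
  have h := VectorFourier.integral_fourierIntegral_smul_eq_flip (μ := volume) (ν := volume)
    (L := -(innerₗ (EuclideanSpace ℝ (Fin d)))) Real.continuous_fourierChar
    (by simp only [LinearMap.neg_apply, innerₗ_apply_apply]; exact continuous_inner.neg) hφ hf
  simp only [VectorFourier.fourierIntegral, LinearMap.neg_apply, LinearMap.flip_apply,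
    innerₗ_apply_apply, neg_neg, smul_eq_mul] at h
  simp only [Real.fourierInv_eq]
  rw [h]
  congr 1
  ext x
  simp only [real_inner_comm]

open scoped FourierTransform in
/-- On `L¹ ∩ L²` the Fourier transform of `L²` is given by the Fourier integral. -/
theorem fourierInv_Lp_ae_eq {d : ℕ} (f : L2 d) (hf : Integrable f volume) :
    ((𝓕⁻ f : L2 d) : EuclideanSpace ℝ (Fin d) → ℂ) =ᵐ[volume]
      𝓕⁻ (f : EuclideanSpace ℝ (Fin d) → ℂ) := by
  have hcont : Continuous (𝓕⁻ (f : EuclideanSpace ℝ (Fin d) → ℂ)) := by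
    have hf1 : MemLp (f : EuclideanSpace ℝ (Fin d) → ℂ) 1 volume := memLp_one_iff_integrable.2 hf
    rw [← Real.Lp.fourierTransformInv_toLp hf1]
    exact (Real.Lp.fourierTransformInv hf1.toLp).continuous
  refine ae_eq_of_integral_contDiff_smul_eq ((Lp.memLp (𝓕⁻ f)).locallyIntegrable (by norm_num))
    hcont.locallyIntegrable fun g hg hgc => ?_
  have hgc' : HasCompactSupport fun x => (g x : ℂ) := hgc.comp_left (g := fun t : ℝ => (t : ℂ)) rfl
  let φ : SchwartzMap (EuclideanSpace ℝ (Fin d)) ℂ := hgc'.toSchwartzMap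
    (Complex.ofRealCLM.contDiff.comp hg)
  have h1 := congrArg (fun T => T φ) (Lp.fourierInv_toTemperedDistribution_eq f)
  simp only [TemperedDistribution.fourierInv_apply, Lp.toTemperedDistribution_apply,
    smul_eq_mul] at h1
  rw [SchwartzMap.fourierInv_coe, integral_fourierInv_mul_eq_of_integrable φ.integrable hf] at h1
  simp only [Complex.real_smul]
  exact h1.symm

open scoped FourierTransform in
theorem exists_isNormalizedFourier {d : ℕ} {ℏ : ℝ} (hℏ : 0 < ℏ) :
    ∃ U : unitary (L2 d →L[ℂ] L2 d), ∃ c : ℂ, c ^ 2 = Complex.I ^ d ∧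
    ∀ f : L2 d, Integrable f volume →
      (U : L2 d →L[ℂ] L2 d) f =ᵐ[volume]
        fun x => c * (((2 * Real.pi * ℏ) ^ (-(d : ℝ) / 2) : ℝ) : ℂ) *
          ∫ y : EuclideanSpace ℝ (Fin d),
            Complex.exp (Complex.I / ℏ * ((∑ j, x j * y j : ℝ) : ℂ)) * f y := by
  obtain ⟨c, hc⟩ := IsAlgClosed.exists_pow_nat_eq (Complex.I ^ d) two_pos
  have hcn : ‖c‖ = 1 := by
    have := congrArg norm hc
    rw [norm_pow, norm_pow, Complex.norm_I, one_pow] at this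
    exact (pow_eq_one_iff_of_nonneg (norm_nonneg _) two_ne_zero).1 this
  have hpos : 0 < 2 * Real.pi * ℏ := by positivity
  set k : ℝ := (2 * Real.pi * ℏ) ^ (-(d : ℝ) / 2) with hk
  have hkpos : 0 < k := Real.rpow_pos_of_pos hpos _
  -- the dilation `x ↦ x / (2πℏ)`
  let A : Matrix (Fin d) (Fin d) ℝ := Matrix.diagonal fun _ => (2 * Real.pi * ℏ)⁻¹
  have hdet : A.det = ((2 * Real.pi * ℏ)⁻¹) ^ d := by simp [A]
  have hA : IsUnit A.det := by
    rw [hdet]; exact (pow_ne_zero _ (inv_ne_zero hpos.ne')).isUnit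
  obtain ⟨V, hV⟩ := exists_unitary_weighted (T := matrixEquiv A hA) (m := fun _ => c * k)
    measurable_const hkpos (fun _ => by simp [hcn, abs_of_pos hkpos]) (by
      rw [map_matrixEquiv]
      congr 3
      rw [hdet, abs_of_pos (by positivity), hk, ← Real.rpow_natCast, ← Real.rpow_natCast,
        ← Real.rpow_mul hpos.le, Real.inv_rpow hpos.le, ← Real.rpow_neg hpos.le]
      congr 1; push_cast; ring)
  refine ⟨V * Unitary.linearIsometryEquiv.symm
    (Lp.fourierTransformₗᵢ (EuclideanSpace ℝ (Fin d)) ℂ).symm, c, hc, fun f hf => ?_⟩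
  have h1 : ((V * Unitary.linearIsometryEquiv.symm
    (Lp.fourierTransformₗᵢ (EuclideanSpace ℝ (Fin d)) ℂ).symm : unitary (L2 d →L[ℂ] L2 d)) :
      L2 d →L[ℂ] L2 d) f = (V : L2 d →L[ℂ] L2 d) (𝓕⁻ f) := rfl
  rw [h1]
  refine (hV _).trans ?_
  have hq := quasiMeasurePreserving_of_map_eq (map_matrixEquiv A hA)
  filter_upwards [hq.ae (fourierInv_Lp_ae_eq f hf)] with x hx
  rw [hx, Real.fourierInv_eq']
  congr 1
  refine integral_congr_ae (Filter.Eventually.of_forall fun y => ?_)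
  simp only [smul_eq_mul]
  congr 2
  have : inner ℝ y (matrixEquiv A hA x) = (2 * Real.pi * ℏ)⁻¹ * ∑ j, x j * y j := by
    rw [matrixEquiv_apply, PiLp.inner_apply, Finset.mul_sum]
    refine Finset.sum_congr rfl fun j _ => ?_
    simp only [A, Matrix.mulVec_diagonal]
    simp; ring
  rw [this]
  have h2 : (ℏ : ℂ) ≠ 0 := by exact_mod_cast hℏ.ne'
  have h3 : (Real.pi : ℂ) ≠ 0 := by exact_mod_cast Real.pi_ne_zero
  push_cast
  field_simp

lemma dense_integrable {d : ℕ} : Dense {f : L2 d | Integrable f volume} := by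
  refine (SchwartzMap.denseRange_toLpCLM (E := EuclideanSpace ℝ (Fin d)) (F := ℂ) (p := 2)
    (μ := volume) ENNReal.ofNat_ne_top).mono ?_
  rintro _ ⟨φ, rfl⟩
  exact φ.integrable.congr (SchwartzMap.coeFn_toLp φ 2 volume).symm

lemma integrable_weyl {d : ℕ} (ℏ : ℝ) (w : Fin d → ℂ) {f : EuclideanSpace ℝ (Fin d) → ℂ}
    (hf : Integrable f) : Integrable (weyl ℏ w f) := by
  refine (hf.comp_add_right (WithLp.toLp 2 fun j => (w j).re)).bdd_mul
    (measurable_weyl_phase ℏ w).aestronglyMeasurable (c := 1)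
    (Filter.Eventually.of_forall fun x => (norm_exp_I_div_mul ℏ _).le)

open scoped Matrix in
theorem implements_of_fourier {d : ℕ} {ℏ : ℝ} {U : unitary (L2 d →L[ℂ] L2 d)} {c : ℂ}
    (hU : ∀ f : L2 d, Integrable f volume →
      (U : L2 d →L[ℂ] L2 d) f =ᵐ[volume]
        fun x => c * ∫ y : EuclideanSpace ℝ (Fin d),
            Complex.exp (Complex.I / ℏ * ((∑ j, x j * y j : ℝ) : ℂ)) * f y) :
    Implements ℏ U (phaseMap (Matrix.fromBlocks 0 1 (-1) 0)) := by
  rw [implements_iff]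
  intro w f
  have e1 : (fun j => (phaseMap (Matrix.fromBlocks 0 1 (-1) 0) w j).re)
      = (fun j => (w j).im) := by
    funext j; simp [phaseMap, Matrix.fromBlocks_mulVec]
  have e2 : (fun j => (phaseMap (Matrix.fromBlocks 0 1 (-1) 0) w j).im)
      = -(fun j => (w j).re) := by
    funext j; simp [phaseMap, Matrix.fromBlocks_mulVec, Matrix.neg_mulVec]
  refine dense_integrable.induction (P := fun f => (U : L2 d →L[ℂ] L2 d) (weylOp ℏ w f) =
    weylOp ℏ (phaseMap (Matrix.fromBlocks 0 1 (-1) 0) w) ((U : L2 d →L[ℂ] L2 d) f)) ?_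
    (isClosed_eq (by fun_prop) (by fun_prop)) f
  intro f hf
  have hw := weylOp_ae_eq ℏ w f
  refine Lp.ext ((hU _ ((integrable_weyl ℏ w hf).congr hw.symm)).trans
    (Filter.EventuallyEq.trans ?_ (weylOp_ae_eq _ _ _).symm))
  refine Filter.EventuallyEq.trans ?_ (weyl_congr _ _ (hU f hf)).symm
  refine Filter.Eventually.of_forall fun x => ?_
  simp only
  rw [weyl_apply, e1, e2]
  have h1 : ∫ y : EuclideanSpace ℝ (Fin d),
        Complex.exp (Complex.I / ℏ * ((∑ j, x j * y j : ℝ) : ℂ)) * (weylOp ℏ w f) y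
      = ∫ y : EuclideanSpace ℝ (Fin d),
        Complex.exp (Complex.I / ℏ * ((∑ j, x j * y j : ℝ) : ℂ)) * weyl ℏ w f y := by
    refine integral_congr_ae ?_
    filter_upwards [hw] with y hy
    rw [hy]
  rw [h1]
  set p : Fin d → ℝ := fun j => (w j).re with hp
  set q : Fin d → ℝ := fun j => (w j).im with hq
  let H : EuclideanSpace ℝ (Fin d) → ℂ := fun y =>
    Complex.exp (Complex.I / ℏ * ((WithLp.ofLp x ⬝ᵥ (WithLp.ofLp y - p) +
      (q ⬝ᵥ (WithLp.ofLp y - p) + p ⬝ᵥ q / 2) : ℝ) : ℂ)) * f y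
  have h2 : ∀ y : EuclideanSpace ℝ (Fin d),
      Complex.exp (Complex.I / ℏ * ((∑ j, x j * y j : ℝ) : ℂ)) * weyl ℏ w f y
        = H (y + WithLp.toLp 2 p) := by
    intro y
    rw [weyl_apply, ← mul_assoc, ← Complex.exp_add]
    simp only [H, WithLp.ofLp_add, add_sub_cancel_right]
    congr 2
    simp only [dotProduct]
    push_cast
    ring
  simp only [h2]
  rw [integral_add_right_eq_self H, mul_left_comm]
  congr 1
  rw [← integral_const_mul]
  congr 1
  ext y
  simp only [H]
  rw [← mul_assoc, ← Complex.exp_add, ← mul_add, ← Complex.ofReal_add]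
  congr 4
  have h3 : ∑ j, (x + WithLp.toLp 2 q) j * y j
      = (WithLp.ofLp x + q) ⬝ᵥ WithLp.ofLp y := rfl
  rw [h3, add_dotProduct, dotProduct_sub, dotProduct_sub, neg_dotProduct, dotProduct_neg,
    dotProduct_comm q p, dotProduct_comm p (WithLp.ofLp x)]
  ring

end

end Metaplectic

namespace Metaplectic

noncomputable section

/-! ### Gaussians of complex symmetric matrices -/

open scoped Matrix

/-- A complex symmetric matrix with positive definite real part becomes diagonal after a real
change of variables: first turn the real part into the identity, then diagonalize the imaginary
part by an orthogonal matrix. -/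
theorem exists_congruence_diagonal {d : ℕ} {M : Matrix (Fin d) (Fin d) ℂ} (hM : M.IsSymm)
    (hpos : (M.map Complex.re).PosDef) :
    ∃ (T : Matrix (Fin d) (Fin d) ℝ) (μ : Fin d → ℝ), IsUnit T.det ∧
      (T.map Complex.ofReal)ᵀ * M * T.map Complex.ofReal =
        Matrix.diagonal fun j => (1 + μ j * Complex.I : ℂ) := by
  have diag : ∀ {R : Matrix (Fin d) (Fin d) ℝ} (hR : R.IsHermitian),
      (hR.eigenvectorUnitary : Matrix (Fin d) (Fin d) ℝ)ᵀ * R *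
        (hR.eigenvectorUnitary : Matrix (Fin d) (Fin d) ℝ) = Matrix.diagonal hR.eigenvalues ∧
      IsUnit (hR.eigenvectorUnitary : Matrix (Fin d) (Fin d) ℝ).det ∧
      (hR.eigenvectorUnitary : Matrix (Fin d) (Fin d) ℝ)ᵀ *
        (hR.eigenvectorUnitary : Matrix (Fin d) (Fin d) ℝ) = 1 := by
    intro R hR
    have h1 : (hR.eigenvectorUnitary : Matrix (Fin d) (Fin d) ℝ)ᵀ *
        (hR.eigenvectorUnitary : Matrix (Fin d) (Fin d) ℝ) = 1 :=
      Unitary.coe_star_mul_self hR.eigenvectorUnitary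
    refine ⟨?_, ?_, h1⟩
    · have h := hR.conjStarAlgAut_star_eigenvectorUnitary
      rw [Unitary.conjStarAlgAut_apply] at h
      have h' : star (hR.eigenvectorUnitary : Matrix (Fin d) (Fin d) ℝ) * R *
          (hR.eigenvectorUnitary : Matrix (Fin d) (Fin d) ℝ) = Matrix.diagonal hR.eigenvalues := by
        simpa using h
      exact h'
    · exact (Matrix.isUnit_iff_isUnit_det _).1 (IsUnit.of_mul_eq_one_right _ h1)
  set R := M.map Complex.re with hR
  obtain ⟨h1, h2, -⟩ := diag hpos.isHermitian
  set O := (hpos.isHermitian.eigenvectorUnitary : Matrix (Fin d) (Fin d) ℝ)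
  set lam := hpos.isHermitian.eigenvalues
  have hlam : ∀ i, 0 < lam i := hpos.eigenvalues_pos
  set P := O * Matrix.diagonal fun i => (Real.sqrt (lam i))⁻¹ with hP
  have hPR : Pᵀ * R * P = 1 := by
    have : Pᵀ * R * P = Matrix.diagonal (fun i => (Real.sqrt (lam i))⁻¹) * (Oᵀ * R * O) *
        Matrix.diagonal fun i => (Real.sqrt (lam i))⁻¹ := by
      rw [hP, Matrix.transpose_mul, Matrix.diagonal_transpose]; simp only [Matrix.mul_assoc]
    rw [this, h1, Matrix.diagonal_mul_diagonal, Matrix.diagonal_mul_diagonal,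
      ← Matrix.diagonal_one]
    congr 1
    funext i
    have := Real.mul_self_sqrt (hlam i).le
    have h0 := (Real.sqrt_pos.2 (hlam i)).ne'
    field_simp
    nlinarith
  have hPdet : IsUnit P.det := by
    rw [hP, Matrix.det_mul, Matrix.det_diagonal]
    refine h2.mul (isUnit_iff_ne_zero.2 (Finset.prod_ne_zero_iff.2 fun i _ => ?_))
    exact inv_ne_zero (Real.sqrt_pos.2 (hlam i)).ne'
  clear_value P
  have hN : (Pᵀ * M.map Complex.im * P).IsHermitian := by
    have : (M.map Complex.im)ᵀ = M.map Complex.im := by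
      rw [← Matrix.transpose_map, hM.eq]
    change (Pᵀ * M.map Complex.im * P)ᵀ = _
    rw [Matrix.transpose_mul, Matrix.transpose_mul, this, Matrix.transpose_transpose,
      Matrix.mul_assoc]
  obtain ⟨h3, h4, h5⟩ := diag hN
  set V := (hN.eigenvectorUnitary : Matrix (Fin d) (Fin d) ℝ)
  refine ⟨P * V, hN.eigenvalues, by rw [Matrix.det_mul]; exact hPdet.mul h4, ?_⟩
  have hsplit : M = R.map Complex.ofReal + Complex.I • (M.map Complex.im).map Complex.ofReal := by
    ext i j
    simp [hR, mul_comm Complex.I]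
  have hmm : ∀ A B : Matrix (Fin d) (Fin d) ℝ,
      A.map Complex.ofReal * B.map Complex.ofReal = (A * B).map Complex.ofReal :=
    fun A B => (Matrix.map_mul (f := Complex.ofRealHom)).symm
  have e1 : (P * V)ᵀ * R * (P * V) = 1 := by
    have : (P * V)ᵀ * R * (P * V) = Vᵀ * (Pᵀ * R * P) * V := by
      rw [Matrix.transpose_mul]; simp only [Matrix.mul_assoc]
    rw [this, hPR, Matrix.mul_one, h5]
  have e2 : (P * V)ᵀ * M.map Complex.im * (P * V) = Matrix.diagonal hN.eigenvalues := by
    rw [← h3, Matrix.transpose_mul]; simp only [Matrix.mul_assoc]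
  conv_lhs => rw [hsplit]
  rw [Matrix.mul_add, Matrix.add_mul, Matrix.mul_smul, Matrix.smul_mul,
    ← Matrix.transpose_map, hmm, hmm, hmm, hmm, e1, e2]
  ext i j
  rcases eq_or_ne i j with rfl | hij
  · simp [mul_comm]
  · simp [hij]

/-- The Gaussian `exp(-(1/2ℏ) x·Mx)`. -/
def gaussian {d : ℕ} (ℏ : ℝ) (M : Matrix (Fin d) (Fin d) ℂ) (x : EuclideanSpace ℝ (Fin d)) : ℂ :=
  Complex.exp (-(1 / (2 * ℏ)) * ((fun j => (x j : ℂ)) ⬝ᵥ M *ᵥ (fun j => (x j : ℂ))))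

lemma continuous_gaussian {d : ℕ} (ℏ : ℝ) (M : Matrix (Fin d) (Fin d) ℂ) :
    Continuous (gaussian ℏ M) := by
  unfold gaussian
  simp only [dotProduct, Matrix.mulVec]
  fun_prop

lemma ofReal_mulVec {d : ℕ} (T : Matrix (Fin d) (Fin d) ℝ) (x : Fin d → ℝ) :
    (fun j => ((T *ᵥ x) j : ℂ)) = T.map Complex.ofReal *ᵥ fun j => (x j : ℂ) := by
  funext j
  simp [Matrix.mulVec, dotProduct]

lemma gaussian_apply_matrix {d : ℕ} (ℏ : ℝ) {M D : Matrix (Fin d) (Fin d) ℂ}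
    {T : Matrix (Fin d) (Fin d) ℝ}
    (h : (T.map Complex.ofReal)ᵀ * M * T.map Complex.ofReal = D)
    (x : EuclideanSpace ℝ (Fin d)) :
    gaussian ℏ M (WithLp.toLp 2 (T *ᵥ WithLp.ofLp x)) = gaussian ℏ D x := by
  unfold gaussian
  congr 2
  have := ofReal_mulVec T (WithLp.ofLp x)
  simp only at this ⊢
  rw [this, ← h, ← Matrix.mulVec_mulVec, ← Matrix.mulVec_mulVec, Matrix.dotProduct_mulVec _ _ᵀ,
    Matrix.vecMul_transpose]

lemma gaussian_diagonal {d : ℕ} (ℏ : ℝ) (D : Fin d → ℂ) (x : EuclideanSpace ℝ (Fin d)) :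
    gaussian ℏ (Matrix.diagonal D) x =
      Complex.exp (-∑ j, (D j / (2 * ℏ)) * (x j : ℂ) ^ 2) := by
  unfold gaussian
  congr 1
  simp only [dotProduct, Matrix.mulVec_diagonal, Finset.mul_sum, ← Finset.sum_neg_distrib]
  refine Finset.sum_congr rfl fun j _ => ?_
  ring

lemma re_one_add_mul_I_div_pos {ℏ : ℝ} (hℏ : 0 < ℏ) (t : ℝ) :
    0 < ((1 + t * Complex.I) / (2 * ℏ)).re := by
  have : (1 + t * Complex.I) / (2 * ℏ) = ((1 / (2 * ℏ) : ℝ) : ℂ) +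
      ((t / (2 * ℏ) : ℝ) : ℂ) * Complex.I := by push_cast; ring
  rw [this, Complex.add_re, Complex.ofReal_re, Complex.re_ofReal_mul, Complex.I_re, mul_zero,
    add_zero]
  positivity

lemma integrable_exp_diagonal_add {d : ℕ} {D : Fin d → ℂ} (hD : ∀ j, 0 < (D j).re)
    (c : Fin d → ℂ) : Integrable fun x : EuclideanSpace ℝ (Fin d) =>
      Complex.exp (-∑ j, D j * (x j : ℂ) ^ 2 + ∑ j, c j * x j) := by
  rw [← (PiLp.volume_preserving_toLp (Fin d)).integrable_comp_emb
    (MeasurableEquiv.toLp 2 (Fin d → ℝ)).measurableEmbedding]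
  exact GaussianFourier.integrable_cexp_neg_sum_mul_add hD c

lemma integral_exp_diagonal_add {d : ℕ} {D : Fin d → ℂ} (hD : ∀ j, 0 < (D j).re)
    (c : Fin d → ℂ) : ∫ x : EuclideanSpace ℝ (Fin d),
      Complex.exp (-∑ j, D j * (x j : ℂ) ^ 2 + ∑ j, c j * x j) =
        ∏ j, (Real.pi / D j) ^ (1 / 2 : ℂ) * Complex.exp (c j ^ 2 / (4 * D j)) := by
  rw [← (PiLp.volume_preserving_toLp (Fin d)).integral_comp
    (MeasurableEquiv.toLp 2 (Fin d → ℝ)).measurableEmbedding]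
  exact GaussianFourier.integral_cexp_neg_sum_mul_add hD c

lemma integrable_gaussian {d : ℕ} {ℏ : ℝ} (hℏ : 0 < ℏ) {M : Matrix (Fin d) (Fin d) ℂ}
    (hM : M.IsSymm) (hpos : (M.map Complex.re).PosDef) : Integrable (gaussian ℏ M) := by
  obtain ⟨T, μ, hT, hD⟩ := exists_congruence_diagonal hM hpos
  have h1 : Integrable (gaussian ℏ M ∘ matrixEquiv T hT) := by
    have : gaussian ℏ M ∘ matrixEquiv T hT = fun x => Complex.exp
        (-∑ j, ((1 + μ j * Complex.I) / (2 * ℏ)) * (x j : ℂ) ^ 2 + ∑ j, (0 : ℂ) * (x j : ℂ)) := by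
      funext x
      rw [Function.comp_apply, matrixEquiv_apply, gaussian_apply_matrix ℏ hD, gaussian_diagonal]
      simp
    rw [this]
    refine integrable_exp_diagonal_add (fun j => ?_) (fun _ => 0)
    exact re_one_add_mul_I_div_pos hℏ (μ j)
  rw [← (matrixEquiv T hT).measurableEmbedding.integrable_map_iff, map_matrixEquiv,
    integrable_smul_measure] at h1
  · exact h1
  · simpa using hT.ne_zero
  · simp

/-- The square of a Gaussian is integrable since it is a Gaussian for `ℏ/2`. -/
lemma memLp_gaussian {d : ℕ} {ℏ : ℝ} (hℏ : 0 < ℏ) {M : Matrix (Fin d) (Fin d) ℂ}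
    (hM : M.IsSymm) (hpos : (M.map Complex.re).PosDef) : MemLp (gaussian ℏ M) 2 volume := by
  rw [memLp_two_iff_integrable_sq_norm (continuous_gaussian ℏ M).aestronglyMeasurable]
  have h := (integrable_gaussian (half_pos hℏ) hM hpos).norm
  refine h.congr (Filter.Eventually.of_forall fun x => ?_)
  simp only [gaussian]
  rw [← norm_pow, ← Complex.exp_nat_mul]
  congr 2
  have : (ℏ : ℂ) ≠ 0 := by exact_mod_cast hℏ.ne'
  push_cast
  field_simp

/-- The Fourier transform of a Gaussian of a complex symmetric matrix is the Gaussian of the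
inverse matrix. The constant is a square root of `det M⁻¹`. -/
theorem integral_exp_mul_gaussian {d : ℕ} {ℏ : ℝ} (hℏ : 0 < ℏ) {M : Matrix (Fin d) (Fin d) ℂ}
    (hM : M.IsSymm) (hpos : (M.map Complex.re).PosDef) :
    ∃ κ : ℂ, κ ^ 2 * M.det = 1 ∧ ∀ x : EuclideanSpace ℝ (Fin d),
      (((2 * Real.pi * ℏ) ^ (-(d : ℝ) / 2) : ℝ) : ℂ) * ∫ y : EuclideanSpace ℝ (Fin d),
        Complex.exp (Complex.I / ℏ * ((∑ j, x j * y j : ℝ) : ℂ)) * gaussian ℏ M y =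
      κ * gaussian ℏ M⁻¹ x := by
  obtain ⟨T, μ, hT, hD⟩ := exists_congruence_diagonal hM hpos
  set D : Fin d → ℂ := fun j => 1 + μ j * Complex.I with hDdef
  have hℏ' : (ℏ : ℂ) ≠ 0 := by exact_mod_cast hℏ.ne'
  have hpi : (Real.pi : ℂ) ≠ 0 := by exact_mod_cast Real.pi_ne_zero
  have hD0 : ∀ j, D j ≠ 0 := by
    intro j h
    have := congrArg Complex.re h
    simp [hDdef] at this
  have hdet : (T.det : ℂ) ^ 2 * M.det = ∏ j, D j := by
    have h := congrArg Matrix.det hD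
    have hTm : (T.map Complex.ofReal).det = (T.det : ℂ) := (Complex.ofRealHom.map_det T).symm
    rw [Matrix.det_mul, Matrix.det_mul, Matrix.det_transpose, Matrix.det_diagonal, hTm] at h
    rw [← h]; ring
  have hMdet : M.det ≠ 0 := by
    intro h
    rw [h, mul_zero] at hdet
    exact Finset.prod_ne_zero_iff.2 (fun j _ => hD0 j) hdet.symm
  set k : ℝ := (2 * Real.pi * ℏ) ^ (-(d : ℝ) / 2) with hk
  refine ⟨k * |T.det| * ∏ j, (Real.pi / (D j / (2 * ℏ))) ^ (1 / 2 : ℂ), ?_, fun x => ?_⟩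
  · have h1 : (∏ j, (Real.pi / (D j / (2 * ℏ))) ^ (1 / 2 : ℂ)) ^ 2
        = (2 * Real.pi * ℏ) ^ d / ∏ j, D j := by
      rw [← Finset.prod_pow]
      have : ∀ j ∈ Finset.univ, ((Real.pi / (D j / (2 * ℏ))) ^ (1 / 2 : ℂ)) ^ 2
          = (2 * Real.pi * ℏ) / D j := by
        intro j _
        rw [← Complex.cpow_nat_mul]
        norm_num
        field_simp
      rw [Finset.prod_congr rfl this, Finset.prod_div_distrib]
      simp
    have h2 : (k : ℂ) ^ 2 * (2 * Real.pi * ℏ) ^ d = 1 := by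
      have hp : 0 < 2 * Real.pi * ℏ := by positivity
      have : k ^ 2 * (2 * Real.pi * ℏ) ^ d = 1 := by
        rw [hk, ← Real.rpow_natCast, ← Real.rpow_mul hp.le, ← Real.rpow_natCast, ← Real.rpow_add hp]
        norm_num
      exact_mod_cast this
    have h3 : ((|T.det| : ℝ) : ℂ) ^ 2 = (T.det : ℂ) ^ 2 := by
      exact_mod_cast sq_abs T.det
    rw [mul_pow, mul_pow, h1, h3, ← hdet]
    have h4 : (T.det : ℂ) ≠ 0 := by exact_mod_cast hT.ne_zero
    field_simp
    exact h2
  · -- substitute `y = T u`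
    set G : EuclideanSpace ℝ (Fin d) → ℂ := fun y =>
      Complex.exp (Complex.I / ℏ * ((∑ j, x j * y j : ℝ) : ℂ)) * gaussian ℏ M y with hG
    have hsub : ∫ y, G y = |T.det| * ∫ u, G (matrixEquiv T hT u) := by
      rw [← (matrixEquiv T hT).measurableEmbedding.integral_map, map_matrixEquiv,
        integral_smul_measure, ENNReal.toReal_ofReal (by positivity), Complex.real_smul,
        ← mul_assoc, ← Complex.ofReal_mul, mul_inv_cancel₀ (abs_ne_zero.2 hT.ne_zero),
        Complex.ofReal_one, one_mul]
    set c : Fin d → ℂ := fun j => Complex.I / ℏ * ((Tᵀ *ᵥ WithLp.ofLp x) j : ℂ) with hc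
    have hGT : ∀ u, G (matrixEquiv T hT u) =
        Complex.exp (-∑ j, (D j / (2 * ℏ)) * (u j : ℂ) ^ 2 + ∑ j, c j * u j) := by
      intro u
      rw [hG]
      simp only
      rw [matrixEquiv_apply, gaussian_apply_matrix ℏ hD, gaussian_diagonal, ← Complex.exp_add,
        add_comm]
      congr 2
      have : ∑ j, x j * (T *ᵥ WithLp.ofLp u) j = ∑ j, (Tᵀ *ᵥ WithLp.ofLp x) j * u j := by
        have := Matrix.dotProduct_mulVec (WithLp.ofLp x) T (WithLp.ofLp u)
        rw [← Matrix.mulVec_transpose] at this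
        exact this
      rw [this]
      push_cast
      rw [Finset.mul_sum]
      simp only [hc, mul_assoc]
    rw [hsub]
    simp only [hGT]
    have hDre : ∀ j, 0 < (D j / (2 * ℏ)).re := fun j => re_one_add_mul_I_div_pos hℏ (μ j)
    rw [integral_exp_diagonal_add hDre, Finset.prod_mul_distrib, ← Complex.exp_sum]
    -- the inverse matrix is `T D⁻¹ Tᵀ`
    have hinv : M⁻¹ = T.map Complex.ofReal * Matrix.diagonal (fun j => (D j)⁻¹) *
        (T.map Complex.ofReal)ᵀ := by
      set Tc := T.map Complex.ofReal
      have hTc : IsUnit Tc.det := by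
        have : Tc.det = (T.det : ℂ) := (Complex.ofRealHom.map_det T).symm
        rw [this]; exact isUnit_iff_ne_zero.2 (by exact_mod_cast hT.ne_zero)
      apply Matrix.inv_eq_right_inv
      have h1 : Tcᵀ * (M * Tc * Matrix.diagonal fun j => (D j)⁻¹) = 1 := by
        rw [← Matrix.mul_assoc, ← Matrix.mul_assoc, hD, Matrix.diagonal_mul_diagonal,
          ← Matrix.diagonal_one]
        congr 1; funext j; exact mul_inv_cancel₀ (hD0 j)
      have h2 := mul_eq_one_comm.1 h1
      rw [← h2]; simp only [Matrix.mul_assoc]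
    have hgi : gaussian ℏ M⁻¹ x = Complex.exp (∑ j, c j ^ 2 / (4 * (D j / (2 * ℏ)))) := by
      unfold gaussian
      congr 1
      have h1 : (T.map Complex.ofReal)ᵀ *ᵥ (fun j => ((WithLp.ofLp x j : ℝ) : ℂ))
          = fun j => ((Tᵀ *ᵥ WithLp.ofLp x) j : ℂ) := by
        rw [ofReal_mulVec, Matrix.transpose_map]
      rw [hinv, ← Matrix.mulVec_mulVec, ← Matrix.mulVec_mulVec, Matrix.dotProduct_mulVec,
        ← Matrix.mulVec_transpose, h1]
      simp only [dotProduct, Matrix.mulVec_diagonal, hc]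
      rw [Finset.mul_sum]
      refine Finset.sum_congr rfl fun j _ => ?_
      have := hD0 j
      rw [mul_pow, div_pow, Complex.I_sq]
      field_simp
      ring
    rw [hgi]
    ring

end

end Metaplectic

namespace Metaplectic

noncomputable section

/-! ### Positive Lagrangian frames and half-forms -/

open scoped Matrix ComplexOrder

/-- A positive Lagrangian frame: the columns of the `2d × d` matrix `F = (X; Q)` span a complex
Lagrangian subspace of `ℂ²ᵈ` on which the Hermitian form `-i v̄ · J v` is positive definite. -/
def IsPositiveFrame {d : ℕ} (F : Matrix (Fin d ⊕ Fin d) (Fin d) ℂ) : Prop :=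
  Fᵀ * Matrix.J (Fin d) ℂ * F = 0 ∧ ((-Complex.I) • (Fᴴ * Matrix.J (Fin d) ℂ * F)).PosDef

/-- The matrix `i Q X⁻¹` of the Gaussian that belongs to the Lagrangian subspace spanned by the
frame `F = (X; Q)`. -/
def frameForm {d : ℕ} (F : Matrix (Fin d ⊕ Fin d) (Fin d) ℂ) : Matrix (Fin d) (Fin d) ℂ :=
  Complex.I • (F.toRows₂ * F.toRows₁⁻¹)

/-- `f` is one of the two half-forms `± (det X)^(-1/2) exp(-(1/2ℏ) x·(i Q X⁻¹)x)` of the frame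
`F = (X; Q)`. Metaplectic operators act on them through the linear action of the symplectic group
on frames, which is how the choice of square roots is tracked. -/
def IsHalfForm {d : ℕ} (ℏ : ℝ) (F : Matrix (Fin d ⊕ Fin d) (Fin d) ℂ) (f : L2 d) : Prop :=
  ∃ s : ℂ, s ^ 2 * F.toRows₁.det = 1 ∧ f =ᵐ[volume] fun x => s * gaussian ℏ (frameForm F) x

section frames

variable {d : ℕ} {F : Matrix (Fin d ⊕ Fin d) (Fin d) ℂ}

lemma transpose_mul_J_mul (F : Matrix (Fin d ⊕ Fin d) (Fin d) ℂ) :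
    Fᵀ * Matrix.J (Fin d) ℂ * F = F.toRows₂ᵀ * F.toRows₁ - F.toRows₁ᵀ * F.toRows₂ := by
  conv_lhs => rw [← Matrix.fromRows_toRows F]
  rw [Matrix.transpose_fromRows, Matrix.J, Matrix.fromCols_mul_fromBlocks,
    Matrix.fromCols_mul_fromRows]
  simp [sub_eq_add_neg]

lemma conjTranspose_mul_J_mul (F : Matrix (Fin d ⊕ Fin d) (Fin d) ℂ) :
    Fᴴ * Matrix.J (Fin d) ℂ * F = F.toRows₂ᴴ * F.toRows₁ - F.toRows₁ᴴ * F.toRows₂ := by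
  conv_lhs => rw [← Matrix.fromRows_toRows F]
  rw [Matrix.conjTranspose_fromRows_eq_fromCols_conjTranspose, Matrix.J,
    Matrix.fromCols_mul_fromBlocks, Matrix.fromCols_mul_fromRows]
  simp [sub_eq_add_neg]

lemma IsPositiveFrame.isUnit_det (hF : IsPositiveFrame F) : IsUnit F.toRows₁.det := by
  rw [isUnit_iff_ne_zero]
  intro h
  obtain ⟨v, hv, hXv⟩ := Matrix.exists_mulVec_eq_zero_iff.2 h
  have hpos := hF.2.dotProduct_mulVec_pos hv
  rw [conjTranspose_mul_J_mul, Matrix.smul_mulVec, Matrix.sub_mulVec, ← Matrix.mulVec_mulVec,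
    ← Matrix.mulVec_mulVec, hXv, Matrix.mulVec_zero, zero_sub, dotProduct_smul, dotProduct_neg,
    Matrix.dotProduct_mulVec, ← Matrix.star_mulVec, hXv] at hpos
  simp at hpos

lemma IsPositiveFrame.isSymm_frameForm (hF : IsPositiveFrame F) : (frameForm F).IsSymm := by
  have hX := hF.isUnit_det
  have h := hF.1
  rw [transpose_mul_J_mul, sub_eq_zero] at h
  have hXt : IsUnit F.toRows₁ᵀ.det := by rwa [Matrix.det_transpose]
  unfold frameForm
  rw [Matrix.IsSymm, Matrix.transpose_smul, Matrix.transpose_mul, Matrix.transpose_nonsing_inv]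
  congr 1
  have h1 : F.toRows₁ᵀ * (F.toRows₁ᵀ⁻¹ * F.toRows₂ᵀ) * F.toRows₁
      = F.toRows₁ᵀ * (F.toRows₂ * F.toRows₁⁻¹) * F.toRows₁ := by
    rw [Matrix.mul_nonsing_inv_cancel_left _ _ hXt, h, Matrix.mul_assoc,
      Matrix.nonsing_inv_mul_cancel_right _ _ hX]
  have h2 := congrArg (fun A => F.toRows₁ᵀ⁻¹ * (A * F.toRows₁⁻¹)) h1
  simpa only [Matrix.mul_nonsing_inv_cancel_right _ _ hX,
    Matrix.nonsing_inv_mul_cancel_left _ _ hXt] using h2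

lemma IsPositiveFrame.posDef_frameForm (hF : IsPositiveFrame F) :
    ((frameForm F).map Complex.re).PosDef := by
  have hX := hF.isUnit_det
  have hs := hF.isSymm_frameForm
  have hXH : IsUnit F.toRows₁ᴴ.det := by
    rw [Matrix.det_conjTranspose]; exact hX.star
  have key : F.toRows₁⁻¹ᴴ * ((-Complex.I) • (Fᴴ * Matrix.J (Fin d) ℂ * F)) * F.toRows₁⁻¹
      = frameForm F + (frameForm F)ᴴ := by
    rw [conjTranspose_mul_J_mul, Matrix.mul_smul, Matrix.smul_mul, Matrix.mul_sub, Matrix.sub_mul,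
      Matrix.conjTranspose_nonsing_inv, Matrix.nonsing_inv_mul_cancel_left _ _ hXH,
      ← Matrix.mul_assoc, Matrix.mul_nonsing_inv_cancel_right _ _ hX]
    unfold frameForm
    rw [Matrix.conjTranspose_smul, Matrix.conjTranspose_mul, Matrix.conjTranspose_nonsing_inv]
    simp [smul_sub]
    abel
  refine Matrix.PosDef.of_dotProduct_mulVec_pos ?_ fun x hx => ?_
  · change ((frameForm F).map Complex.re)ᵀ = _
    rw [← Matrix.transpose_map, hs.eq]
  · have hy : (F.toRows₁ *ᵥ (F.toRows₁⁻¹ *ᵥ fun j => (x j : ℂ))) = fun j => (x j : ℂ) := by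
      rw [Matrix.mulVec_mulVec, Matrix.mul_nonsing_inv _ hX, Matrix.one_mulVec]
    have hy0 : F.toRows₁⁻¹ *ᵥ (fun j => (x j : ℂ)) ≠ 0 := by
      intro h
      rw [h, Matrix.mulVec_zero] at hy
      refine hx (funext fun j => ?_)
      have := congrFun hy j
      simp only [Pi.zero_apply] at this ⊢
      exact_mod_cast this.symm
    have hpos := hF.2.dotProduct_mulVec_pos hy0
    rw [Matrix.star_mulVec, ← Matrix.dotProduct_mulVec, Matrix.mulVec_mulVec,
      Matrix.mulVec_mulVec, key] at hpos
    have hre : frameForm F + (frameForm F)ᴴ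
        = ((2 : ℝ) • (frameForm F).map Complex.re).map Complex.ofReal := by
      ext i j
      have : frameForm F j i = frameForm F i j := congrFun (congrFun hs.eq i) j
      simp only [Matrix.add_apply, Matrix.conjTranspose_apply, this, Matrix.map_apply,
        Matrix.smul_apply, smul_eq_mul]
      exact Complex.add_conj _
    have hstar : star (fun j => (x j : ℂ)) = fun j => (x j : ℂ) := by
      funext j; simp
    rw [hre, ← ofReal_mulVec, hstar, Matrix.smul_mulVec] at hpos
    have h2 : ((fun j => (x j : ℂ)) ⬝ᵥ fun j => (((2 : ℝ) •
        (frameForm F).map Complex.re *ᵥ x) j : ℂ))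
        = ((2 * (x ⬝ᵥ (frameForm F).map Complex.re *ᵥ x) : ℝ) : ℂ) := by
      simp only [dotProduct, Pi.smul_apply, smul_eq_mul]
      push_cast
      rw [Finset.mul_sum]
      refine Finset.sum_congr rfl fun j _ => by ring
    rw [h2] at hpos
    have h3 : (0 : ℝ) < 2 * (x ⬝ᵥ (frameForm F).map Complex.re *ᵥ x) := by exact_mod_cast hpos
    simpa using h3

lemma IsPositiveFrame.symplectic_mul (hF : IsPositiveFrame F)
    {S : Matrix (Fin d ⊕ Fin d) (Fin d ⊕ Fin d) ℝ} (hS : S ∈ Matrix.symplecticGroup (Fin d) ℝ) :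
    IsPositiveFrame (S.map Complex.ofReal * F) := by
  have h1 : (S.map Complex.ofReal)ᵀ * Matrix.J (Fin d) ℂ * S.map Complex.ofReal
      = Matrix.J (Fin d) ℂ := by
    have := SymplecticGroup.mem_iff'.1 hS
    have h := congrArg (fun A : Matrix _ _ ℝ => A.map Complex.ofRealHom) this
    simp only [Matrix.map_mul, Matrix.map_J] at h
    exact h
  have h2 : (S.map Complex.ofReal)ᴴ = (S.map Complex.ofReal)ᵀ := by
    ext i j; simp
  constructor
  · have : (S.map Complex.ofReal * F)ᵀ * Matrix.J (Fin d) ℂ * (S.map Complex.ofReal * F)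
        = Fᵀ * ((S.map Complex.ofReal)ᵀ * Matrix.J (Fin d) ℂ * S.map Complex.ofReal) * F := by
      rw [Matrix.transpose_mul]; simp only [Matrix.mul_assoc]
    rw [this, h1, hF.1]
  · have : (S.map Complex.ofReal * F)ᴴ * Matrix.J (Fin d) ℂ * (S.map Complex.ofReal * F)
        = Fᴴ * ((S.map Complex.ofReal)ᵀ * Matrix.J (Fin d) ℂ * S.map Complex.ofReal) * F := by
      rw [Matrix.conjTranspose_mul, h2]; simp only [Matrix.mul_assoc]
    rw [this, h1]
    exact hF.2

lemma IsPositiveFrame.exists_isHalfForm (hF : IsPositiveFrame F) {ℏ : ℝ} (hℏ : 0 < ℏ) :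
    ∃ f : L2 d, IsHalfForm ℏ F f := by
  obtain ⟨s, hs⟩ := IsAlgClosed.exists_pow_nat_eq (F.toRows₁.det⁻¹) two_pos
  have h := (memLp_gaussian hℏ hF.isSymm_frameForm hF.posDef_frameForm).const_mul s
  exact ⟨h.toLp _, s, by rw [hs, inv_mul_cancel₀ hF.isUnit_det.ne_zero], h.coeFn_toLp⟩

lemma IsHalfForm.eq_or_eq_neg {ℏ : ℝ} {f g : L2 d} (hf : IsHalfForm ℏ F f)
    (hg : IsHalfForm ℏ F g) : f = g ∨ f = -g := by
  obtain ⟨s, hs, hfs⟩ := hf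
  obtain ⟨t, ht, hgt⟩ := hg
  have h0 : F.toRows₁.det ≠ 0 := by rintro h; simp [h] at hs
  have hst : s ^ 2 = t ^ 2 := mul_right_cancel₀ h0 (hs.trans ht.symm)
  rcases sq_eq_sq_iff_eq_or_eq_neg.1 hst with rfl | rfl
  · exact Or.inl (Lp.ext (hfs.trans hgt.symm))
  · refine Or.inr (Lp.ext ?_)
    filter_upwards [hfs, hgt, Lp.coeFn_neg g] with x h1 h2 h3
    rw [h1, h3, Pi.neg_apply, h2, neg_mul]

lemma IsHalfForm.neg {ℏ : ℝ} {f : L2 d} (hf : IsHalfForm ℏ F f) : IsHalfForm ℏ F (-f) := by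
  obtain ⟨s, hs, hfs⟩ := hf
  refine ⟨-s, by rwa [neg_sq], ?_⟩
  filter_upwards [hfs, Lp.coeFn_neg f] with x h1 h3
  rw [h3, Pi.neg_apply, h1, neg_mul]

end frames

/-! ### The action of the metaplectic group on half-forms -/

/-- The unitary operator `U` covers the symplectic matrix `S`: it implements the phase space map
of `S`, and it maps half-forms of a frame `F` to half-forms of `S F`. -/
structure Covers {d : ℕ} (ℏ : ℝ) (U : unitary (L2 d →L[ℂ] L2 d))
    (S : Matrix (Fin d ⊕ Fin d) (Fin d ⊕ Fin d) ℝ) : Prop where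
  mem : S ∈ Matrix.symplecticGroup (Fin d) ℝ
  implements : Implements ℏ U (phaseMap S)
  isHalfForm : ∀ F, IsPositiveFrame F → ∀ f, IsHalfForm ℏ F f →
    IsHalfForm ℏ (S.map Complex.ofReal * F) ((U : L2 d →L[ℂ] L2 d) f)

variable {d : ℕ} {ℏ : ℝ}

lemma map_ofReal_mul_mul (S T : Matrix (Fin d ⊕ Fin d) (Fin d ⊕ Fin d) ℝ)
    (F : Matrix (Fin d ⊕ Fin d) (Fin d) ℂ) :
    (S * T).map Complex.ofReal * F = S.map Complex.ofReal * (T.map Complex.ofReal * F) := by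
  rw [← Matrix.mul_assoc]
  congr 1
  exact Matrix.map_mul (f := Complex.ofRealHom)

lemma Covers.one : Covers ℏ (1 : unitary (L2 d →L[ℂ] L2 d)) 1 where
  mem := one_mem _
  implements := by
    rw [implements_iff]; intro w f; rw [phaseMap_one]; rfl
  isHalfForm F _ f hf := by
    have : (1 : Matrix (Fin d ⊕ Fin d) (Fin d ⊕ Fin d) ℝ).map Complex.ofReal = 1 :=
      Matrix.map_one _ Complex.ofReal_zero Complex.ofReal_one
    rw [this, Matrix.one_mul]
    exact hf

lemma Covers.mul {U V : unitary (L2 d →L[ℂ] L2 d)}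
    {S T : Matrix (Fin d ⊕ Fin d) (Fin d ⊕ Fin d) ℝ} (hU : Covers ℏ U S) (hV : Covers ℏ V T) :
    Covers ℏ (U * V) (S * T) where
  mem := mul_mem hU.mem hV.mem
  implements := by
    have := hU.implements.mul hV.implements
    simpa only [← phaseMap_mul] using this
  isHalfForm F hF f hf := by
    rw [map_ofReal_mul_mul]
    exact hU.isHalfForm _ (hF.symplectic_mul hV.mem) _ (hV.isHalfForm F hF f hf)

lemma Covers.inv (hℏ : 0 < ℏ) {U : unitary (L2 d →L[ℂ] L2 d)}
    {S : Matrix (Fin d ⊕ Fin d) (Fin d ⊕ Fin d) ℝ} (hU : Covers ℏ U S) :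
    Covers ℏ U⁻¹ S⁻¹ := by
  have hdet := SymplecticGroup.symplectic_det hU.mem
  have hS : S * S⁻¹ = 1 := Matrix.mul_nonsing_inv S hdet
  have hmem : S⁻¹ ∈ Matrix.symplecticGroup (Fin d) ℝ := by
    have := (⟨S, hU.mem⟩ : Matrix.symplecticGroup (Fin d) ℝ)⁻¹.2
    rwa [SymplecticGroup.coe_inv'] at this
  refine ⟨hmem, hU.implements.inv fun w => ?_, fun F hF f hf => ?_⟩
  · rw [← phaseMap_mul, hS, phaseMap_one]
  · have hF' := hF.symplectic_mul hmem
    obtain ⟨f₀, hf₀⟩ := hF'.exists_isHalfForm hℏ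
    have h := hU.isHalfForm _ hF' _ hf₀
    rw [← map_ofReal_mul_mul, hS] at h
    have h1 : (1 : Matrix (Fin d ⊕ Fin d) (Fin d ⊕ Fin d) ℝ).map Complex.ofReal = 1 :=
      Matrix.map_one _ Complex.ofReal_zero Complex.ofReal_one
    rw [h1, Matrix.one_mul] at h
    rcases hf.eq_or_eq_neg h with rfl | rfl
    · rwa [unitary_inv_apply_apply]
    · rw [map_neg, unitary_inv_apply_apply]
      exact hf₀.neg

end

end Metaplectic

namespace Metaplectic

noncomputable section

open scoped Matrix ComplexOrder

variable {d : ℕ} {ℏ : ℝ}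

lemma map_fromBlocks_mul (A B C D : Matrix (Fin d) (Fin d) ℝ)
    (F : Matrix (Fin d ⊕ Fin d) (Fin d) ℂ) :
    (Matrix.fromBlocks A B C D).map Complex.ofReal * F =
      Matrix.fromRows
        (A.map Complex.ofReal * F.toRows₁ + B.map Complex.ofReal * F.toRows₂)
        (C.map Complex.ofReal * F.toRows₁ + D.map Complex.ofReal * F.toRows₂) := by
  conv_lhs => rw [← Matrix.fromRows_toRows F]
  rw [Matrix.fromBlocks_map, Matrix.fromBlocks_mul_fromRows]

lemma map_ofReal_zero : (0 : Matrix (Fin d) (Fin d) ℝ).map Complex.ofReal = 0 :=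
  Matrix.map_zero _ Complex.ofReal_zero

lemma map_ofReal_one : (1 : Matrix (Fin d) (Fin d) ℝ).map Complex.ofReal = 1 :=
  Matrix.map_one _ Complex.ofReal_zero Complex.ofReal_one

lemma map_ofReal_neg (A : Matrix (Fin d) (Fin d) ℝ) :
    (-A).map Complex.ofReal = -A.map Complex.ofReal := by
  ext; simp

lemma det_map_ofReal (A : Matrix (Fin d) (Fin d) ℝ) :
    (A.map Complex.ofReal).det = (A.det : ℂ) :=
  (Complex.ofRealHom.map_det A).symm

lemma map_ofReal_inv {A : Matrix (Fin d) (Fin d) ℝ} (hA : IsUnit A.det) :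
    (A.map Complex.ofReal)⁻¹ = A⁻¹.map Complex.ofReal := by
  apply Matrix.inv_eq_right_inv
  rw [← map_ofReal_one, ← Matrix.mul_nonsing_inv A hA]
  exact (Matrix.map_mul (f := Complex.ofRealHom)).symm

theorem covers_of_substitution {U : unitary (L2 d →L[ℂ] L2 d)}
    {A : Matrix (Fin d) (Fin d) ℝ} {c : ℂ} (hc : c ^ 2 * (A.det : ℂ) = 1)
    (hU : ∀ f : L2 d, (U : L2 d →L[ℂ] L2 d) f =ᵐ[volume]
      fun x => c * f (WithLp.toLp 2 (A⁻¹.mulVec (WithLp.ofLp x)))) :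
    Covers ℏ U (Matrix.fromBlocks A 0 0 A⁻¹ᵀ) := by
  have hA : IsUnit A.det := by
    rw [isUnit_iff_ne_zero]; rintro h; simp [h] at hc
  have hAi : IsUnit (A⁻¹).det := Matrix.isUnit_nonsing_inv_det A hA
  refine ⟨?_, implements_of_substitution ℏ hc hU, fun F hF f ⟨s, hs, hf⟩ => ?_⟩
  · rw [SymplecticGroup.fromBlocks_mem_iff]
    refine ⟨by simp, by simp, ?_⟩
    rw [← Matrix.transpose_mul, Matrix.nonsing_inv_mul A hA]
    simp
  · rw [map_fromBlocks_mul, map_ofReal_zero, Matrix.zero_mul, Matrix.zero_mul, add_zero, zero_add]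
    refine ⟨c * s, ?_, ?_⟩
    · rw [Matrix.toRows₁_fromRows, Matrix.det_mul, det_map_ofReal]
      linear_combination c ^ 2 * (A.det : ℂ) * hs + hc
    · have hD : (A⁻¹.map Complex.ofReal)ᵀ * frameForm F * A⁻¹.map Complex.ofReal =
          frameForm (Matrix.fromRows (A.map Complex.ofReal * F.toRows₁)
            (A⁻¹ᵀ.map Complex.ofReal * F.toRows₂)) := by
        unfold frameForm
        rw [Matrix.toRows₁_fromRows, Matrix.toRows₂_fromRows, Matrix.mul_inv_rev,
          map_ofReal_inv hA, Matrix.transpose_map, Matrix.mul_smul, Matrix.smul_mul]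
        simp only [Matrix.mul_assoc]
      have hq : Measure.QuasiMeasurePreserving (matrixEquiv A⁻¹ hAi) volume volume :=
        quasiMeasurePreserving_of_map_eq (map_matrixEquiv _ _)
      refine (hU f).trans ?_
      filter_upwards [hq.ae hf] with x hx
      rw [matrixEquiv_apply, gaussian_apply_matrix ℏ hD] at hx
      rw [hx, mul_assoc]

theorem covers_of_chirp {U : unitary (L2 d →L[ℂ] L2 d)}
    {C : Matrix (Fin d) (Fin d) ℝ} (hC : C.IsSymm)
    (hU : ∀ f : L2 d, (U : L2 d →L[ℂ] L2 d) f =ᵐ[volume]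
      fun x => Complex.exp (Complex.I / (2 * ℏ) * ((∑ j, ∑ k, x j * C j k * x k : ℝ) : ℂ)) * f x) :
    Covers ℏ U (Matrix.fromBlocks 1 0 (-C) 1) := by
  refine ⟨?_, implements_of_chirp hC hU, fun F hF f ⟨s, hs, hf⟩ => ?_⟩
  · rw [SymplecticGroup.fromBlocks_mem_iff]
    simp [hC.eq]
  · rw [map_fromBlocks_mul, map_ofReal_zero, map_ofReal_one, Matrix.zero_mul, Matrix.one_mul,
      add_zero, Matrix.one_mul]
    refine ⟨s, by rwa [Matrix.toRows₁_fromRows], (hU f).trans ?_⟩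
    filter_upwards [hf] with x hx
    rw [hx, mul_left_comm]
    congr 1
    have hD : frameForm (Matrix.fromRows F.toRows₁
        ((-C).map Complex.ofReal * F.toRows₁ + F.toRows₂))
        = frameForm F - Complex.I • C.map Complex.ofReal := by
      unfold frameForm
      rw [Matrix.toRows₁_fromRows, Matrix.toRows₂_fromRows, Matrix.add_mul,
        Matrix.mul_nonsing_inv_cancel_right _ _ hF.isUnit_det, map_ofReal_neg, smul_add, smul_neg]
      abel
    have hC' : (fun j => (x j : ℂ)) ⬝ᵥ C.map Complex.ofReal *ᵥ (fun j => (x j : ℂ))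
        = ((∑ j, ∑ k, x j * C j k * x k : ℝ) : ℂ) := by
      rw [sum_sum_eq_dotProduct, ← ofReal_mulVec]
      simp [dotProduct]
    rw [hD]
    unfold gaussian
    rw [← Complex.exp_add, Matrix.sub_mulVec, dotProduct_sub, Matrix.smul_mulVec, dotProduct_smul,
      hC']
    congr 1
    simp only [smul_eq_mul]
    ring

theorem covers_of_fourier (hℏ : 0 < ℏ) {U : unitary (L2 d →L[ℂ] L2 d)} {c : ℂ}
    (hc : c ^ 2 = Complex.I ^ d)
    (hU : ∀ f : L2 d, Integrable f volume →
      (U : L2 d →L[ℂ] L2 d) f =ᵐ[volume]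
        fun x => c * (((2 * Real.pi * ℏ) ^ (-(d : ℝ) / 2) : ℝ) : ℂ) *
          ∫ y : EuclideanSpace ℝ (Fin d),
            Complex.exp (Complex.I / ℏ * ((∑ j, x j * y j : ℝ) : ℂ)) * f y) :
    Covers ℏ U (Matrix.fromBlocks 0 1 (-1) 0) := by
  refine ⟨?_, implements_of_fourier hU, fun F hF f ⟨s, hs, hf⟩ => ?_⟩
  · rw [SymplecticGroup.fromBlocks_mem_iff]
    simp
  · rw [map_fromBlocks_mul, map_ofReal_neg, map_ofReal_zero, map_ofReal_one, Matrix.zero_mul,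
      Matrix.zero_mul, zero_add, add_zero, Matrix.one_mul, Matrix.neg_mul, Matrix.one_mul]
    have hsymm := hF.isSymm_frameForm
    have hpos := hF.posDef_frameForm
    have hX := hF.isUnit_det
    obtain ⟨κ, hκ, hint⟩ := integral_exp_mul_gaussian hℏ hsymm hpos
    have hdetM : (frameForm F).det * F.toRows₁.det = Complex.I ^ d * F.toRows₂.det := by
      unfold frameForm
      rw [Matrix.det_smul, Fintype.card_fin, mul_assoc, ← Matrix.det_mul, Matrix.mul_assoc,
        Matrix.nonsing_inv_mul _ hX, Matrix.mul_one]
    refine ⟨c * κ * s, ?_, ?_⟩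
    · rw [Matrix.toRows₁_fromRows]
      linear_combination κ ^ 2 * s ^ 2 * F.toRows₂.det * hc - κ ^ 2 * s ^ 2 * hdetM + hκ +
        κ ^ 2 * (frameForm F).det * hs
    · have hD : frameForm (Matrix.fromRows F.toRows₂ (-F.toRows₁)) = (frameForm F)⁻¹ := by
        symm
        have hQ : IsUnit F.toRows₂.det := by
          rw [isUnit_iff_ne_zero]
          intro h
          rw [h, mul_zero] at hdetM
          rcases mul_eq_zero.1 hdetM with h | h
          · simp [h] at hκ
          · exact hX.ne_zero h
        apply Matrix.inv_eq_right_inv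
        unfold frameForm
        rw [Matrix.toRows₁_fromRows, Matrix.toRows₂_fromRows, Matrix.mul_smul, Matrix.smul_mul,
          smul_smul, Complex.I_mul_I, Matrix.neg_mul, Matrix.mul_neg, smul_neg, neg_smul, one_smul,
          neg_neg, Matrix.mul_assoc, Matrix.nonsing_inv_mul_cancel_left _ _ hX,
          Matrix.mul_nonsing_inv _ hQ]
      have hfint : Integrable f volume :=
        ((integrable_gaussian hℏ hsymm hpos).const_mul s).congr hf.symm
      refine (hU f hfint).trans (Filter.Eventually.of_forall fun x => ?_)
      simp only
      have h1 : ∫ y : EuclideanSpace ℝ (Fin d),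
            Complex.exp (Complex.I / ℏ * ((∑ j, x j * y j : ℝ) : ℂ)) * f y
          = s * ∫ y : EuclideanSpace ℝ (Fin d),
            Complex.exp (Complex.I / ℏ * ((∑ j, x j * y j : ℝ) : ℂ)) *
              gaussian ℏ (frameForm F) y := by
        rw [← integral_const_mul]
        refine integral_congr_ae ?_
        filter_upwards [hf] with y hy
        rw [hy]; ring
      rw [h1, hD]
      linear_combination c * s * hint x

/-- Every element of the metaplectic group covers a symplectic matrix. -/
theorem exists_covers (hℏ : 0 < ℏ) {U : unitary (L2 d →L[ℂ] L2 d)}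
    (hU : U ∈ metaplecticGroup ℏ d) :
    ∃ S : Matrix (Fin d ⊕ Fin d) (Fin d ⊕ Fin d) ℝ, Covers ℏ U S := by
  induction hU using Subgroup.closure_induction with
  | mem U hU =>
    rcases hU with ⟨A, c, hc, h⟩ | ⟨C, hC, h⟩ | ⟨c, hc, h⟩
    · exact ⟨_, covers_of_substitution hc h⟩
    · exact ⟨_, covers_of_chirp hC h⟩
    · exact ⟨_, covers_of_fourier hℏ hc h⟩
  | one => exact ⟨1, Covers.one⟩
  | mul U V _ _ h1 h2 =>
    obtain ⟨S, hS⟩ := h1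
    obtain ⟨T, hT⟩ := h2
    exact ⟨S * T, hS.mul hT⟩
  | inv U _ h =>
    obtain ⟨S, hS⟩ := h
    exact ⟨S⁻¹, hS.inv hℏ⟩

/-! ### The ground state -/

lemma gaussian_one_eq (ℏ : ℝ) (x : EuclideanSpace ℝ (Fin d)) :
    gaussian ℏ 1 x = ((Real.exp (-(‖x‖ ^ 2 / (2 * ℏ))) : ℝ) : ℂ) := by
  unfold gaussian
  rw [Matrix.one_mulVec, Complex.ofReal_exp, EuclideanSpace.real_norm_sq_eq]
  congr 1
  push_cast
  rw [dotProduct, neg_mul, Finset.mul_sum, Finset.sum_div]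
  congr 1
  refine Finset.sum_congr rfl fun j _ => by ring

lemma posDef_re_one : ((1 : Matrix (Fin d) (Fin d) ℂ).map Complex.re).PosDef := by
  rw [Matrix.map_one _ Complex.zero_re Complex.one_re]
  exact Matrix.PosDef.one

/-- The Gaussian `exp(-|x|²/(2ℏ))` as an element of `L²(ℝᵈ)`. -/
def groundState (d : ℕ) {ℏ : ℝ} (hℏ : 0 < ℏ) : L2 d :=
  (memLp_gaussian hℏ Matrix.isSymm_one posDef_re_one).toLp (gaussian ℏ 1)

lemma groundState_ae_eq (hℏ : 0 < ℏ) : groundState d hℏ =ᵐ[volume] gaussian ℏ 1 :=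
  MemLp.coeFn_toLp _

lemma continuous_weyl (ℏ : ℝ) (w : Fin d → ℂ) {f : EuclideanSpace ℝ (Fin d) → ℂ}
    (hf : Continuous f) : Continuous (weyl ℏ w f) := by
  unfold weyl
  refine Continuous.mul (by fun_prop) (hf.comp (by fun_prop))

/-- The Weyl operators of different points of phase space differ on the ground state. -/
lemma eq_of_weyl_gaussian_eq (hℏ : 0 < ℏ) {w w' : Fin d → ℂ}
    (h : weyl ℏ w (gaussian ℏ 1) =ᵐ[volume] weyl ℏ w' (gaussian ℏ 1)) : w = w' := by
  have hc := continuous_gaussian (d := d) ℏ 1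
  have h1 := (Continuous.ae_eq_iff_eq volume (continuous_weyl ℏ w hc)
    (continuous_weyl ℏ w' hc)).1 h
  have hre : (fun j => (w j).re) = fun j => (w' j).re := by
    have h2 := congrArg norm (congrFun h1 (-WithLp.toLp 2 fun j => (w j).re))
    simp only [weyl, norm_mul, norm_exp_I_div_mul, one_mul, gaussian_one_eq, Complex.norm_real,
      Real.norm_eq_abs, Real.abs_exp, neg_add_cancel, Real.exp_eq_exp] at h2
    have h3 : ‖-WithLp.toLp 2 (fun j => (w j).re) +
        WithLp.toLp 2 (fun j => (w' j).re)‖ ^ 2 = 0 := by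
      field_simp at h2
      simpa using h2.symm
    have h4 := norm_eq_zero.1 (pow_eq_zero_iff two_ne_zero |>.1 h3)
    have h5 : WithLp.toLp 2 (fun j => (w j).re) = WithLp.toLp 2 (fun j => (w' j).re) := by
      rwa [neg_add_eq_zero] at h4
    exact (WithLp.toLp_injective 2) h5
  set p := fun j => (w j).re with hp
  set q := fun j => (w j).im with hq
  set q' := fun j => (w' j).im with hq'
  have him : q = q' := by
    by_contra hne
    have hδ : (q - q') ⬝ᵥ (q - q') ≠ 0 := by
      rw [Ne, dotProduct_self_eq_zero, sub_eq_zero]; exact hne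
    set N := (q - q') ⬝ᵥ (q - q') with hN
    -- at this point the two phases differ by `π`
    let x : EuclideanSpace ℝ (Fin d) :=
      WithLp.toLp 2 ((Real.pi * ℏ / N) • (q - q') - (1 / 2 : ℝ) • p)
    have h2 := congrFun h1 x
    rw [weyl_apply, weyl_apply, ← hp, ← hq, ← hq', ← hre] at h2
    have h3 : gaussian ℏ 1 (x + WithLp.toLp 2 p) ≠ 0 := Complex.exp_ne_zero _
    have h4 := mul_right_cancel₀ h3 h2
    rw [Complex.exp_eq_exp_iff_exp_sub_eq_one, ← mul_sub, ← Complex.ofReal_sub] at h4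
    have h5 : q ⬝ᵥ WithLp.ofLp x + p ⬝ᵥ q / 2 - (q' ⬝ᵥ WithLp.ofLp x + p ⬝ᵥ q' / 2)
        = Real.pi * ℏ := by
      have h6 : (q - q') ⬝ᵥ WithLp.ofLp x = Real.pi * ℏ - (p ⬝ᵥ q - p ⬝ᵥ q') / 2 := by
        rw [dotProduct_sub (q - q'), dotProduct_smul, dotProduct_smul, smul_eq_mul, smul_eq_mul,
          ← hN, dotProduct_comm (q - q') p, dotProduct_sub, div_mul_cancel₀ _ hδ]
        ring
      rw [sub_dotProduct] at h6
      linarith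
    have hℏ' : (ℏ : ℂ) ≠ 0 := by exact_mod_cast hℏ.ne'
    have h7 : Complex.I / ℏ * ((Real.pi * ℏ : ℝ) : ℂ) = Real.pi * Complex.I := by
      push_cast; field_simp
    rw [h5, h7, Complex.exp_pi_mul_I] at h4
    norm_num at h4
  funext j
  exact Complex.ext (congrFun hre j) (congrFun him j)

/-- The phase space map that a unitary operator implements is determined by the operator. -/
lemma Implements.unique (hℏ : 0 < ℏ) {U : unitary (L2 d →L[ℂ] L2 d)}
    {S T : (Fin d → ℂ) → (Fin d → ℂ)} (hS : Implements ℏ U S) (hT : Implements ℏ U T) :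
    S = T := by
  rw [implements_iff] at hS hT
  funext w
  have h := (hS w (((U⁻¹ : unitary (L2 d →L[ℂ] L2 d)) : L2 d →L[ℂ] L2 d)
    (groundState d hℏ))).symm.trans (hT w _)
  rw [unitary_apply_inv_apply] at h
  refine eq_of_weyl_gaussian_eq hℏ ?_
  have h1 := weylOp_ae_eq ℏ (S w) (groundState d hℏ)
  have h2 := weylOp_ae_eq ℏ (T w) (groundState d hℏ)
  rw [h] at h1
  exact ((weyl_congr ℏ _ (groundState_ae_eq hℏ)).symm.trans h1.symm).trans
    (h2.trans (weyl_congr ℏ _ (groundState_ae_eq hℏ)))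

/-- The real `2d × 2d` matrix of a complex `d × d` matrix acting on `ℂᵈ ≅ ℝ²ᵈ`. -/
def realBlock (g : Matrix (Fin d) (Fin d) ℂ) : Matrix (Fin d ⊕ Fin d) (Fin d ⊕ Fin d) ℝ :=
  Matrix.fromBlocks (g.map Complex.re) (-g.map Complex.im) (g.map Complex.im) (g.map Complex.re)

lemma phaseMap_realBlock (g : Matrix (Fin d) (Fin d) ℂ) (w : Fin d → ℂ) :
    phaseMap (realBlock g) w = g *ᵥ w := by
  funext j
  apply Complex.ext
  · simp [phaseMap, realBlock, Matrix.mulVec, dotProduct, sub_eq_add_neg,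
      Finset.sum_add_distrib]
  · simp [phaseMap, realBlock, Matrix.mulVec, dotProduct, Finset.sum_add_distrib, add_comm]

lemma phaseMap_injective : Function.Injective
    (phaseMap : Matrix (Fin d ⊕ Fin d) (Fin d ⊕ Fin d) ℝ → (Fin d → ℂ) → (Fin d → ℂ)) := by
  intro S T h
  apply Matrix.toLin'.injective
  refine LinearMap.ext fun v => ?_
  have h1 := congrFun h (fun j => ⟨v (Sum.inl j), v (Sum.inr j)⟩)
  have h2 : Sum.elim (fun j => v (Sum.inl j)) (fun j => v (Sum.inr j)) = v := by
    refine funext ?_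
    rintro (j | j) <;> rfl
  rw [Matrix.toLin'_apply, Matrix.toLin'_apply]
  refine funext ?_
  rintro (j | j)
  · have := congrArg Complex.re (congrFun h1 j)
    simpa only [phaseMap, h2] using this
  · have := congrArg Complex.im (congrFun h1 j)
    simpa only [phaseMap, h2] using this

/-- The frame of the ground state. -/
def standardFrame (d : ℕ) : Matrix (Fin d ⊕ Fin d) (Fin d) ℂ :=
  Matrix.fromRows 1 (-(Complex.I • (1 : Matrix (Fin d) (Fin d) ℂ)))

lemma isPositiveFrame_standardFrame : IsPositiveFrame (standardFrame d) := by
  constructor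
  · rw [transpose_mul_J_mul]
    simp [standardFrame]
  · rw [conjTranspose_mul_J_mul]
    have : (-Complex.I) • ((standardFrame d).toRows₂ᴴ * (standardFrame d).toRows₁ -
        (standardFrame d).toRows₁ᴴ * (standardFrame d).toRows₂) = 1 + 1 := by
      simp [standardFrame, smul_smul]
    rw [this]
    exact Matrix.PosDef.one.add Matrix.PosDef.one

lemma frameForm_fromRows {X : Matrix (Fin d) (Fin d) ℂ} (hX : IsUnit X.det) :
    frameForm (Matrix.fromRows X (-(Complex.I • X))) = 1 := by
  unfold frameForm
  rw [Matrix.toRows₁_fromRows, Matrix.toRows₂_fromRows, Matrix.neg_mul, Matrix.smul_mul,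
    Matrix.mul_nonsing_inv _ hX, smul_neg, smul_smul, Complex.I_mul_I, neg_smul, one_smul, neg_neg]

/-- The ground state is an eigenvector of each metaplectic operator of a unitary matrix. -/
theorem exists_apply_groundState (hℏ : 0 < ℏ) {g : Matrix.unitaryGroup (Fin d) ℂ}
    {U : unitary (L2 d →L[ℂ] L2 d)} (hU : IsMetaplecticOperator ℏ g U) :
    ∃ ζ : ℂ, ζ ^ 2 = ((g : Matrix (Fin d) (Fin d) ℂ).det)⁻¹ ∧
      (U : L2 d →L[ℂ] L2 d) (groundState d hℏ) = ζ • groundState d hℏ := by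
  obtain ⟨S, hS⟩ := exists_covers hℏ hU.1
  have hSg : S = realBlock (g : Matrix (Fin d) (Fin d) ℂ) := by
    apply phaseMap_injective
    rw [hS.implements.unique hℏ hU.2]
    funext w
    rw [phaseMap_realBlock]
  have hdet : IsUnit (g : Matrix (Fin d) (Fin d) ℂ).det := Matrix.UnitaryGroup.det_isUnit g
  have h0 : IsHalfForm ℏ (standardFrame d) (groundState d hℏ) := by
    refine ⟨1, by simp [standardFrame], ?_⟩
    have : frameForm (standardFrame d) = 1 := frameForm_fromRows (by simp)
    rw [this]
    simpa using groundState_ae_eq hℏ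
  have h1 := hS.isHalfForm _ isPositiveFrame_standardFrame _ h0
  have h2 : S.map Complex.ofReal * standardFrame d =
      Matrix.fromRows (g : Matrix (Fin d) (Fin d) ℂ)
        (-(Complex.I • (g : Matrix (Fin d) (Fin d) ℂ))) := by
    have hg : (g : Matrix (Fin d) (Fin d) ℂ) =
        ((g : Matrix (Fin d) (Fin d) ℂ).map Complex.re).map Complex.ofReal +
        Complex.I • ((g : Matrix (Fin d) (Fin d) ℂ).map Complex.im).map Complex.ofReal := by
      ext i j
      simp [mul_comm Complex.I]
    rw [hSg, realBlock, map_fromBlocks_mul, standardFrame, Matrix.toRows₁_fromRows,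
      Matrix.toRows₂_fromRows, map_ofReal_neg, Matrix.mul_one, Matrix.mul_one, Matrix.mul_neg,
      Matrix.mul_neg, Matrix.mul_smul, Matrix.mul_smul, Matrix.mul_one, Matrix.mul_one,
      smul_neg, neg_neg]
    congr 1
    · exact hg.symm
    · conv_rhs => rw [hg]
      rw [smul_add, smul_smul, Complex.I_mul_I, neg_smul, one_smul, neg_add, neg_neg, add_comm]
  rw [h2] at h1
  obtain ⟨ζ, hζ, hUζ⟩ := h1
  rw [frameForm_fromRows (by simpa using hdet)] at hUζ
  rw [Matrix.toRows₁_fromRows] at hζ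
  refine ⟨ζ, eq_inv_of_mul_eq_one_left hζ, Lp.ext ?_⟩
  filter_upwards [hUζ, groundState_ae_eq (d := d) hℏ, Lp.coeFn_smul ζ (groundState d hℏ)]
    with x h3 h4 h5
  rw [h3, h5, Pi.smul_apply, h4, smul_eq_mul]

end

end Metaplectic

namespace Metaplectic

noncomputable section

/-! ### Existence of metaplectic operators -/

open scoped Matrix

variable {d : ℕ} {ℏ : ℝ}

lemma fromBlocks_generators_mul (C L K E : Matrix (Fin d) (Fin d) ℝ) :
    Matrix.fromBlocks 1 0 (-C) 1 * (Matrix.fromBlocks L 0 0 K *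
      (Matrix.fromBlocks 0 1 (-1) 0 * Matrix.fromBlocks 1 0 (-E) 1)) =
      Matrix.fromBlocks (-(L * E)) L (C * L * E - K) (-(C * L)) := by
  simp [Matrix.fromBlocks_multiply, Matrix.mul_assoc, sub_eq_add_neg]

lemma re_im_relations {g : Matrix (Fin d) (Fin d) ℂ} (hg : g ∈ Matrix.unitaryGroup (Fin d) ℂ) :
    g.map Complex.re * (g.map Complex.im)ᵀ = g.map Complex.im * (g.map Complex.re)ᵀ ∧
    (g.map Complex.im)ᵀ * g.map Complex.re = (g.map Complex.re)ᵀ * g.map Complex.im ∧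
    (g.map Complex.re)ᵀ * g.map Complex.re + (g.map Complex.im)ᵀ * g.map Complex.im = 1 := by
  have h1 : g * star g = 1 := Matrix.mem_unitaryGroup_iff.1 hg
  have h2 : star g * g = 1 := Matrix.mem_unitaryGroup_iff'.1 hg
  refine ⟨?_, ?_, ?_⟩
  · ext i j
    have := congrArg Complex.im (congrFun (congrFun h1 i) j)
    simp only [Matrix.mul_apply, Matrix.star_apply, Complex.im_sum, Complex.mul_im,
      RCLike.star_def, Complex.conj_re, Complex.conj_im, Matrix.one_apply] at this
    have h0 : (if i = j then (1 : ℂ) else 0).im = 0 := by split_ifs <;> simp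
    rw [h0] at this
    simp only [Matrix.mul_apply, Matrix.map_apply, Matrix.transpose_apply]
    rw [← sub_eq_zero, ← Finset.sum_sub_distrib, ← neg_eq_zero, ← Finset.sum_neg_distrib, ← this]
    refine Finset.sum_congr rfl fun k _ => by ring
  · ext i j
    have := congrArg Complex.im (congrFun (congrFun h2 i) j)
    simp only [Matrix.mul_apply, Matrix.star_apply, Complex.im_sum, Complex.mul_im,
      RCLike.star_def, Complex.conj_re, Complex.conj_im, Matrix.one_apply] at this
    have h0 : (if i = j then (1 : ℂ) else 0).im = 0 := by split_ifs <;> simp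
    rw [h0] at this
    simp only [Matrix.mul_apply, Matrix.map_apply, Matrix.transpose_apply]
    rw [← sub_eq_zero, ← Finset.sum_sub_distrib, ← neg_eq_zero, ← Finset.sum_neg_distrib, ← this]
    refine Finset.sum_congr rfl fun k _ => by ring
  · ext i j
    have := congrArg Complex.re (congrFun (congrFun h2 i) j)
    simp only [Matrix.mul_apply, Matrix.star_apply, Complex.re_sum, Complex.mul_re,
      RCLike.star_def, Complex.conj_re, Complex.conj_im, Matrix.one_apply] at this
    have h0 : (if i = j then (1 : ℂ) else 0).re = if i = j then 1 else 0 := by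
      split_ifs <;> simp
    rw [h0] at this
    simp only [Matrix.add_apply, Matrix.mul_apply, Matrix.map_apply, Matrix.transpose_apply,
      Matrix.one_apply]
    rw [← this, ← Finset.sum_add_distrib]
    refine Finset.sum_congr rfl fun k _ => by ring

/-- If the imaginary part `B` of the unitary matrix `A + iB` is invertible, the matrix is the
product of a chirp, a linear substitution, the Fourier transform and another chirp. -/
lemma exists_metaplectic_of_isUnit_im (hℏ : 0 < ℏ) {g : Matrix (Fin d) (Fin d) ℂ}
    (hg : g ∈ Matrix.unitaryGroup (Fin d) ℂ) (hB : IsUnit (g.map Complex.im).det) :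
    ∃ U ∈ metaplecticGroup ℏ d, Implements ℏ U (fun w => g *ᵥ w) := by
  obtain ⟨r1, r2, r3⟩ := re_im_relations hg
  set A := g.map Complex.re with hA
  set B := g.map Complex.im with hBdef
  have hBt : IsUnit Bᵀ.det := by rwa [Matrix.det_transpose]
  have hL : IsUnit (-B).det := by
    rw [Matrix.det_neg]; exact ((isUnit_one.neg).pow _).mul hB
  have hLinv : (-B)⁻¹ = -B⁻¹ := by
    apply Matrix.inv_eq_right_inv
    rw [neg_mul_neg, Matrix.mul_nonsing_inv _ hB]
  have hs1 : (B⁻¹ * A).IsSymm := by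
    rw [Matrix.IsSymm, Matrix.transpose_mul, Matrix.transpose_nonsing_inv]
    have : A * Bᵀ * Bᵀ⁻¹ = A := Matrix.mul_nonsing_inv_cancel_right _ _ hBt
    conv_rhs => rw [← this, r1]
    rw [Matrix.mul_assoc B, Matrix.nonsing_inv_mul_cancel_left _ _ hB]
  have hs2 : (A * B⁻¹).IsSymm := by
    rw [Matrix.IsSymm, Matrix.transpose_mul, Matrix.transpose_nonsing_inv]
    have : Bᵀ⁻¹ * (Bᵀ * A) = A := Matrix.nonsing_inv_mul_cancel_left _ _ hBt
    conv_rhs => rw [← this, r2]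
    rw [← Matrix.mul_assoc, Matrix.mul_nonsing_inv_cancel_right _ _ hB]
  obtain ⟨V₁, hV₁⟩ := exists_isChirp ℏ (A * B⁻¹)
  obtain ⟨V₂, hV₂⟩ := exists_isChirp ℏ (B⁻¹ * A)
  obtain ⟨W, c, hc, hW⟩ := exists_isLinearSubstitution (-B) hL
  obtain ⟨Φ, k, hk, hΦ⟩ := exists_isNormalizedFourier (d := d) hℏ
  refine ⟨V₁ * (W * (Φ * V₂)), ?_, ?_⟩
  · refine mul_mem ?_ (mul_mem ?_ (mul_mem ?_ ?_)) <;> apply Subgroup.subset_closure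
    · exact Or.inr (Or.inl ⟨_, hs2, hV₁⟩)
    · exact Or.inl ⟨_, c, hc, hW⟩
    · exact Or.inr (Or.inr ⟨k, hk, hΦ⟩)
    · exact Or.inr (Or.inl ⟨_, hs1, hV₂⟩)
  · have h := (implements_of_chirp hs2 hV₁).mul ((implements_of_substitution ℏ hc hW).mul
      ((implements_of_fourier hΦ).mul (implements_of_chirp hs1 hV₂)))
    simp only [← phaseMap_mul] at h
    rw [fromBlocks_generators_mul] at h
    have hblock : Matrix.fromBlocks (-(-B * (B⁻¹ * A))) (-B)
        (A * B⁻¹ * -B * (B⁻¹ * A) - (-B)⁻¹ᵀ) (-(A * B⁻¹ * -B)) = realBlock g := by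
      unfold realBlock
      rw [← hA, ← hBdef, hLinv]
      congr 1
      · rw [Matrix.neg_mul, neg_neg, Matrix.mul_nonsing_inv_cancel_left _ _ hB]
      · have h1 : A * B⁻¹ * -B * (B⁻¹ * A) = -(A * B⁻¹ * A) := by
          rw [Matrix.mul_neg, Matrix.neg_mul, Matrix.nonsing_inv_mul_cancel_right _ _ hB,
            Matrix.mul_assoc]
        have h2 : A * B⁻¹ = Bᵀ⁻¹ * Aᵀ := by
          conv_lhs => rw [← hs2.eq]
          rw [Matrix.transpose_mul, Matrix.transpose_nonsing_inv]
        rw [h1, h2, Matrix.mul_assoc, eq_sub_of_add_eq r3, Matrix.mul_sub, Matrix.mul_one,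
          Matrix.nonsing_inv_mul_cancel_left _ _ hBt, Matrix.transpose_neg,
          Matrix.transpose_nonsing_inv]
        abel
      · rw [Matrix.mul_neg, neg_neg, Matrix.nonsing_inv_mul_cancel_right _ _ hB]
    rw [hblock] at h
    simpa only [phaseMap_realBlock] using h

lemma infinite_sphere : (Metric.sphere (0 : ℂ) 1).Infinite := by
  have h : IsPreconnected (Metric.sphere (0 : ℂ) 1) :=
    isPreconnected_sphere (by simp [Complex.rank_real_complex]) 0 1
  refine h.infinite_of_nontrivial ⟨1, by simp, -1, by simp, ?_⟩
  norm_num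

/-- There is a rotation after which the imaginary part of a unitary matrix is invertible. -/
lemma exists_rotation_isUnit_im {g : Matrix (Fin d) (Fin d) ℂ}
    (hg : g ∈ Matrix.unitaryGroup (Fin d) ℂ) :
    ∃ c : ℂ, ‖c‖ = 1 ∧ c.im ≠ 0 ∧ IsUnit ((star c • g).map Complex.im).det := by
  have hgdet : IsUnit g.det := Matrix.UnitaryGroup.det_isUnit ⟨g, hg⟩
  set gb : Matrix (Fin d) (Fin d) ℂ := g.map (starRingEnd ℂ) with hgb
  have hgbdet : IsUnit gb.det := by
    rw [hgb]
    have := (starRingEnd ℂ).map_det g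
    rw [RingHom.mapMatrix_apply] at this
    rw [← this]
    exact hgdet.map _
  set N := gb⁻¹ * g with hN
  -- the zeros of this polynomial on the circle are the rotations to be avoided
  set p : Polynomial ℂ := N.charpoly.comp (Polynomial.X ^ 2) * (Polynomial.X ^ 2 - 1) with hp
  have hp0 : p ≠ 0 := by
    refine mul_ne_zero ?_ ?_
    · exact (N.charpoly_monic.comp (Polynomial.monic_X_pow 2) (by simp)).ne_zero
    · exact Polynomial.X_pow_sub_C_ne_zero two_pos 1
  obtain ⟨c, hc, hpc⟩ : ∃ c ∈ Metric.sphere (0 : ℂ) 1, c ∉ (p.roots.toFinset : Set ℂ) :=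
    (infinite_sphere.sdiff (Finset.finite_toSet _)).nonempty
  have hc1 : ‖c‖ = 1 := by simpa using hc
  have hc0 : c ≠ 0 := by rintro rfl; simp at hc1
  have heval : p.eval c ≠ 0 := by
    intro h
    apply hpc
    simp [hp0, Polynomial.IsRoot, h]
  rw [hp, Polynomial.eval_mul, Polynomial.eval_comp] at heval
  obtain ⟨h1, h2⟩ := mul_ne_zero_iff.1 heval
  simp only [Polynomial.eval_pow, Polynomial.eval_X, Polynomial.eval_sub, Polynomial.eval_one]
    at h1 h2
  have hcc : star c * c = 1 := by
    have := Complex.conj_mul' c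
    rw [hc1] at this
    simpa using this
  refine ⟨c, hc1, ?_, ?_⟩
  · intro him
    apply h2
    have : star c = c := Complex.conj_eq_iff_im.2 him
    rw [this] at hcc
    rw [pow_two, hcc, sub_self]
  · have hid : (2 * Complex.I) • ((star c • g).map Complex.im).map Complex.ofReal
        = -(star c • (gb * (Matrix.scalar (Fin d) (c ^ 2) - N))) := by
      have e1 : gb * (Matrix.scalar (Fin d) (c ^ 2) - N) = c ^ 2 • gb - g := by
        rw [Matrix.mul_sub, hN, Matrix.mul_nonsing_inv_cancel_left _ _ hgbdet, Matrix.scalar_apply,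
          ← Matrix.smul_one_eq_diagonal, Matrix.mul_smul, Matrix.mul_one]
      rw [e1, smul_sub, smul_smul, pow_two, ← mul_assoc, hcc, one_mul]
      ext i j
      have h3 := Complex.sub_conj (star c * g i j)
      simp only [Matrix.smul_apply, Matrix.map_apply, Matrix.neg_apply, Matrix.sub_apply, hgb,
        smul_eq_mul, neg_sub]
      rw [RingHom.map_mul] at h3
      have h4 : (starRingEnd ℂ) (star c) = c := star_star c
      rw [h4] at h3
      rw [h3]
      push_cast
      ring
    have hne : ((2 * Complex.I) • ((star c • g).map Complex.im).map Complex.ofReal).det ≠ 0 := by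
      rw [hid, Matrix.det_neg, Matrix.det_smul, Matrix.det_mul, ← Matrix.eval_charpoly]
      refine mul_ne_zero (pow_ne_zero _ (by norm_num)) (mul_ne_zero (pow_ne_zero _ ?_)
        (mul_ne_zero hgbdet.ne_zero h1))
      exact star_ne_zero.2 hc0
    rw [Matrix.det_smul, det_map_ofReal] at hne
    rw [isUnit_iff_ne_zero]
    intro h
    rw [h] at hne
    simp at hne

/-- Every unitary matrix has a metaplectic operator: it is the product of `c̄ g` and the scalar
matrix `c`, for a rotation `c` that makes both imaginary parts invertible. -/
theorem exists_isMetaplecticOperator (hℏ : 0 < ℏ) (g : Matrix.unitaryGroup (Fin d) ℂ) :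
    ∃ U : unitary (L2 d →L[ℂ] L2 d), IsMetaplecticOperator ℏ g U := by
  obtain ⟨c, hc, him, hu⟩ := exists_rotation_isUnit_im g.2
  have hcc : c * star c = 1 := by
    have := Complex.mul_conj' c
    rw [hc] at this
    simpa using this
  have hcc' : star c * c = 1 := by rw [mul_comm]; exact hcc
  have h1 : star c • (g : Matrix (Fin d) (Fin d) ℂ) ∈ Matrix.unitaryGroup (Fin d) ℂ := by
    rw [Matrix.mem_unitaryGroup_iff, star_smul, star_star, Matrix.smul_mul, Matrix.mul_smul,
      smul_smul, hcc', one_smul]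
    exact Matrix.mem_unitaryGroup_iff.1 g.2
  have h2 : c • (1 : Matrix (Fin d) (Fin d) ℂ) ∈ Matrix.unitaryGroup (Fin d) ℂ := by
    rw [Matrix.mem_unitaryGroup_iff, star_smul, Matrix.smul_mul, Matrix.mul_smul,
      smul_smul, hcc, one_smul, star_one, Matrix.mul_one]
  have h3 : IsUnit ((c • (1 : Matrix (Fin d) (Fin d) ℂ)).map Complex.im).det := by
    have : (c • (1 : Matrix (Fin d) (Fin d) ℂ)).map Complex.im
        = c.im • (1 : Matrix (Fin d) (Fin d) ℝ) := by
      ext i j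
      rcases eq_or_ne i j with rfl | hij
      · simp
      · simp [hij]
    rw [this, Matrix.det_smul, Matrix.det_one, mul_one]
    exact (isUnit_iff_ne_zero.2 him).pow _
  obtain ⟨U, hU, hU'⟩ := exists_metaplectic_of_isUnit_im hℏ h1 hu
  obtain ⟨V, hV, hV'⟩ := exists_metaplectic_of_isUnit_im hℏ h2 h3
  refine ⟨U * V, mul_mem hU hV, ?_⟩
  have h := hU'.mul hV'
  simp only [Matrix.smul_mulVec, Matrix.one_mulVec, Matrix.mulVec_smul, smul_smul, hcc,
    one_smul] at h
  exact h

end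

end Metaplectic

namespace Metaplectic

noncomputable section

/-! ### Gaussian integrals of entire functions -/

open scoped Matrix

variable {d : ℕ}

/-- `F` is at most of the order of `exp(a |z|² + b |z|)` for some `b`. -/
def HasGrowth (a : ℝ) (F : (Fin d → ℂ) → ℂ) : Prop :=
  ∃ C b : ℝ, ∀ z, ‖F z‖ ≤ C * Real.exp (a * ∑ j, ‖z j‖ ^ 2 + b * ∑ j, ‖z j‖)

lemma HasGrowth.mul {a a' : ℝ} {F G : (Fin d → ℂ) → ℂ} (hF : HasGrowth a F)
    (hG : HasGrowth a' G) : HasGrowth (a + a') (fun z => F z * G z) := by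
  obtain ⟨C, b, h⟩ := hF
  obtain ⟨C', b', h'⟩ := hG
  refine ⟨C * C', b + b', fun z => ?_⟩
  rw [norm_mul]
  calc ‖F z‖ * ‖G z‖ ≤ _ := mul_le_mul (h z) (h' z) (norm_nonneg _) ((norm_nonneg _).trans (h z))
    _ = _ := by
      rw [mul_mul_mul_comm, ← Real.exp_add]
      congr 2; ring

lemma hasGrowth_const (c : ℂ) : HasGrowth 0 (fun _ : Fin d → ℂ => c) :=
  ⟨‖c‖, 0, fun z => by simp⟩

lemma HasGrowth.pow {F : (Fin d → ℂ) → ℂ} (hF : HasGrowth 0 F) (n : ℕ) :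
    HasGrowth 0 (fun z => F z ^ n) := by
  induction n with
  | zero => simpa using hasGrowth_const 1
  | succ n ih => simpa [pow_succ] using ih.mul hF

lemma HasGrowth.prod {ι : Type*} (s : Finset ι) {F : ι → (Fin d → ℂ) → ℂ}
    (hF : ∀ i ∈ s, HasGrowth 0 (F i)) : HasGrowth 0 (fun z => ∏ i ∈ s, F i z) := by
  classical
  induction s using Finset.induction_on with
  | empty => simpa using hasGrowth_const 1
  | insert i s hi ih =>
    simp only [Finset.prod_insert hi]
    simpa using (hF i (Finset.mem_insert_self i s)).mul
      (ih fun k hk => hF k (Finset.mem_insert_of_mem hk))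

lemma norm_dotProduct_le (c z : Fin d → ℂ) :
    ‖∑ j, c j * z j‖ ≤ (∑ j, ‖c j‖) * ∑ j, ‖z j‖ := by
  refine (norm_sum_le _ _).trans ?_
  rw [Finset.sum_mul]
  refine Finset.sum_le_sum fun j _ => ?_
  rw [norm_mul]
  exact mul_le_mul_of_nonneg_left
    (Finset.single_le_sum (fun i _ => norm_nonneg (z i)) (Finset.mem_univ j)) (norm_nonneg _)

lemma hasGrowth_exp_linear (c : Fin d → ℂ) :
    HasGrowth 0 (fun z => Complex.exp (∑ j, c j * z j)) := by
  refine ⟨1, ∑ j, ‖c j‖, fun z => ?_⟩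
  rw [one_mul, zero_mul, zero_add]
  exact (Complex.norm_exp_le_exp_norm _).trans (Real.exp_le_exp.2 (norm_dotProduct_le c z))

lemma hasGrowth_linear (c : Fin d → ℂ) : HasGrowth 0 (fun z => ∑ j, c j * z j) := by
  refine ⟨1, ∑ j, ‖c j‖, fun z => ?_⟩
  rw [one_mul, zero_mul, zero_add]
  exact (norm_dotProduct_le c z).trans ((le_add_of_nonneg_right zero_le_one).trans
    (Real.add_one_le_exp _))

lemma HasGrowth.comp_add {a : ℝ} (ha : 0 ≤ a) {F : (Fin d → ℂ) → ℂ} (hF : HasGrowth a F)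
    (w : Fin d → ℂ) : HasGrowth a (fun z => F (w + z)) := by
  obtain ⟨C, b, h⟩ := hF
  have hC : 0 ≤ C := by
    have := (norm_nonneg _).trans (h 0)
    simpa using this
  refine ⟨C * Real.exp (a * ∑ j, ‖w j‖ ^ 2 + |b| * ∑ j, ‖w j‖), 2 * a * (∑ j, ‖w j‖) + |b|,
    fun z => (h _).trans ?_⟩
  rw [mul_assoc, ← Real.exp_add]
  refine mul_le_mul_of_nonneg_left (Real.exp_le_exp.2 ?_) hC
  have h1 : ∑ j, ‖(w + z) j‖ ^ 2 ≤ ∑ j, ‖w j‖ ^ 2 + 2 * ((∑ j, ‖w j‖) * ∑ j, ‖z j‖) +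
      ∑ j, ‖z j‖ ^ 2 := by
    have h2 : ∑ j, ‖w j‖ * ‖z j‖ ≤ (∑ j, ‖w j‖) * ∑ j, ‖z j‖ := by
      rw [Finset.sum_mul]
      refine Finset.sum_le_sum fun j _ => mul_le_mul_of_nonneg_left
        (Finset.single_le_sum (fun i _ => norm_nonneg (z i)) (Finset.mem_univ j)) (norm_nonneg _)
    calc ∑ j, ‖(w + z) j‖ ^ 2 ≤ ∑ j, (‖w j‖ ^ 2 + 2 * (‖w j‖ * ‖z j‖) + ‖z j‖ ^ 2) := by
          refine Finset.sum_le_sum fun j _ => ?_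
          have := pow_le_pow_left₀ (norm_nonneg _) (norm_add_le (w j) (z j)) 2
          simp only [Pi.add_apply]
          linarith [add_sq ‖w j‖ ‖z j‖]
      _ = ∑ j, ‖w j‖ ^ 2 + 2 * (∑ j, ‖w j‖ * ‖z j‖) + ∑ j, ‖z j‖ ^ 2 := by
          rw [Finset.sum_add_distrib, Finset.sum_add_distrib, Finset.mul_sum]
      _ ≤ _ := by linarith
  have h3 : b * ∑ j, ‖(w + z) j‖ ≤ |b| * ∑ j, ‖w j‖ + |b| * ∑ j, ‖z j‖ := by
    calc b * ∑ j, ‖(w + z) j‖ ≤ |b| * ∑ j, ‖(w + z) j‖ :=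
          mul_le_mul_of_nonneg_right (le_abs_self b) (Finset.sum_nonneg fun j _ => norm_nonneg _)
      _ ≤ |b| * ∑ j, (‖w j‖ + ‖z j‖) := mul_le_mul_of_nonneg_left
          (Finset.sum_le_sum fun j _ => norm_add_le _ _) (abs_nonneg b)
      _ = _ := by rw [Finset.sum_add_distrib, mul_add]
  have h4 := mul_le_mul_of_nonneg_left h1 ha
  linarith

lemma integrable_exp_neg_sum_norm_sq {c : ℝ} (hc : 0 < c) :
    Integrable fun z : Fin d → ℂ => Real.exp (-c * ∑ j, ‖z j‖ ^ 2) := by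
  have h1 : Integrable fun z : ℂ => Real.exp (-c * ‖z‖ ^ 2) := by
    refine (GaussianFourier.integrable_cexp_neg_mul_sq_norm_add (V := ℂ) (b := (c : ℂ))
      (by simpa using hc) 0 0).norm.congr (Filter.Eventually.of_forall fun z => ?_)
    simp only [zero_mul, add_zero]
    rw [Complex.norm_exp]
    congr 1
    norm_cast
  have h2 := Integrable.fintype_prod (ι := Fin d) (μ := fun _ => (volume : Measure ℂ))
    (f := fun _ z => Real.exp (-c * ‖z‖ ^ 2)) fun _ => h1
  refine h2.congr (Filter.Eventually.of_forall fun z => ?_)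
  simp only
  rw [← Real.exp_sum, Finset.mul_sum]

lemma integral_exp_neg_pi_sum_norm_sq :
    ∫ z : Fin d → ℂ, ((Real.exp (-Real.pi * ∑ j, ‖z j‖ ^ 2) : ℝ) : ℂ) = 1 := by
  rw [integral_complex_ofReal]
  have h1 : ∫ z : ℂ, Real.exp (-Real.pi * ‖z‖ ^ 2) = 1 := by
    rw [GaussianFourier.integral_rexp_neg_mul_sq_norm Real.pi_pos, div_self Real.pi_ne_zero,
      Real.one_rpow]
  have h2 := integral_fintype_prod_volume_eq_prod
    (fun (_ : Fin d) (z : ℂ) => Real.exp (-Real.pi * ‖z‖ ^ 2))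
  simp only [h1, Finset.prod_const_one, ← Real.exp_sum, ← Finset.mul_sum] at h2
  rw [h2, Complex.ofReal_one]

/-- Up to a constant, a Gaussian absorbs the exponential of a linear form. -/
lemma HasGrowth.norm_le {a c : ℝ} (hac : a < c) {F : (Fin d → ℂ) → ℂ} (hF : HasGrowth a F) :
    ∃ C : ℝ, ∀ z, ‖F z‖ ≤ C * Real.exp (c * ∑ j, ‖z j‖ ^ 2) := by
  obtain ⟨C, b, h⟩ := hF
  have hC : 0 ≤ C := by
    have := (norm_nonneg _).trans (h 0)
    simpa using this
  refine ⟨C * Real.exp (d * (b ^ 2 / (4 * (c - a)))), fun z => (h z).trans ?_⟩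
  rw [mul_assoc, ← Real.exp_add]
  refine mul_le_mul_of_nonneg_left (Real.exp_le_exp.2 ?_) hC
  have h1 : b * ∑ j, ‖z j‖ ≤ ∑ j, (b ^ 2 / (4 * (c - a)) + (c - a) * ‖z j‖ ^ 2) := by
    rw [Finset.mul_sum]
    refine Finset.sum_le_sum fun j _ => ?_
    have hca : 0 < c - a := sub_pos.2 hac
    have : b ^ 2 / (4 * (c - a)) + (c - a) * ‖z j‖ ^ 2 - b * ‖z j‖
        = (b - 2 * (c - a) * ‖z j‖) ^ 2 / (4 * (c - a)) := by
      field_simp; ring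
    have h2 : 0 ≤ (b - 2 * (c - a) * ‖z j‖) ^ 2 / (4 * (c - a)) := by positivity
    linarith
  rw [Finset.sum_add_distrib, ← Finset.mul_sum] at h1
  simp only [Finset.sum_const, Finset.card_univ, Fintype.card_fin, nsmul_eq_mul] at h1
  linarith

lemma HasGrowth.integrable {a c : ℝ} (hac : a < c) {F : (Fin d → ℂ) → ℂ} (hF : HasGrowth a F)
    (hFc : Continuous F) :
    Integrable fun z => F z * ((Real.exp (-c * ∑ j, ‖z j‖ ^ 2) : ℝ) : ℂ) := by
  obtain ⟨C, hC⟩ := hF.norm_le (c := (a + c) / 2) (by linarith)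
  refine ((integrable_exp_neg_sum_norm_sq (d := d) (c := (c - a) / 2)
    (by linarith)).const_mul C).mono' (by fun_prop) (Filter.Eventually.of_forall fun z => ?_)
  rw [norm_mul, Complex.norm_real, Real.norm_eq_abs, Real.abs_exp]
  refine (mul_le_mul_of_nonneg_right (hC z) (Real.exp_nonneg _)).trans (le_of_eq ?_)
  rw [mul_assoc, ← Real.exp_add]
  congr 2; ring

/-- A unitary matrix preserves the volume of `ℂᵈ`. -/
lemma measurePreserving_mulVec {g : Matrix (Fin d) (Fin d) ℂ}
    (hg : g ∈ Matrix.unitaryGroup (Fin d) ℂ) :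
    MeasurePreserving (fun z : Fin d → ℂ => g *ᵥ z) volume volume := by
  have hdet : LinearMap.det ((Matrix.toLin' g).restrictScalars ℝ) = 1 := by
    rw [LinearMap.det_restrictScalars, LinearMap.det_toLin', Algebra.norm_complex_apply,
      Complex.normSq_eq_norm_sq]
    have h1 : ‖g.det‖ = 1 := by
      have := Matrix.det_of_mem_unitary hg
      exact CStarRing.norm_of_mem_unitary this
    rw [h1, one_pow]
  have h := Measure.map_linearMap_addHaar_eq_smul_addHaar (volume : Measure (Fin d → ℂ))
    (f := (Matrix.toLin' g).restrictScalars ℝ) (by rw [hdet]; exact one_ne_zero)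
  rw [hdet] at h
  rw [inv_one, abs_one, ENNReal.ofReal_one, one_smul] at h
  refine ⟨?_, h⟩
  exact ((Continuous.matrix_mulVec continuous_const continuous_id).measurable)

lemma measurableEmbedding_mulVec {g : Matrix (Fin d) (Fin d) ℂ}
    (hg : g ∈ Matrix.unitaryGroup (Fin d) ℂ) :
    MeasurableEmbedding (fun z : Fin d → ℂ => g *ᵥ z) := by
  have hdet : IsUnit g.det := Matrix.UnitaryGroup.det_isUnit ⟨g, hg⟩
  refine Continuous.measurableEmbedding
    (Continuous.matrix_mulVec continuous_const continuous_id) fun z w h => ?_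
  have := congrArg (fun v => g⁻¹ *ᵥ v) h
  simpa [Matrix.nonsing_inv_mul _ hdet] using this

lemma sum_norm_sq_mulVec {g : Matrix (Fin d) (Fin d) ℂ}
    (hg : g ∈ Matrix.unitaryGroup (Fin d) ℂ) (z : Fin d → ℂ) :
    ∑ j, ‖(g *ᵥ z) j‖ ^ 2 = ∑ j, ‖z j‖ ^ 2 := by
  have h : ∀ y : Fin d → ℂ, ((∑ j, ‖y j‖ ^ 2 : ℝ) : ℂ) = star y ⬝ᵥ y := by
    intro y
    simp only [dotProduct, Pi.star_apply]
    push_cast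
    refine Finset.sum_congr rfl fun j _ => (Complex.conj_mul' (y j)).symm
  have h1 : star (g *ᵥ z) ⬝ᵥ (g *ᵥ z) = star z ⬝ᵥ z := by
    have h2 : gᴴ * g = 1 := Matrix.mem_unitaryGroup_iff'.1 hg
    rw [Matrix.star_mulVec, ← Matrix.dotProduct_mulVec, Matrix.mulVec_mulVec, h2, Matrix.one_mulVec]
  rw [← h, ← h] at h1
  exact_mod_cast h1

/-- The Gaussian mean of an entire function is its value at the origin: the Gaussian is invariant
under the rotations `z ↦ e^{iθ} z`, and the mean of the function over each circle is its value at
the origin. -/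
theorem integral_mul_gaussian_eq_apply_zero {a : ℝ} (ha : a < Real.pi)
    {F : (Fin d → ℂ) → ℂ} (hF : HasGrowth a F) (hd : Differentiable ℂ F) :
    ∫ z, F z * ((Real.exp (-Real.pi * ∑ j, ‖z j‖ ^ 2) : ℝ) : ℂ) = F 0 := by
  set e : (Fin d → ℂ) → ℂ := fun z => ((Real.exp (-Real.pi * ∑ j, ‖z j‖ ^ 2) : ℝ) : ℂ) with he
  have hec : Continuous e := by rw [he]; fun_prop
  have hrot : ∀ θ : ℝ, ∫ z, F z * e z = ∫ z, F (circleMap 0 1 θ • z) * e z := by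
    intro θ
    have hn : ‖circleMap 0 1 θ‖ = 1 := by simp
    have hg : circleMap 0 1 θ • (1 : Matrix (Fin d) (Fin d) ℂ) ∈ Matrix.unitaryGroup (Fin d) ℂ := by
      rw [Matrix.mem_unitaryGroup_iff, star_smul, Matrix.smul_mul, Matrix.mul_smul, smul_smul,
        star_one, Matrix.mul_one]
      have h1 : circleMap 0 1 θ * star (circleMap 0 1 θ) = 1 := by
        have := Complex.mul_conj' (circleMap 0 1 θ)
        rw [hn] at this
        simpa using this
      rw [h1, one_smul]
    have h := (measurePreserving_mulVec hg).integral_comp (measurableEmbedding_mulVec hg)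
      (fun z => F z * e z)
    rw [← h]
    congr 1
    ext z
    rw [Matrix.smul_mulVec, Matrix.one_mulVec]
    simp only [he, Pi.smul_apply, smul_eq_mul, norm_mul, hn, one_mul]
  have hmean : ∀ z : Fin d → ℂ, ∫ θ in (0 : ℝ)..2 * Real.pi, F (circleMap 0 1 θ • z)
      = 2 * Real.pi * F 0 := by
    intro z
    have h1 : Differentiable ℂ fun t : ℂ => F (t • z) :=
      hd.comp (differentiable_id.smul_const z)
    have h2 := (h1.diffContOnCl (s := Metric.ball 0 |1|)).circleAverage
    rw [Real.circleAverage_def, zero_smul, Complex.real_smul] at h2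
    rw [← h2, ← mul_assoc]
    have : (Real.pi : ℂ) ≠ 0 := by exact_mod_cast Real.pi_ne_zero
    push_cast
    field_simp
  have hint : Integrable (Function.uncurry fun (θ : ℝ) (z : Fin d → ℂ) =>
      F (circleMap 0 1 θ • z) * e z)
      ((volume.restrict (Set.uIoc 0 (2 * Real.pi))).prod volume) := by
    obtain ⟨C, hC⟩ := hF.norm_le (c := (a + Real.pi) / 2) (by linarith)
    have hb := (integrable_exp_neg_sum_norm_sq (d := d) (c := (Real.pi - a) / 2)
      (by linarith)).const_mul C
    have h1 : Integrable (fun _ : ℝ => (1 : ℝ)) (volume.restrict (Set.uIoc 0 (2 * Real.pi))) := by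
      rw [Set.uIoc_of_le Real.two_pi_pos.le]
      exact integrable_const 1
    refine (h1.mul_prod hb).mono' ?_ (Filter.Eventually.of_forall fun p => ?_)
    · refine Continuous.aestronglyMeasurable ?_
      have h2 := hd.continuous
      have h3 : Continuous (fun p : ℝ × (Fin d → ℂ) => circleMap 0 1 p.1 • p.2) :=
        ((continuous_circleMap 0 1).comp continuous_fst).smul continuous_snd
      exact (h2.comp h3).mul (hec.comp continuous_snd)
    · simp only [Function.uncurry, one_mul, he]
      rw [norm_mul, Complex.norm_real, Real.norm_eq_abs, Real.abs_exp]
      refine (mul_le_mul_of_nonneg_right (hC _) (Real.exp_nonneg _)).trans (le_of_eq ?_)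
      have hn : ‖circleMap 0 1 p.1‖ = 1 := by simp
      simp only [Pi.smul_apply, smul_eq_mul, norm_mul, hn, one_mul]
      rw [mul_assoc, ← Real.exp_add]
      congr 2; ring
  have hswap := intervalIntegral_integral_swap hint
  simp only [← hrot, intervalIntegral.integral_mul_const, hmean,
    intervalIntegral.integral_const, sub_zero] at hswap
  rw [integral_const_mul, integral_exp_neg_pi_sum_norm_sq, mul_one, Complex.real_smul] at hswap
  have h0 : ((2 * Real.pi : ℝ) : ℂ) ≠ 0 := by exact_mod_cast Real.two_pi_pos.ne'
  refine mul_left_cancel₀ h0 ?_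
  rw [hswap]
  push_cast
  ring

/-- The reproducing property of `exp(π w·z̄)` for entire functions, by translation. -/
theorem integral_mul_exp_eq_apply {a : ℝ} (ha0 : 0 ≤ a) (ha : a < Real.pi)
    {F : (Fin d → ℂ) → ℂ} (hF : HasGrowth a F) (hd : Differentiable ℂ F) (w : Fin d → ℂ) :
    ∫ z, F z * Complex.exp (Real.pi * ∑ j, w j * star (z j)) *
      ((Real.exp (-Real.pi * ∑ j, ‖z j‖ ^ 2) : ℝ) : ℂ) = F w := by
  set G : (Fin d → ℂ) → ℂ := fun u =>
    F (w + u) * Complex.exp (∑ j, (-Real.pi * star (w j)) * u j) with hG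
  have h1 : HasGrowth a G := by
    have := (hF.comp_add ha0 w).mul (hasGrowth_exp_linear fun j => -Real.pi * star (w j))
    rwa [add_zero] at this
  have h2 : Differentiable ℂ G := by
    refine Differentiable.mul (hd.comp (by fun_prop)) (by fun_prop)
  have h3 := integral_mul_gaussian_eq_apply_zero ha h1 h2
  have h4 : G 0 = F w := by simp [hG]
  rw [← h4, ← h3, ← integral_add_left_eq_self _ w]
  congr 1
  ext u
  rw [hG]
  simp only
  rw [mul_assoc, mul_assoc, Complex.ofReal_exp, Complex.ofReal_exp, ← Complex.exp_add,
    ← Complex.exp_add]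
  congr 2
  have h5 : ∀ y : ℂ, ((‖y‖ ^ 2 : ℝ) : ℂ) = y * star y := fun y => by
    rw [Complex.star_def, Complex.mul_conj']; push_cast; rfl
  rw [Complex.ofReal_mul, Complex.ofReal_mul, Complex.ofReal_sum, Complex.ofReal_sum,
    Complex.ofReal_neg, Finset.mul_sum, Finset.mul_sum, Finset.mul_sum, ← Finset.sum_add_distrib,
    ← Finset.sum_add_distrib]
  refine Finset.sum_congr rfl fun j _ => ?_
  rw [h5, h5, Pi.add_apply, star_add]
  ring

end

end Metaplectic

namespace Metaplectic

noncomputable section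

/-! ### The Bargmann transform and coherent states -/

open scoped Matrix

variable {d : ℕ} {ℏ : ℝ}

lemma continuous_bargmannKernel (ℏ : ℝ) :
    Continuous fun p : (Fin d → ℂ) × EuclideanSpace ℝ (Fin d) => bargmannKernel ℏ p.1 p.2 := by
  unfold bargmannKernel
  fun_prop

lemma sqrt_two_pi_div_sq (hℏ : 0 < ℏ) : Real.sqrt (2 * Real.pi / ℏ) ^ 2 = 2 * Real.pi / ℏ :=
  Real.sq_sqrt (by positivity)

lemma norm_bargmannKernel (ℏ : ℝ) (z : Fin d → ℂ) (x : EuclideanSpace ℝ (Fin d)) :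
    ‖bargmannKernel ℏ z x‖ = |(Real.pi * ℏ) ^ (-(d : ℝ) / 4)| *
      Real.exp (∑ j, (Real.sqrt (2 * Real.pi / ℏ) * ((z j).re * x j) - x j ^ 2 / (2 * ℏ)
        - Real.pi / 2 * ((z j).re ^ 2 - (z j).im ^ 2))) := by
  unfold bargmannKernel
  rw [norm_mul, Complex.norm_real, Real.norm_eq_abs, Complex.norm_exp]
  congr 2
  have h1 : ((∑ j, x j ^ 2 : ℝ) : ℂ) / (2 * ℏ) = ((∑ j, x j ^ 2 / (2 * ℏ) : ℝ) : ℂ) := by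
    rw [← Finset.sum_div]; push_cast; rfl
  have h2 : (Real.pi / 2 : ℂ) = ((Real.pi / 2 : ℝ) : ℂ) := by push_cast; rfl
  rw [h1, h2, Complex.sub_re, Complex.sub_re, Complex.re_ofReal_mul, Complex.re_ofReal_mul,
    Complex.ofReal_re, Complex.re_sum, Complex.re_sum, Finset.mul_sum, Finset.mul_sum,
    ← Finset.sum_sub_distrib, ← Finset.sum_sub_distrib]
  refine Finset.sum_congr rfl fun j _ => ?_
  rw [Complex.re_mul_ofReal, pow_two (z j), Complex.mul_re]
  ring

/-- A bound of the Bargmann kernel by a product of Gaussians, whose growth in `z` is dominated by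
the weight `exp(-π|z|²)`. -/
lemma norm_bargmannKernel_le (hℏ : 0 < ℏ) (z : Fin d → ℂ) (x : EuclideanSpace ℝ (Fin d)) :
    ‖bargmannKernel ℏ z x‖ ≤ |(Real.pi * ℏ) ^ (-(d : ℝ) / 4)| * (‖gaussian (5 * ℏ) 1 x‖ *
      Real.exp (3 * Real.pi / 4 * ∑ j, ‖z j‖ ^ 2)) := by
  rw [norm_bargmannKernel, gaussian_one_eq, Complex.norm_real, Real.norm_eq_abs, Real.abs_exp,
    ← Real.exp_add]
  refine mul_le_mul_of_nonneg_left (Real.exp_le_exp.2 ?_) (abs_nonneg _)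
  rw [EuclideanSpace.real_norm_sq_eq, Finset.sum_div, Finset.mul_sum, ← Finset.sum_neg_distrib,
    ← Finset.sum_add_distrib]
  refine Finset.sum_le_sum fun j _ => ?_
  rw [← Complex.normSq_eq_norm_sq, Complex.normSq_apply]
  set t := Real.sqrt (2 * Real.pi / ℏ) with ht
  have ht2 : t ^ 2 = 2 * Real.pi / ℏ := sqrt_two_pi_div_sq hℏ
  have hpi : Real.pi = t ^ 2 * ℏ / 2 := by rw [ht2]; field_simp
  rw [hpi]
  have key : -(x j ^ 2 / (2 * (5 * ℏ))) + 3 * (t ^ 2 * ℏ / 2) / 4 *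
      ((z j).re * (z j).re + (z j).im * (z j).im) - (t * ((z j).re * x j) - x j ^ 2 / (2 * ℏ) -
      t ^ 2 * ℏ / 2 / 2 * ((z j).re ^ 2 - (z j).im ^ 2))
      = 2 / (5 * ℏ) * (x j - 5 / 4 * ℏ * t * (z j).re) ^ 2 + t ^ 2 * ℏ / 8 * (z j).im ^ 2 := by
    field_simp; ring
  have : 0 ≤ 2 / (5 * ℏ) * (x j - 5 / 4 * ℏ * t * (z j).re) ^ 2 + t ^ 2 * ℏ / 8 * (z j).im ^ 2 := by
    positivity
  linarith

lemma memLp_gaussian_one (hℏ : 0 < ℏ) : MemLp (gaussian (d := d) ℏ 1) 2 volume :=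
  memLp_gaussian hℏ Matrix.isSymm_one posDef_re_one

lemma norm_bargmannAdjoint_integrand_le (hℏ : 0 < ℏ) (F : (Fin d → ℂ) → ℂ) (z : Fin d → ℂ)
    (x : EuclideanSpace ℝ (Fin d)) :
    ‖star (bargmannKernel ℏ z x) * F z * ((Real.exp (-Real.pi * ∑ j, ‖z j‖ ^ 2) : ℝ) : ℂ)‖ ≤
      |(Real.pi * ℏ) ^ (-(d : ℝ) / 4)| * ‖gaussian (5 * ℏ) 1 x‖ *
        ‖F z * ((Real.exp (-(Real.pi / 4) * ∑ j, ‖z j‖ ^ 2) : ℝ) : ℂ)‖ := by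
  rw [norm_mul, norm_mul, norm_mul, norm_star, Complex.norm_real, Complex.norm_real,
    Real.norm_eq_abs, Real.norm_eq_abs, Real.abs_exp, Real.abs_exp]
  have h := mul_le_mul_of_nonneg_right (norm_bargmannKernel_le hℏ z x)
    (mul_nonneg (norm_nonneg (F z)) (Real.exp_nonneg (-Real.pi * ∑ j, ‖z j‖ ^ 2)))
  rw [← mul_assoc] at h
  refine h.trans (le_of_eq ?_)
  have e : Real.exp (-(Real.pi / 4) * ∑ j, ‖z j‖ ^ 2) =
      Real.exp (3 * Real.pi / 4 * ∑ j, ‖z j‖ ^ 2) * Real.exp (-Real.pi * ∑ j, ‖z j‖ ^ 2) := by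
    rw [← Real.exp_add]; congr 1; ring
  rw [e]
  ring

/-- The Bargmann adjoint of a function of moderate growth is square integrable. -/
theorem memLp_bargmannAdjoint (hℏ : 0 < ℏ) {F : (Fin d → ℂ) → ℂ} (hF : HasGrowth 0 F)
    (hFc : Continuous F) : MemLp (bargmannAdjoint ℏ F) 2 volume := by
  have hint := (hF.integrable (c := Real.pi / 4) (by positivity) hFc).norm
  refine ((memLp_gaussian_one (d := d) (ℏ := 5 * ℏ) (by positivity)).const_mul
    ((|(Real.pi * ℏ) ^ (-(d : ℝ) / 4)| * ∫ z : Fin d → ℂ,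
      ‖F z * ((Real.exp (-(Real.pi / 4) * ∑ j, ‖z j‖ ^ 2) : ℝ) : ℂ)‖ : ℝ) : ℂ)).of_le ?_
    (Filter.Eventually.of_forall fun x => ?_)
  · have hc : Continuous fun p : EuclideanSpace ℝ (Fin d) × (Fin d → ℂ) =>
        star (bargmannKernel ℏ p.2 p.1) * F p.2 *
          ((Real.exp (-Real.pi * ∑ j, ‖p.2 j‖ ^ 2) : ℝ) : ℂ) := by
      have h1 := (continuous_bargmannKernel (d := d) ℏ).comp continuous_swap
      exact (h1.star.mul (hFc.comp continuous_snd)).mul (by fun_prop)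
    exact hc.aestronglyMeasurable.integral_prod_right'
  · have h2 : ∀ z, _ := fun z => norm_bargmannAdjoint_integrand_le hℏ F z x
    refine (norm_integral_le_of_norm_le (hint.const_mul _)
      (Filter.Eventually.of_forall h2)).trans (le_of_eq ?_)
    have h3 : 0 ≤ ∫ z : Fin d → ℂ,
        ‖F z * ((Real.exp (-(Real.pi / 4) * ∑ j, ‖z j‖ ^ 2) : ℝ) : ℂ)‖ :=
      integral_nonneg fun _ => norm_nonneg _
    rw [integral_const_mul, norm_mul, Complex.norm_real, Real.norm_eq_abs,
      abs_of_nonneg (mul_nonneg (abs_nonneg _) h3)]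
    ring

/-- The coherent state of `z ∈ ℂᵈ`: the conjugate of the Bargmann kernel `K(z, ·)`, obtained from
the ground state by a Weyl operator. -/
def coherent (d : ℕ) {ℏ : ℝ} (hℏ : 0 < ℏ) (z : Fin d → ℂ) : L2 d :=
  ((((Real.pi * ℏ) ^ (-(d : ℝ) / 4) : ℝ) : ℂ) *
      ((Real.exp (Real.pi / 2 * ∑ j, ‖z j‖ ^ 2) : ℝ) : ℂ)) •
    weylOp ℏ (-((Real.sqrt (2 * Real.pi * ℏ) : ℝ) : ℂ) • z) (groundState d hℏ)

lemma coherent_ae_eq (hℏ : 0 < ℏ) (z : Fin d → ℂ) :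
    coherent d hℏ z =ᵐ[volume] fun x => star (bargmannKernel ℏ z x) := by
  refine (Lp.coeFn_smul _ _).trans ?_
  have h := (weylOp_ae_eq ℏ (-((Real.sqrt (2 * Real.pi * ℏ) : ℝ) : ℂ) • z)
    (groundState d hℏ)).trans (weyl_congr ℏ _ (groundState_ae_eq hℏ))
  filter_upwards [h] with x hx
  rw [Pi.smul_apply, hx, smul_eq_mul]
  set s := Real.sqrt (2 * Real.pi * ℏ) with hs
  have hs2 : s ^ 2 = 2 * Real.pi * ℏ := Real.sq_sqrt (by positivity)
  have ht : Real.sqrt (2 * Real.pi / ℏ) = s / ℏ := by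
    have : 2 * Real.pi / ℏ = (2 * Real.pi * ℏ) / ℏ ^ 2 := by field_simp
    rw [this, Real.sqrt_div' _ (by positivity), Real.sqrt_sq hℏ.le]
  unfold weyl bargmannKernel gaussian
  rw [star_mul', mul_assoc]
  congr 1
  · exact (Complex.conj_ofReal _).symm
  rw [Complex.ofReal_exp, ← Complex.exp_add, ← Complex.exp_add, Complex.star_def,
    ← Complex.exp_conj]
  congr 1
  have hℏ' : (ℏ : ℂ) ≠ 0 := by exact_mod_cast hℏ.ne'
  have hs2' : (s : ℂ) ^ 2 = 2 * Real.pi * ℏ := by exact_mod_cast hs2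
  have hpi : (Real.pi : ℂ) = s ^ 2 / (2 * ℏ) := by rw [hs2']; field_simp
  simp only [ht, map_sub, map_mul, map_sum, map_div₀, map_pow, Complex.conj_ofReal, map_ofNat,
    Matrix.one_mulVec, dotProduct, Complex.ofReal_sum, Complex.ofReal_mul, Complex.ofReal_div,
    Complex.ofReal_pow, Complex.ofReal_ofNat, Complex.ofReal_add, Finset.mul_sum, Finset.sum_div,
    PiLp.add_apply, Pi.smul_apply, smul_eq_mul, ← Complex.ofReal_neg, Complex.re_ofReal_mul,
    Complex.im_ofReal_mul]
  rw [← Finset.sum_add_distrib, ← Finset.sum_add_distrib, ← Finset.sum_sub_distrib,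
    ← Finset.sum_sub_distrib]
  refine Finset.sum_congr rfl fun j _ => ?_
  rw [← Complex.ofReal_pow, ← Complex.normSq_eq_norm_sq, Complex.normSq_apply]
  have hz : (starRingEnd ℂ) (z j) = (z j).re - (z j).im * Complex.I := by
    apply Complex.ext <;> simp
  rw [hz, hpi]
  push_cast
  field_simp
  ring_nf
  simp only [Complex.I_sq]
  ring

lemma inner_coherent (hℏ : 0 < ℏ) (h : L2 d) (z : Fin d → ℂ) :
    inner ℂ h (coherent d hℏ z) = ∫ x, star (h x) * star (bargmannKernel ℏ z x) := by
  rw [L2.inner_def]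
  refine integral_congr_ae ?_
  filter_upwards [coherent_ae_eq hℏ z] with x hx
  rw [hx, RCLike.inner_apply, mul_comm]
  rfl

lemma integrable_norm_mul_gaussian (hℏ : 0 < ℏ) (h : L2 d) :
    Integrable fun x => ‖h x‖ * ‖gaussian (5 * ℏ) 1 x‖ :=
  (Lp.memLp h).norm.integrable_mul
    (memLp_gaussian_one (d := d) (ℏ := 5 * ℏ) (by positivity)).norm

lemma integrable_prod_bargmann (hℏ : 0 < ℏ) (h : L2 d) {F : (Fin d → ℂ) → ℂ}
    (hF : HasGrowth 0 F) (hFc : Continuous F) :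
    Integrable (Function.uncurry fun (x : EuclideanSpace ℝ (Fin d)) (z : Fin d → ℂ) =>
      star (h x) * (star (bargmannKernel ℏ z x) * F z *
        ((Real.exp (-Real.pi * ∑ j, ‖z j‖ ^ 2) : ℝ) : ℂ))) (volume.prod volume) := by
  have hint := (hF.integrable (c := Real.pi / 4) (by positivity) hFc).norm
  refine (((integrable_norm_mul_gaussian hℏ h).const_mul
    |(Real.pi * ℏ) ^ (-(d : ℝ) / 4)|).mul_prod hint).mono' ?_
    (Filter.Eventually.of_forall fun p => ?_)
  · have hc : Continuous fun p : EuclideanSpace ℝ (Fin d) × (Fin d → ℂ) =>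
        star (bargmannKernel ℏ p.2 p.1) * F p.2 *
          ((Real.exp (-Real.pi * ∑ j, ‖p.2 j‖ ^ 2) : ℝ) : ℂ) := by
      have h1 := (continuous_bargmannKernel (d := d) ℏ).comp continuous_swap
      exact (h1.star.mul (hFc.comp continuous_snd)).mul (by fun_prop)
    exact ((Lp.aestronglyMeasurable h).star.comp_fst).mul hc.aestronglyMeasurable
  · simp only [Function.uncurry]
    rw [norm_mul, norm_star]
    refine (mul_le_mul_of_nonneg_left (norm_bargmannAdjoint_integrand_le hℏ F p.2 p.1)
      (norm_nonneg _)).trans (le_of_eq ?_)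
    ring

/-- The Bargmann adjoint as a weak integral of coherent states. -/
theorem inner_bargmannAdjoint (hℏ : 0 < ℏ) (h : L2 d) {F : (Fin d → ℂ) → ℂ}
    (hF : HasGrowth 0 F) (hFc : Continuous F)
    (hu : MemLp (bargmannAdjoint ℏ F) 2 volume) :
    inner ℂ h (hu.toLp _) = ∫ z, F z * inner ℂ h (coherent d hℏ z) *
      ((Real.exp (-Real.pi * ∑ j, ‖z j‖ ^ 2) : ℝ) : ℂ) := by
  have h1 : inner ℂ h (hu.toLp _) = ∫ x, ∫ z, star (h x) * (star (bargmannKernel ℏ z x) * F z *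
        ((Real.exp (-Real.pi * ∑ j, ‖z j‖ ^ 2) : ℝ) : ℂ)) := by
    rw [L2.inner_def]
    refine integral_congr_ae ?_
    filter_upwards [hu.coeFn_toLp] with x hx
    rw [hx, RCLike.inner_apply, mul_comm, integral_const_mul]
    rfl
  rw [h1, integral_integral_swap (integrable_prod_bargmann hℏ h hF hFc)]
  congr 1
  ext z
  rw [inner_coherent, mul_comm (F z), mul_assoc, ← integral_mul_const]
  congr 1
  ext x
  ring

lemma integrable_mul_inner_coherent (hℏ : 0 < ℏ) (h : L2 d) {F : (Fin d → ℂ) → ℂ}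
    (hF : HasGrowth 0 F) (hFc : Continuous F) :
    Integrable fun z => F z * inner ℂ h (coherent d hℏ z) *
      ((Real.exp (-Real.pi * ∑ j, ‖z j‖ ^ 2) : ℝ) : ℂ) := by
  refine (integrable_prod_bargmann hℏ h hF hFc).integral_prod_right.congr
    (Filter.Eventually.of_forall fun z => ?_)
  simp only [Function.uncurry]
  rw [inner_coherent, mul_comm (F z), mul_assoc, ← integral_mul_const]
  congr 1
  ext x
  ring

lemma differentiable_bargmannKernel (ℏ : ℝ) (x : EuclideanSpace ℝ (Fin d)) :
    Differentiable ℂ fun z : Fin d → ℂ => bargmannKernel ℏ z x := by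
  unfold bargmannKernel
  fun_prop

lemma hasGrowth_bargmannKernel (hℏ : 0 < ℏ) (x : EuclideanSpace ℝ (Fin d)) :
    HasGrowth (3 * Real.pi / 4) fun z : Fin d → ℂ => bargmannKernel ℏ z x := by
  refine ⟨|(Real.pi * ℏ) ^ (-(d : ℝ) / 4)| * ‖gaussian (5 * ℏ) 1 x‖, 0, fun z => ?_⟩
  rw [zero_mul, add_zero, mul_assoc]
  exact norm_bargmannKernel_le hℏ z x

/-- The Bargmann adjoint maps the reproducing kernel to the coherent state. -/
theorem bargmannAdjoint_exp (hℏ : 0 < ℏ) (w : Fin d → ℂ) (x : EuclideanSpace ℝ (Fin d)) :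
    bargmannAdjoint ℏ (fun z => Complex.exp (∑ j, (Real.pi * star (w j)) * z j)) x =
      star (bargmannKernel ℏ w x) := by
  have h := integral_mul_exp_eq_apply (a := 3 * Real.pi / 4) (by positivity)
    (by linarith [Real.pi_pos]) (hasGrowth_bargmannKernel hℏ x)
    (differentiable_bargmannKernel ℏ x) w
  rw [← h]
  unfold bargmannAdjoint
  have h2 := integral_conj (𝕜 := ℂ) (μ := (volume : Measure (Fin d → ℂ))) (f := fun z =>
    bargmannKernel ℏ z x * Complex.exp (Real.pi * ∑ j, w j * star (z j)) *
      ((Real.exp (-Real.pi * ∑ j, ‖z j‖ ^ 2) : ℝ) : ℂ))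
  refine Eq.trans ?_ h2
  congr 1
  ext z
  rw [map_mul, map_mul, Complex.conj_ofReal, ← Complex.exp_conj]
  have h3 : (starRingEnd ℂ) (Real.pi * ∑ j, w j * star (z j)) =
      ∑ j, (Real.pi * star (w j)) * z j := by
    rw [map_mul, Complex.conj_ofReal, map_sum, Finset.mul_sum]
    refine Finset.sum_congr rfl fun j _ => ?_
    rw [map_mul]
    simp only [Complex.star_def, Complex.conj_conj]
    ring
  rw [h3]
  rfl

/-- The inner product of two coherent states is the reproducing kernel of the Fock space. -/
theorem inner_coherent_coherent (hℏ : 0 < ℏ) (w z : Fin d → ℂ) :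
    inner ℂ (coherent d hℏ w) (coherent d hℏ z) =
      Complex.exp (Real.pi * ∑ j, w j * star (z j)) := by
  rw [inner_coherent]
  have hℏ' : (ℏ : ℂ) ≠ 0 := by exact_mod_cast hℏ.ne'
  set t := Real.sqrt (2 * Real.pi / ℏ) with ht
  set k := (Real.pi * ℏ) ^ (-(d : ℝ) / 4) with hk
  set A : ℂ := -(Real.pi / 2 * ∑ j, w j ^ 2) - Real.pi / 2 * ∑ j, star (z j) ^ 2 with hA
  have h1 : ∀ x : EuclideanSpace ℝ (Fin d), bargmannKernel ℏ w x * star (bargmannKernel ℏ z x)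
      = ((k : ℂ) ^ 2 * Complex.exp A) * Complex.exp (-∑ j, (1 / (ℏ : ℂ)) * (x j : ℂ) ^ 2 +
        ∑ j, (t * (w j + star (z j))) * x j) := by
    intro x
    unfold bargmannKernel
    rw [star_mul', Complex.star_def, Complex.conj_ofReal, ← Complex.exp_conj]
    rw [mul_mul_mul_comm, ← Complex.exp_add, mul_assoc ((k : ℂ) ^ 2), ← Complex.exp_add, ← pow_two]
    congr 2
    simp only [map_sub, map_mul, map_sum, map_div₀, map_pow, Complex.conj_ofReal, map_ofNat, hA,
      Complex.ofReal_sum, Complex.ofReal_pow, Finset.mul_sum, Finset.sum_div, ← ht]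
    rw [← Finset.sum_neg_distrib, ← Finset.sum_neg_distrib, ← Finset.sum_sub_distrib,
      ← Finset.sum_sub_distrib, ← Finset.sum_sub_distrib, ← Finset.sum_sub_distrib,
      ← Finset.sum_sub_distrib, ← Finset.sum_add_distrib, ← Finset.sum_add_distrib,
      ← Finset.sum_add_distrib]
    refine Finset.sum_congr rfl fun j _ => ?_
    simp only [Complex.star_def]
    field_simp
    ring
  have h2 : ∫ x, star (coherent d hℏ w x) * star (bargmannKernel ℏ z x)
      = ∫ x, bargmannKernel ℏ w x * star (bargmannKernel ℏ z x) := by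
    refine integral_congr_ae ?_
    filter_upwards [coherent_ae_eq hℏ w] with x hx
    rw [hx, star_star]
  rw [h2]
  simp only [h1]
  rw [integral_const_mul, integral_exp_diagonal_add (fun j => by
    rw [← Complex.ofReal_one, ← Complex.ofReal_div, Complex.ofReal_re]; positivity),
    Finset.prod_mul_distrib, ← Complex.exp_sum, Finset.prod_const, Finset.card_univ,
    Fintype.card_fin, mul_mul_mul_comm, ← Complex.exp_add]
  have h3 : (k : ℂ) ^ 2 * ((Real.pi / (1 / (ℏ : ℂ))) ^ (1 / 2 : ℂ)) ^ d = 1 := by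
    have hp : 0 < Real.pi * ℏ := by positivity
    have h4 : (Real.pi / (1 / (ℏ : ℂ))) = ((Real.pi * ℏ : ℝ) : ℂ) := by push_cast; field_simp
    have h5 : (1 / 2 : ℂ) = ((1 / 2 : ℝ) : ℂ) := by push_cast; rfl
    rw [h4, h5, ← Complex.ofReal_cpow hp.le, ← Complex.ofReal_pow, ← Complex.ofReal_pow,
      ← Complex.ofReal_mul, hk, ← Real.rpow_natCast, ← Real.rpow_natCast, ← Real.rpow_mul hp.le,
      ← Real.rpow_mul hp.le, ← Real.rpow_add hp]
    have h6 : -(d : ℝ) / 4 * ((2 : ℕ) : ℝ) + 1 / 2 * (d : ℝ) = 0 := by push_cast; ring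
    rw [h6, Real.rpow_zero, Complex.ofReal_one]
  rw [h3, one_mul]
  congr 1
  have ht2 : (t : ℂ) ^ 2 = 2 * Real.pi / ℏ := by exact_mod_cast sqrt_two_pi_div_sq hℏ
  rw [hA, Finset.mul_sum, Finset.mul_sum, Finset.mul_sum, ← Finset.sum_neg_distrib,
    ← Finset.sum_sub_distrib, ← Finset.sum_add_distrib]
  refine Finset.sum_congr rfl fun j _ => ?_
  rw [mul_pow, ht2]
  field_simp
  ring

end

end Metaplectic

namespace Metaplectic

noncomputable section

/-! ### Metaplectic operators in the Bargmann representation -/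

open scoped Matrix

variable {d : ℕ} {ℏ : ℝ}

lemma apply_coherent (hℏ : 0 < ℏ) {g : Matrix.unitaryGroup (Fin d) ℂ}
    {U : unitary (L2 d →L[ℂ] L2 d)} {ζ : ℂ}
    (hU : Implements ℏ U (fun w => (g : Matrix (Fin d) (Fin d) ℂ) *ᵥ w))
    (hζ : (U : L2 d →L[ℂ] L2 d) (groundState d hℏ) = ζ • groundState d hℏ) (z : Fin d → ℂ) :
    (U : L2 d →L[ℂ] L2 d) (coherent d hℏ z) =
      ζ • coherent d hℏ ((g : Matrix (Fin d) (Fin d) ℂ) *ᵥ z) := by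
  unfold coherent
  rw [map_smul, implements_iff.1 hU, hζ, map_smul, Matrix.mulVec_smul, sum_norm_sq_mulVec g.2,
    smul_comm]

lemma inner_unitary_apply (U : unitary (L2 d →L[ℂ] L2 d)) (h f : L2 d) :
    inner ℂ h ((U : L2 d →L[ℂ] L2 d) f) =
      inner ℂ (((U⁻¹ : unitary (L2 d →L[ℂ] L2 d)) : L2 d →L[ℂ] L2 d) h) f := by
  have h1 := ((Unitary.linearIsometryEquiv U).inner_map_map
    (((U⁻¹ : unitary (L2 d →L[ℂ] L2 d)) : L2 d →L[ℂ] L2 d) h) f)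
  change inner ℂ ((U : L2 d →L[ℂ] L2 d) (((U⁻¹ : unitary (L2 d →L[ℂ] L2 d)) :
    L2 d →L[ℂ] L2 d) h)) ((U : L2 d →L[ℂ] L2 d) f) = _ at h1
  rw [unitary_apply_inv_apply] at h1
  exact h1

/-- In the Bargmann representation the metaplectic operator of `g` is `F ↦ ζ F ∘ g⁻¹`; here for
eigenfunctions `F` of this substitution. -/
theorem apply_bargmannAdjoint (hℏ : 0 < ℏ) {g : Matrix.unitaryGroup (Fin d) ℂ}
    {U : unitary (L2 d →L[ℂ] L2 d)} {ζ : ℂ}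
    (hU : Implements ℏ U (fun w => (g : Matrix (Fin d) (Fin d) ℂ) *ᵥ w))
    (hζ : (U : L2 d →L[ℂ] L2 d) (groundState d hℏ) = ζ • groundState d hℏ)
    {F : (Fin d → ℂ) → ℂ} (hF : HasGrowth 0 F) (hFc : Continuous F) {c : ℂ}
    (hc : ∀ z, F z = c * F ((g : Matrix (Fin d) (Fin d) ℂ) *ᵥ z))
    (hu : MemLp (bargmannAdjoint ℏ F) 2 volume) :
    (U : L2 d →L[ℂ] L2 d) (hu.toLp _) = (ζ * c) • hu.toLp _ := by
  refine ext_inner_left ℂ fun h => ?_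
  rw [inner_unitary_apply, inner_smul_right, inner_bargmannAdjoint hℏ _ hF hFc,
    inner_bargmannAdjoint hℏ _ hF hFc,
    ← (measurePreserving_mulVec g.2).integral_comp (measurableEmbedding_mulVec g.2)
      (fun z => F z * inner ℂ h (coherent d hℏ z) *
      ((Real.exp (-Real.pi * ∑ j, ‖z j‖ ^ 2) : ℝ) : ℂ)), ← integral_const_mul]
  congr 1
  ext z
  rw [sum_norm_sq_mulVec g.2, ← inner_unitary_apply, apply_coherent hℏ hU hζ, inner_smul_right,
    hc z]
  ring

/-- A function orthogonal to all coherent states vanishes: its product with a Gaussian has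
Fourier transform zero. -/
theorem eq_zero_of_inner_coherent (hℏ : 0 < ℏ) {f : L2 d}
    (h : ∀ z, inner ℂ f (coherent d hℏ z) = 0) : f = 0 := by
  set G : EuclideanSpace ℝ (Fin d) → ℂ := fun x => star (f x) * gaussian ℏ 1 x with hG
  have hgn : ∀ x : EuclideanSpace ℝ (Fin d), ‖gaussian ℏ 1 x‖ ≤ 1 := by
    intro x
    rw [gaussian_one_eq, Complex.norm_real, Real.norm_eq_abs, Real.abs_exp, Real.exp_le_one_iff]
    have : 0 ≤ ‖x‖ ^ 2 / (2 * ℏ) := by positivity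
    linarith
  have hGm : AEStronglyMeasurable G volume :=
    (Lp.aestronglyMeasurable f).star.mul (continuous_gaussian ℏ 1).aestronglyMeasurable
  have hG2 : MemLp G 2 volume := by
    refine (Lp.memLp f).of_le hGm (Filter.Eventually.of_forall fun x => ?_)
    rw [hG, norm_mul, norm_star]
    exact mul_le_of_le_one_right (norm_nonneg _) (hgn x)
  have hG1 : Integrable G := by
    refine ((Lp.memLp f).norm.integrable_mul (memLp_gaussian_one (d := d) hℏ).norm).mono' hGm
      (Filter.Eventually.of_forall fun x => ?_)
    rw [hG, norm_mul, norm_star]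
    rfl
  set t := Real.sqrt (2 * Real.pi / ℏ) with ht
  have ht0 : (t : ℂ) ≠ 0 := by
    have : 0 < t := Real.sqrt_pos.2 (by positivity)
    exact_mod_cast this.ne'
  have hℏ' : (ℏ : ℂ) ≠ 0 := by exact_mod_cast hℏ.ne'
  have hint : ∀ ξ : EuclideanSpace ℝ (Fin d),
      ∫ x, Complex.exp (((2 * Real.pi * inner ℝ x ξ : ℝ) : ℂ) * Complex.I) * G x = 0 := by
    intro ξ
    set z : Fin d → ℂ := fun j => -(2 * Real.pi * ξ j / t) * Complex.I with hz
    have h1 := h z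
    rw [inner_coherent] at h1
    set c : ℂ := (((Real.pi * ℏ) ^ (-(d : ℝ) / 4) : ℝ) : ℂ) *
      Complex.exp (-(Real.pi / 2 * ∑ j, star (z j) ^ 2)) with hc
    have hc0 : c ≠ 0 := by
      refine mul_ne_zero ?_ (Complex.exp_ne_zero _)
      exact_mod_cast (Real.rpow_pos_of_pos (by positivity : 0 < Real.pi * ℏ) _).ne'
    have h2 : ∀ x : EuclideanSpace ℝ (Fin d), star (f x) * star (bargmannKernel ℏ z x) =
        c * (Complex.exp (((2 * Real.pi * inner ℝ x ξ : ℝ) : ℂ) * Complex.I) * G x) := by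
      intro x
      have h3 : star (bargmannKernel ℏ z x) = c *
          (Complex.exp (((2 * Real.pi * inner ℝ x ξ : ℝ) : ℂ) * Complex.I) * gaussian ℏ 1 x) := by
        unfold bargmannKernel gaussian
        rw [star_mul', Complex.star_def, Complex.conj_ofReal, ← Complex.exp_conj, hc, mul_assoc,
          ← Complex.exp_add, ← Complex.exp_add, Matrix.one_mulVec]
        congr 2
        have h4 : ∀ j, (starRingEnd ℂ) (z j) = (2 * Real.pi * ξ j / t) * Complex.I := by
          intro j
          have : (starRingEnd ℂ) 2 = 2 := map_ofNat _ 2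
          simp [hz, this]
        have h5 : inner ℝ x ξ = ∑ j, x j * ξ j := by
          rw [PiLp.inner_apply]
          refine Finset.sum_congr rfl fun j _ => ?_
          simp [mul_comm]
        simp only [map_sub, map_mul, map_sum, map_div₀, map_pow, Complex.conj_ofReal, map_ofNat, h4,
          Complex.star_def, dotProduct, h5, ← ht]
        have h6 : (t : ℂ) * ∑ j, 2 * Real.pi * ξ j / t * Complex.I * (x j : ℂ)
            = ((2 * Real.pi * ∑ j, x j * ξ j : ℝ) : ℂ) * Complex.I := by
          push_cast
          rw [Finset.mul_sum, Finset.mul_sum, Finset.sum_mul]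
          refine Finset.sum_congr rfl fun j _ => ?_
          field_simp
        have h7 : ((∑ j, x j ^ 2 : ℝ) : ℂ) = ∑ j, (x j : ℂ) * x j := by
          push_cast
          exact Finset.sum_congr rfl fun j _ => pow_two _
        rw [h6, h7]
        ring
      rw [h3, hG]
      ring
    simp only [h2] at h1
    rw [integral_const_mul] at h1
    exact (mul_eq_zero.1 h1).resolve_left hc0
  have hGL : Integrable (hG2.toLp G) volume := hG1.congr hG2.coeFn_toLp.symm
  have h0 : (FourierTransformInv.fourierInv (hG2.toLp G) : L2 d) = 0 := by
    refine Lp.ext ((fourierInv_Lp_ae_eq _ hGL).trans ?_)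
    filter_upwards [Lp.coeFn_zero ℂ 2 (volume : Measure (EuclideanSpace ℝ (Fin d)))] with ξ hξ
    rw [hξ, Real.fourierInv_eq', Pi.zero_apply, ← hint ξ]
    refine integral_congr_ae ?_
    filter_upwards [hG2.coeFn_toLp] with x hx
    rw [hx, smul_eq_mul]
  have h1 : hG2.toLp G = 0 := by
    have := (Lp.fourierTransformₗᵢ (EuclideanSpace ℝ (Fin d)) ℂ).symm.map_eq_zero_iff.1 h0
    exact this
  refine Lp.ext ?_
  have h2 := hG2.coeFn_toLp
  rw [h1] at h2
  filter_upwards [h2, Lp.coeFn_zero ℂ 2 (volume : Measure (EuclideanSpace ℝ (Fin d)))] with x hx h3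
  rw [h3, Pi.zero_apply] at hx ⊢
  rcases mul_eq_zero.1 hx.symm with h4 | h4
  · exact star_eq_zero.1 h4
  · exact absurd h4 (Complex.exp_ne_zero _)

/-! ### Polynomials in a basis of linear forms -/

lemma sum_inner_single_mul (v : EuclideanSpace ℂ (Fin d)) (z : Fin d → ℂ) :
    ∑ j, inner ℂ v (EuclideanSpace.single j (1 : ℂ)) * z j = inner ℂ v (WithLp.toLp 2 z) := by
  rw [PiLp.inner_apply]
  refine Finset.sum_congr rfl fun j _ => ?_
  rw [EuclideanSpace.inner_single_right]
  simp [mul_comm]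

lemma hasGrowth_eigenPolynomial (v : Fin d → EuclideanSpace ℂ (Fin d)) (n : Fin d → ℕ) :
    HasGrowth 0 (eigenPolynomial v n) :=
  HasGrowth.prod _ fun _ _ => (hasGrowth_linear _).pow _

lemma differentiable_eigenPolynomial (v : Fin d → EuclideanSpace ℂ (Fin d)) (n : Fin d → ℕ) :
    Differentiable ℂ (eigenPolynomial v n) := by
  unfold eigenPolynomial
  fun_prop

lemma eigenPolynomial_mulVec {g : Matrix.unitaryGroup (Fin d) ℂ}
    {v : Fin d → EuclideanSpace ℂ (Fin d)} {θ : Fin d → ℂ}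
    (hv : ∀ j, Matrix.toEuclideanLin (g : Matrix (Fin d) (Fin d) ℂ) (v j) = θ j • v j)
    (n : Fin d → ℕ) (z : Fin d → ℂ) :
    eigenPolynomial v n z = (∏ j, (starRingEnd ℂ (θ j)) ^ n j) *
      eigenPolynomial v n ((g : Matrix (Fin d) (Fin d) ℂ) *ᵥ z) := by
  unfold eigenPolynomial
  rw [← Finset.prod_mul_distrib]
  refine Finset.prod_congr rfl fun k _ => ?_
  rw [← mul_pow, sum_inner_single_mul, sum_inner_single_mul]
  congr 1
  -- `⟨v, z⟩ = ⟨g v, g z⟩ = θ̄ ⟨v, g z⟩`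
  have h1 : inner ℂ (Matrix.toEuclideanLin (g : Matrix (Fin d) (Fin d) ℂ) (v k))
      (WithLp.toLp 2 ((g : Matrix (Fin d) (Fin d) ℂ) *ᵥ z)) = inner ℂ (v k) (WithLp.toLp 2 z) := by
    have hg : (g : Matrix (Fin d) (Fin d) ℂ)ᴴ * (g : Matrix (Fin d) (Fin d) ℂ) = 1 :=
      Matrix.mem_unitaryGroup_iff'.1 g.2
    rw [EuclideanSpace.inner_eq_star_dotProduct, EuclideanSpace.inner_eq_star_dotProduct]
    change ((g : Matrix (Fin d) (Fin d) ℂ) *ᵥ z) ⬝ᵥ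
      star ((g : Matrix (Fin d) (Fin d) ℂ) *ᵥ (WithLp.ofLp (v k))) = _
    rw [dotProduct_comm, Matrix.star_mulVec, ← Matrix.dotProduct_mulVec, Matrix.mulVec_mulVec, hg,
      Matrix.one_mulVec, dotProduct_comm]
  rw [← h1, hv k, inner_smul_left]

lemma exists_eigenPolynomial_eq_one (v : Module.Basis (Fin d) ℂ (EuclideanSpace ℂ (Fin d)))
    (n : Fin d → ℕ) : ∃ w, eigenPolynomial v n w = 1 := by
  let Φ : EuclideanSpace ℂ (Fin d) →ₗ[ℂ] (Fin d → ℂ) := LinearMap.pi fun k => (innerₛₗ ℂ) (v k)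
  have hinj : Function.Injective Φ := by
    rw [injective_iff_map_eq_zero]
    intro x hx
    have h1 : inner ℂ x x = 0 := by
      conv_lhs => rw [← v.sum_repr x]
      rw [sum_inner]
      refine Finset.sum_eq_zero fun k _ => ?_
      rw [v.sum_repr, inner_smul_left, show inner ℂ (v k) x = 0 from congrFun hx k, mul_zero]
    exact inner_self_eq_zero.1 h1
  have hsurj : Function.Surjective Φ :=
    (LinearMap.injective_iff_surjective_of_finrank_eq_finrank (by simp)).1 hinj
  obtain ⟨x, hx⟩ := hsurj (fun _ => 1)
  refine ⟨WithLp.ofLp x, ?_⟩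
  unfold eigenPolynomial
  refine Finset.prod_eq_one fun k _ => ?_
  rw [sum_inner_single_mul]
  have : inner ℂ (v k) x = 1 := congrFun hx k
  rw [WithLp.toLp_ofLp, this, one_pow]

/-- The Bargmann adjoint of a product of linear forms does not vanish: its inner product with a
coherent state is the value of the polynomial at the corresponding point. -/
lemma bargmannAdjoint_eigenPolynomial_ne_zero (hℏ : 0 < ℏ)
    (v : Module.Basis (Fin d) ℂ (EuclideanSpace ℂ (Fin d))) (n : Fin d → ℕ)
    (hu : MemLp (bargmannAdjoint ℏ (eigenPolynomial v n)) 2 volume) :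
    hu.toLp (bargmannAdjoint ℏ (eigenPolynomial v n)) ≠ 0 := by
  intro h0
  obtain ⟨w, hw⟩ := exists_eigenPolynomial_eq_one v n
  have h1 := inner_bargmannAdjoint hℏ (coherent d hℏ w) (hasGrowth_eigenPolynomial v n)
    (differentiable_eigenPolynomial v n).continuous hu
  rw [h0, inner_zero_right] at h1
  simp only [inner_coherent_coherent] at h1
  rw [integral_mul_exp_eq_apply le_rfl Real.pi_pos (hasGrowth_eigenPolynomial v n)
    (differentiable_eigenPolynomial v n), hw] at h1
  exact zero_ne_one h1

/-- A function orthogonal to the Bargmann adjoints of all monomials in a basis of linear forms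
vanishes. -/
theorem eq_zero_of_inner_bargmannAdjoint (hℏ : 0 < ℏ)
    (v : Module.Basis (Fin d) ℂ (EuclideanSpace ℂ (Fin d))) {f : L2 d}
    (h : ∀ (n : Fin d → ℕ) (hu : MemLp (bargmannAdjoint ℏ (eigenPolynomial v n)) 2 volume),
      inner ℂ f (hu.toLp _) = 0) : f = 0 := by
  refine eq_zero_of_inner_coherent hℏ fun w => ?_
  set φ : (Fin d → ℂ) → ℂ := fun z => inner ℂ f (coherent d hℏ z) *
    ((Real.exp (-Real.pi * ∑ j, ‖z j‖ ^ 2) : ℝ) : ℂ) with hφ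
  have hφint : ∀ {F : (Fin d → ℂ) → ℂ}, HasGrowth 0 F → Continuous F →
      Integrable fun z => F z * φ z := by
    intro F hF hFc
    refine (integrable_mul_inner_coherent hℏ f hF hFc).congr
      (Filter.Eventually.of_forall fun z => ?_)
    simp only [hφ, mul_assoc]
  have hmono : ∀ n : Fin d → ℕ, ∫ z, eigenPolynomial v n z * φ z = 0 := by
    intro n
    have hF := hasGrowth_eigenPolynomial v n
    have hFc := (differentiable_eigenPolynomial v n).continuous
    have h1 := h n (memLp_bargmannAdjoint hℏ hF hFc)
    rw [inner_bargmannAdjoint hℏ f hF hFc] at h1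
    simpa only [hφ, mul_assoc] using h1
  -- powers of a linear form are combinations of the monomials
  set L : (Fin d → ℂ) → ℂ := fun z => ∑ j, (Real.pi * star (w j)) * z j with hL
  have hLg : HasGrowth 0 L := hasGrowth_linear _
  have hLc : Continuous L := by rw [hL]; fun_prop
  have hLv : ∃ c : Fin d → ℂ, ∀ z, L z = ∑ k, c k *
      ∑ j, inner ℂ (v k) (EuclideanSpace.single j (1 : ℂ)) * z j := by
    set y : EuclideanSpace ℂ (Fin d) := (Real.pi : ℂ) • WithLp.toLp 2 w with hy
    refine ⟨fun k => star (v.repr y k), fun z => ?_⟩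
    have h1 : L z = inner ℂ y (WithLp.toLp 2 z) := by
      rw [hL, PiLp.inner_apply]
      refine Finset.sum_congr rfl fun j _ => ?_
      simp [hy, mul_comm]
    rw [h1]
    conv_lhs => rw [← v.sum_repr y]
    rw [sum_inner]
    refine Finset.sum_congr rfl fun k _ => ?_
    rw [sum_inner_single_mul, inner_smul_left]
    rfl
  obtain ⟨c, hc⟩ := hLv
  have hpow : ∀ m : ℕ, ∫ z, L z ^ m * φ z = 0 := by
    intro m
    have h1 : ∀ z, L z ^ m * φ z = ∑ n ∈ Finset.univ.piAntidiag m,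
        ((Nat.multinomial Finset.univ n : ℂ) * ∏ k, c k ^ n k) * (eigenPolynomial v n z * φ z) := by
      intro z
      rw [hc, Finset.sum_pow_eq_sum_piAntidiag, Finset.sum_mul]
      refine Finset.sum_congr rfl fun n _ => ?_
      unfold eigenPolynomial
      simp only [mul_pow, Finset.prod_mul_distrib]
      ring
    simp only [h1]
    rw [integral_finsetSum]
    · refine Finset.sum_eq_zero fun n _ => ?_
      rw [integral_const_mul, hmono, mul_zero]
    · intro n _
      exact (hφint (hasGrowth_eigenPolynomial v n)
        (differentiable_eigenPolynomial v n).continuous).const_mul _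
  -- hence the exponential series of the linear form is orthogonal to `φ`
  have hEg := hasGrowth_exp_linear fun j => (Real.pi * star (w j) : ℂ)
  have hEc : Continuous fun z : Fin d → ℂ => Complex.exp (∑ j, (Real.pi * star (w j)) * z j) := by
    fun_prop
  have hexp : ∫ z, Complex.exp (L z) * φ z = 0 := by
    have hbound : Integrable fun z => ((Real.exp ‖L z‖ : ℝ) : ℂ) * φ z := by
      refine hφint ?_ (by fun_prop)
      refine ⟨1, ∑ j, ‖(Real.pi * star (w j) : ℂ)‖, fun z => ?_⟩
      rw [one_mul, zero_mul, zero_add, Complex.norm_real, Real.norm_eq_abs, Real.abs_exp]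
      exact Real.exp_le_exp.2 (norm_dotProduct_le _ z)
    have hsum := hasSum_integral_of_dominated_convergence (μ := (volume : Measure (Fin d → ℂ)))
      (F := fun (m : ℕ) z => ((m.factorial : ℂ)⁻¹ * (L z ^ m * φ z)))
      (f := fun z => Complex.exp (L z) * φ z)
      (fun m z => (‖L z‖ ^ m / m.factorial) * ‖φ z‖)
      (fun m => ((hφint (hLg.pow m) (hLc.pow m)).const_mul _).aestronglyMeasurable)
      (fun m => Filter.Eventually.of_forall fun z => by
        rw [norm_mul, norm_mul, norm_pow, norm_inv, Complex.norm_natCast]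
        exact le_of_eq (by ring))
      (Filter.Eventually.of_forall fun z => (Real.summable_pow_div_factorial _).mul_right _)
      (by
        refine hbound.norm.congr (Filter.Eventually.of_forall fun z => ?_)
        simp only
        rw [tsum_mul_right, norm_mul, Complex.norm_real, Real.norm_eq_abs, Real.abs_exp,
          Real.exp_eq_exp_ℝ, NormedSpace.exp_eq_tsum_div])
      (Filter.Eventually.of_forall fun z => by
        have h1 := NormedSpace.expSeries_div_hasSum_exp (L z)
        rw [← Complex.exp_eq_exp_ℂ] at h1
        refine (h1.mul_right (φ z)).congr_fun fun m => ?_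
        ring)
    simp only [integral_const_mul, hpow, mul_zero] at hsum
    exact hsum.unique hasSum_zero
  have hu := memLp_bargmannAdjoint hℏ hEg hEc
  have h1 := inner_bargmannAdjoint hℏ f hEg hEc hu
  have h2 : hu.toLp _ = coherent d hℏ w := by
    refine Lp.ext (hu.coeFn_toLp.trans ?_)
    filter_upwards [coherent_ae_eq hℏ w] with x hx
    rw [hx, bargmannAdjoint_exp hℏ]
  rw [h2] at h1
  rw [h1, ← hexp]
  simp only [hφ, mul_assoc, hL]

end

end Metaplectic

namespace Metaplectic

noncomputable section

/-! ### Unitary operators with a total family of eigenvectors -/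

lemma mem_spectrum_of_hasEigenvalue {H : Type*} [NormedAddCommGroup H] [NormedSpace ℂ H]
    {T : H →L[ℂ] H} {a : ℂ}
    (ha : Module.End.HasEigenvalue (T : H →ₗ[ℂ] H) a) : a ∈ spectrum ℂ T := by
  obtain ⟨f, hf⟩ := ha.exists_hasEigenvector
  rw [spectrum.mem_iff]
  rintro ⟨w, hw⟩
  refine hf.2 ?_
  have h1 : (w : H →L[ℂ] H) f = 0 := by
    have h2 : T f = a • f := hf.apply_eq_smul
    rw [hw]
    simp [h2, Algebra.algebraMap_eq_smul_one]
  calc f = (↑w⁻¹ * ↑w : H →L[ℂ] H) f := by rw [Units.inv_mul]; rfl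
    _ = (↑w⁻¹ : H →L[ℂ] H) ((w : H →L[ℂ] H) f) := rfl
    _ = 0 := by rw [h1, map_zero]

section Total

variable {H ι : Type*} [NormedAddCommGroup H] [InnerProductSpace ℂ H] [CompleteSpace H]
  {U : unitary (H →L[ℂ] H)} {e : ι → H} {lam : ι → ℂ}

lemma norm_eigenvalue_eq_one {f : H} (hf : f ≠ 0) {a : ℂ} (h : (U : H →L[ℂ] H) f = a • f) :
    ‖a‖ = 1 := by
  have h1 := (Unitary.linearIsometryEquiv U).norm_map f
  change ‖(U : H →L[ℂ] H) f‖ = ‖f‖ at h1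
  rw [h, norm_smul] at h1
  exact mul_right_cancel₀ (norm_ne_zero_iff.2 hf) (h1.trans (one_mul _).symm)

/-- A unitary operator with a total family of eigenvectors has no further eigenvalues, because
eigenvectors of distinct eigenvalues are orthogonal. -/
theorem hasEigenvalue_iff_of_total (he : ∀ i, e i ≠ 0)
    (hU : ∀ i, (U : H →L[ℂ] H) (e i) = lam i • e i)
    (htot : ∀ f : H, (∀ i, inner ℂ f (e i) = 0) → f = 0) (a : ℂ) :
    Module.End.HasEigenvalue ((U : H →L[ℂ] H) : H →ₗ[ℂ] H) a ↔ ∃ i, a = lam i := by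
  constructor
  · intro ha
    obtain ⟨f, hf⟩ := ha.exists_hasEigenvector
    have hfa : (U : H →L[ℂ] H) f = a • f := hf.apply_eq_smul
    by_contra hne
    push Not at hne
    refine hf.2 (htot f fun i => ?_)
    have h1 : inner ℂ ((U : H →L[ℂ] H) f) ((U : H →L[ℂ] H) (e i)) = inner ℂ f (e i) :=
      (Unitary.linearIsometryEquiv U).inner_map_map f (e i)
    rw [hfa, hU, inner_smul_left, inner_smul_right] at h1
    have h2 : a * (starRingEnd ℂ) a = 1 := by
      rw [Complex.mul_conj, Complex.normSq_eq_norm_sq, norm_eigenvalue_eq_one hf.2 hfa]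
      simp
    have h3 : (lam i - a) * inner ℂ f (e i) = 0 := by
      linear_combination a * h1 - lam i * inner ℂ f (e i) * h2
    exact (mul_eq_zero.1 h3).resolve_left (sub_ne_zero.2 (hne i).symm)
  · rintro ⟨i, rfl⟩
    exact Module.End.hasEigenvalue_of_hasEigenvector (x := e i)
      ⟨Module.End.mem_eigenspace_iff.2 (hU i), he i⟩

/-- If a total family of eigenvectors has only finitely many eigenvalues `λ`, then `∏ (U - λ) = 0`,
so that there is no spectrum besides these eigenvalues. -/
theorem spectrum_subset_of_finite
    (hU : ∀ i, (U : H →L[ℂ] H) (e i) = lam i • e i)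
    (htot : ∀ f : H, (∀ i, inner ℂ f (e i) = 0) → f = 0) (hfin : (Set.range lam).Finite) :
    spectrum ℂ (U : H →L[ℂ] H) ⊆ Set.range lam := by
  classical
  intro a ha
  have hnt : Nontrivial (H →L[ℂ] H) := by
    by_contra h
    rw [not_nontrivial_iff_subsingleton] at h
    have := spectrum.of_subsingleton (R := ℂ) (U : H →L[ℂ] H)
    rw [this] at ha
    exact ha
  set p : Polynomial ℂ := ∏ s ∈ hfin.toFinset, (Polynomial.X - Polynomial.C s) with hp
  have hpe : ∀ i, Polynomial.aeval (U : H →L[ℂ] H) p (e i) = 0 := by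
    intro i
    obtain ⟨r, hr⟩ : (Polynomial.X - Polynomial.C (lam i)) ∣ p :=
      Finset.dvd_prod_of_mem _ (hfin.mem_toFinset.2 ⟨i, rfl⟩)
    rw [hr, mul_comm, map_mul, mul_apply_eq_comp]
    have : (Polynomial.aeval (U : H →L[ℂ] H) (Polynomial.X - Polynomial.C (lam i))) (e i) = 0 := by
      simp [hU, Algebra.algebraMap_eq_smul_one]
    rw [this, map_zero]
  have hp0 : Polynomial.aeval (U : H →L[ℂ] H) p = 0 := by
    ext x
    refine ext_inner_left ℂ fun h => ?_
    rw [← ContinuousLinearMap.adjoint_inner_left, htot (ContinuousLinearMap.adjoint _ h),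
      inner_zero_left, zero_apply, inner_zero_right]
    intro i
    rw [ContinuousLinearMap.adjoint_inner_left, hpe, inner_zero_right]
  have h1 := spectrum.subset_polynomial_aeval (U : H →L[ℂ] H) p ⟨a, ha, rfl⟩
  rw [hp0, spectrum.zero_eq, Set.mem_singleton_iff] at h1
  simp only [hp, Polynomial.eval_prod, Finset.prod_eq_zero_iff, Polynomial.eval_sub,
    Polynomial.eval_X, Polynomial.eval_C] at h1
  obtain ⟨s, hs, hsa⟩ := h1
  rw [sub_eq_zero.1 hsa]
  exact hfin.mem_toFinset.1 hs

end Total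

/-! ### Diagonalization of unitary matrices -/

open scoped Matrix

variable {d : ℕ} {ℏ : ℝ}

lemma exists_perm_of_map_univ_eq {ι α : Type*} [Fintype ι] {η θ : ι → α}
    (h : Multiset.map η Finset.univ.val = Multiset.map θ Finset.univ.val) :
    ∃ σ : Equiv.Perm ι, ∀ j, η (σ j) = θ j := by
  classical
  have hcard : ∀ a, Fintype.card {j // θ j = a} = Fintype.card {j // η j = a} := by
    intro a
    have h1 := congrArg (Multiset.count a) h
    rw [Multiset.count_map, Multiset.count_map] at h1
    rw [Fintype.card_subtype, Fintype.card_subtype]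
    simpa only [eq_comm, Finset.card_def, Finset.filter_val] using h1.symm
  exact ⟨Equiv.ofFiberEquiv fun a => Fintype.equivOfCardEq (hcard a),
    fun j => Equiv.ofFiberEquiv_map _ j⟩

lemma inner_toEuclideanLin (g : Matrix.unitaryGroup (Fin d) ℂ) (x y : EuclideanSpace ℂ (Fin d)) :
    inner ℂ (Matrix.toEuclideanLin (g : Matrix (Fin d) (Fin d) ℂ) x)
      (Matrix.toEuclideanLin (g : Matrix (Fin d) (Fin d) ℂ) y) = inner ℂ x y := by
  have hg : (g : Matrix (Fin d) (Fin d) ℂ)ᴴ * (g : Matrix (Fin d) (Fin d) ℂ) = 1 :=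
    Matrix.mem_unitaryGroup_iff'.1 g.2
  rw [EuclideanSpace.inner_eq_star_dotProduct, EuclideanSpace.inner_eq_star_dotProduct]
  change ((g : Matrix (Fin d) (Fin d) ℂ) *ᵥ (WithLp.ofLp y)) ⬝ᵥ
    star ((g : Matrix (Fin d) (Fin d) ℂ) *ᵥ (WithLp.ofLp x)) = _
  rw [dotProduct_comm, Matrix.star_mulVec, ← Matrix.dotProduct_mulVec, Matrix.mulVec_mulVec, hg,
    Matrix.one_mulVec, dotProduct_comm]

lemma norm_det_eq_one (g : Matrix.unitaryGroup (Fin d) ℂ) :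
    ‖(g : Matrix (Fin d) (Fin d) ℂ).det‖ = 1 := by
  have h1 : (g : Matrix (Fin d) (Fin d) ℂ)ᴴ * (g : Matrix (Fin d) (Fin d) ℂ) = 1 :=
    Matrix.mem_unitaryGroup_iff'.1 g.2
  have h2 := congrArg (fun M : Matrix (Fin d) (Fin d) ℂ => ‖M.det‖) h1
  simp only [Matrix.det_mul, Matrix.det_conjTranspose, norm_mul, norm_star, Matrix.det_one,
    norm_one, ← sq] at h2
  exact (pow_eq_one_iff_of_nonneg (norm_nonneg _) two_ne_zero).1 h2

lemma isSemisimple_toEuclideanLin (g : Matrix.unitaryGroup (Fin d) ℂ) :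
    Module.End.IsSemisimple (Matrix.toEuclideanLin (g : Matrix (Fin d) (Fin d) ℂ)) := by
  set T := Matrix.toEuclideanLin (g : Matrix (Fin d) (Fin d) ℂ) with hT
  have hTi : Function.Injective T := by
    rw [injective_iff_map_eq_zero]
    intro x hx
    have := inner_toEuclideanLin g x x
    rw [← hT, hx, inner_zero_left] at this
    exact inner_self_eq_zero.1 this.symm
  refine Module.End.isSemisimple_iff.2 fun p hp =>
    ⟨pᗮ, ?_, p.isCompl_orthogonal⟩
  rw [Module.End.mem_invtSubmodule] at hp ⊢
  have hpT : p.map T = p :=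
    Submodule.eq_of_le_of_finrank_eq (Submodule.map_le_iff_le_comap.2 hp)
      (LinearEquiv.finrank_eq (p.equivMapOfInjective T hTi)).symm
  intro y hy
  rw [Submodule.mem_comap, Submodule.mem_orthogonal]
  intro x hx
  rw [← hpT] at hx
  obtain ⟨x', hx', rfl⟩ := hx
  rw [inner_toEuclideanLin]
  exact (Submodule.mem_orthogonal _ _).1 hy x' hx'

/-- A unitary matrix is diagonalizable, with the roots of its characteristic polynomial, in any
given order, as eigenvalues. -/
theorem exists_eigenbasis (g : Matrix.unitaryGroup (Fin d) ℂ) {θ : Fin d → ℂ}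
    (hθ : (g : Matrix (Fin d) (Fin d) ℂ).charpoly.roots = Multiset.map θ Finset.univ.val) :
    ∃ v : Module.Basis (Fin d) ℂ (EuclideanSpace ℂ (Fin d)),
      ∀ j, Matrix.toEuclideanLin (g : Matrix (Fin d) (Fin d) ℂ) (v j) = θ j • v j := by
  classical
  set T := Matrix.toEuclideanLin (g : Matrix (Fin d) (Fin d) ℂ) with hT
  set s : Set (EuclideanSpace ℂ (Fin d)) := {x | ∃ a : ℂ, T x = a • x} with hs
  have hspan : ⊤ ≤ Submodule.span ℂ s := by
    rw [← (isSemisimple_toEuclideanLin g).iSup_eigenspace_eq_top]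
    exact iSup_le fun a x hx => Submodule.subset_span ⟨a, Module.End.mem_eigenspace_iff.1 hx⟩
  let b₀ := Module.Basis.ofSpan hspan
  let b : Module.Basis (Fin d) ℂ (EuclideanSpace ℂ (Fin d)) :=
    b₀.reindex (Fintype.equivFinOfCardEq (by
      rw [← Module.finrank_eq_card_basis b₀, finrank_euclideanSpace_fin]))
  have hb : ∀ j, ∃ a : ℂ, T (b j) = a • b j := fun j => by
    have : b j ∈ s := Module.Basis.ofSpan_subset hspan ⟨_, (b₀.reindex_apply _ j).symm⟩
    exact this
  choose η hη using hb
  have hM : LinearMap.toMatrix b b T = Matrix.diagonal η := by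
    ext i j
    rw [LinearMap.toMatrix_apply, hη, map_smul, b.repr_self, Finsupp.smul_apply,
      Finsupp.single_apply, Matrix.diagonal_apply, smul_eq_mul]
    by_cases h : i = j
    · simp [h]
    · simp [h, Ne.symm h]
  have hc : (g : Matrix (Fin d) (Fin d) ℂ).charpoly = T.charpoly :=
    (Matrix.charpoly_toLin _ (EuclideanSpace.basisFun (Fin d) ℂ).toBasis).symm
  have hroots : Multiset.map η Finset.univ.val = Multiset.map θ Finset.univ.val := by
    rw [← hθ, hc, ← LinearMap.charpoly_toMatrix T b, hM, Matrix.charpoly_diagonal]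
    exact ((congrArg Polynomial.roots (by simp [Finset.prod, Function.comp_def])).trans
      (Polynomial.roots_multiset_prod_X_sub_C (Multiset.map η Finset.univ.val))).symm
  obtain ⟨σ, hσ⟩ := exists_perm_of_map_univ_eq hroots
  refine ⟨b.reindex σ.symm, fun j => ?_⟩
  rw [b.reindex_apply, Equiv.symm_symm, hη, hσ]

lemma hasEigenvalue_toLin'_iff (g : Matrix.unitaryGroup (Fin d) ℂ) {θ : Fin d → ℂ}
    (hθ : (g : Matrix (Fin d) (Fin d) ℂ).charpoly.roots = Multiset.map θ Finset.univ.val) (a : ℂ) :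
    Module.End.HasEigenvalue (Matrix.toLin' (g : Matrix (Fin d) (Fin d) ℂ)) a ↔ ∃ j, θ j = a := by
  rw [Module.End.hasEigenvalue_iff_isRoot_charpoly, Matrix.charpoly_toLin',
    ← Polynomial.mem_roots (Matrix.charpoly_monic _).ne_zero, hθ]
  simp

lemma norm_eq_one_of_eigenbasis {g : Matrix.unitaryGroup (Fin d) ℂ} {θ : Fin d → ℂ}
    {v : Module.Basis (Fin d) ℂ (EuclideanSpace ℂ (Fin d))}
    (hv : ∀ j, Matrix.toEuclideanLin (g : Matrix (Fin d) (Fin d) ℂ) (v j) = θ j • v j)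
    (j : Fin d) : ‖θ j‖ = 1 := by
  have h1 := inner_toEuclideanLin g (v j) (v j)
  have h0 : inner ℂ (v j) (v j) ≠ 0 := inner_self_ne_zero.2 (v.ne_zero j)
  rw [hv, inner_smul_left, inner_smul_right, ← mul_assoc] at h1
  have h2 := mul_right_cancel₀ h0 (h1.trans (one_mul _).symm)
  rw [mul_comm, Complex.mul_conj, Complex.normSq_eq_norm_sq] at h2
  have h3 : ‖θ j‖ ^ 2 = 1 := by exact_mod_cast h2
  exact (pow_eq_one_iff_of_nonneg (norm_nonneg _) two_ne_zero).1 h3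

/-! ### Rotations of the circle -/

lemma exists_circle_exp {a : ℂ} (ha : ‖a‖ = 1) :
    ∃ α : ℝ, a = Complex.exp (2 * Real.pi * Complex.I * α) := by
  refine ⟨Complex.arg a / (2 * Real.pi), ?_⟩
  conv_lhs => rw [← Complex.norm_mul_exp_arg_mul_I a, ha]
  rw [Complex.ofReal_one, one_mul]
  congr 1
  push_cast
  have := Real.pi_ne_zero
  field_simp

lemma exists_pow_eq_one_of_not_irrational {α : ℝ} (hα : ¬ Irrational α) :
    ∃ N : ℕ, 0 < N ∧ Complex.exp (2 * Real.pi * Complex.I * α) ^ N = 1 := by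
  obtain ⟨r, rfl⟩ := not_not.1 hα
  refine ⟨r.den, r.den_pos, ?_⟩
  rw [← Complex.exp_nat_mul, Complex.exp_eq_one_iff]
  refine ⟨r.num, ?_⟩
  have h1 : ((r.den : ℂ)) * (r : ℂ) = r.num := by
    exact_mod_cast Rat.den_mul_eq_num r
  push_cast
  linear_combination (2 * Real.pi * Complex.I) * h1

/-- A closed set containing the orbit of a point under an irrational rotation contains the whole
circle. -/
lemma sphere_subset_of_irrational {S : Set ℂ} (hS : IsClosed S) {ζ : ℂ} (hζ : ‖ζ‖ = 1) {α : ℝ}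
    (hα : Irrational α)
    (h : ∀ n : ℕ, ζ * (starRingEnd ℂ (Complex.exp (2 * Real.pi * Complex.I * α))) ^ n ∈ S) :
    Metric.sphere (0 : ℂ) 1 ⊆ S := by
  set F : AddCircle (1 : ℝ) → ℂ := fun x => ζ * starRingEnd ℂ (AddCircle.toCircle x : ℂ) with hF
  have hFc : Continuous F := by
    have := AddCircle.continuous_toCircle (T := 1)
    fun_prop
  have hd : DenseRange (fun n : ℕ => n • ((α : ℝ) : AddCircle (1 : ℝ))) := by
    rw [← denseRange_zsmul_iff_nsmul]
    exact AddCircle.denseRange_zsmul_coe_iff.2 (by rwa [div_one])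
  have hall : ∀ x, F x ∈ S := by
    intro x
    have hcl : IsClosed (F ⁻¹' S) := hS.preimage hFc
    refine hcl.closure_subset_iff.2 ?_ (hd x)
    rintro _ ⟨n, rfl⟩
    have h1 := h n
    rw [Set.mem_preimage, hF]
    dsimp only
    rw [AddCircle.toCircle_nsmul, AddCircle.toCircle_apply_mk, Circle.coe_pow, Circle.coe_exp,
      map_pow]
    convert h1 using 5
    push_cast
    ring
  intro a ha
  have ha1 : ‖a‖ = 1 := by simpa using ha
  have hζ0 : ζ ≠ 0 := norm_ne_zero_iff.1 (by rw [hζ]; exact one_ne_zero)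
  have hb : ‖starRingEnd ℂ (a / ζ)‖ = 1 := by
    rw [RCLike.norm_conj, norm_div, ha1, hζ, div_one]
  obtain ⟨β, hβ⟩ := exists_circle_exp hb
  have h1 := hall (β : AddCircle (1 : ℝ))
  have h2 : F (β : AddCircle (1 : ℝ)) = a := by
    rw [hF]
    dsimp only
    rw [AddCircle.toCircle_apply_mk, Circle.coe_exp]
    have : Complex.exp (((2 * Real.pi / 1 * β : ℝ) : ℂ) * Complex.I) = starRingEnd ℂ (a / ζ) := by
      rw [hβ]
      congr 1
      push_cast
      ring
    rw [this, Complex.conj_conj]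
    field_simp
  rwa [h2] at h1

/-- The products of powers of finitely many roots of unity `ω ^ aⱼ` form the group generated by
`ω ^ gcd(aⱼ)`. -/
lemma exists_prod_inv_pow_iff {G : Type*} [CommGroup G] {ω : G} {Q : ℕ} (hQ : 0 < Q)
    (hω : ω ^ Q = 1) (a : Fin d → ℤ) {P : ℕ}
    (hP : P = Finset.univ.gcd fun j => (a j).natAbs) (y : G) :
    (∃ n : Fin d → ℕ, y = ∏ j, ((ω ^ a j)⁻¹) ^ n j) ↔ y ∈ Subgroup.zpowers (ω ^ P) := by
  have hpow : ∀ x ∈ Subgroup.zpowers ω, x ^ Q = 1 := by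
    rintro _ ⟨k, rfl⟩
    change (ω ^ k) ^ Q = 1
    rw [← zpow_natCast, ← zpow_mul, mul_comm, zpow_mul, zpow_natCast, hω, one_zpow]
  let K : Subgroup G :=
    { carrier := {y | ∃ n : Fin d → ℕ, y = ∏ j, ((ω ^ a j)⁻¹) ^ n j}
      one_mem' := ⟨0, by simp⟩
      mul_mem' := by
        rintro _ _ ⟨m, rfl⟩ ⟨n, rfl⟩
        exact ⟨m + n, by simp only [Pi.add_apply, pow_add, Finset.prod_mul_distrib]⟩
      inv_mem' := by
        rintro _ ⟨n, rfl⟩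
        refine ⟨fun j => n j * (Q - 1), ?_⟩
        simp only [pow_mul]
        rw [Finset.prod_pow, inv_eq_iff_mul_eq_one, ← pow_succ', Nat.sub_add_cancel hQ]
        exact hpow _ (prod_mem fun j _ => pow_mem
          (inv_mem (Subgroup.zpow_mem_zpowers ω (a j))) _) }
  change y ∈ K ↔ _
  suffices K = Subgroup.zpowers (ω ^ P) by rw [this]
  refine le_antisymm ?_ (Subgroup.zpowers_le.2 ?_)
  · rintro _ ⟨n, rfl⟩
    refine prod_mem fun j _ => pow_mem (inv_mem ?_) _
    obtain ⟨k, hk⟩ : (P : ℤ) ∣ a j := by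
      rw [Int.natCast_dvd, hP]
      exact Finset.gcd_dvd (Finset.mem_univ j)
    exact ⟨k, by rw [hk, zpow_mul, zpow_natCast]⟩
  · -- the exponents `k` with `ω ^ k ∈ K` form a group `ℤ m` containing every `aⱼ`
    let A : AddSubgroup ℤ :=
      { carrier := {k | ω ^ k ∈ K}
        zero_mem' := by rw [Set.mem_ofPred_eq, zpow_zero]; exact K.one_mem
        add_mem' := fun hk hl => by
          rw [Set.mem_ofPred_eq, zpow_add]; exact K.mul_mem hk hl
        neg_mem' := fun hk => by
          rw [Set.mem_ofPred_eq, zpow_neg]; exact K.inv_mem hk }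
    obtain ⟨m, hm⟩ := Int.subgroup_cyclic A
    rw [← AddSubgroup.zmultiples_eq_closure] at hm
    have hA : ∀ k : ℤ, ω ^ k ∈ K ↔ m ∣ k := by
      intro k
      rw [← Int.mem_zmultiples_iff, ← hm]
      rfl
    have ha : ∀ j, m ∣ a j := by
      intro j
      refine (hA _).1 (K.inv_mem_iff.1 ⟨Pi.single j 1, ?_⟩)
      rw [Finset.prod_eq_single j]
      · rw [Pi.single_eq_same, pow_one]
      · intro i _ hij
        rw [Pi.single_eq_of_ne hij, pow_zero]
      · exact fun hj => absurd (Finset.mem_univ j) hj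
    rw [← zpow_natCast, hA, hP, ← Int.natAbs_dvd, Int.natCast_dvd_natCast]
    exact Finset.dvd_gcd fun j _ => Int.natAbs_dvd_natAbs.2 (ha j)

lemma finite_range_prod_pow {θ : Fin d → ℂ} {N : Fin d → ℕ} (hN : ∀ j, 0 < N j)
    (hθ : ∀ j, θ j ^ N j = 1) (ζ : ℂ) :
    (Set.range fun n : Fin d → ℕ => ζ * ∏ j, (starRingEnd ℂ (θ j)) ^ n j).Finite := by
  refine ((Fintype.piFinset fun j => Finset.range (N j)).finite_toSet.image
    fun n : Fin d → ℕ => ζ * ∏ j, (starRingEnd ℂ (θ j)) ^ n j).subset ?_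
  rintro _ ⟨n, rfl⟩
  refine ⟨fun j => n j % N j, ?_, ?_⟩
  · rw [Finset.mem_coe, Fintype.mem_piFinset]
    exact fun j => Finset.mem_range.2 (Nat.mod_lt _ (hN j))
  · dsimp only
    congr 1
    refine Finset.prod_congr rfl fun j _ => ?_
    rw [← map_pow, ← map_pow]
    congr 1
    conv_rhs => rw [← Nat.mod_add_div (n j) (N j), pow_add, pow_mul, hθ, one_pow, mul_one]

/-- The eigenvalues `ζ ∏ θ̄ⱼ ^ nⱼ` for roots of unity `θⱼ = exp(2πi pⱼ/qⱼ)` are the points of a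
rotated cyclic group. -/
lemma eigenvalues_eq_image_zpowers {θ : Fin d → ℂ} {p : Fin d → ℤ} {q : Fin d → ℕ}
    (hq : ∀ j, 0 < q j)
    (hθ : ∀ j, θ j = Complex.exp (2 * Real.pi * Complex.I * (p j : ℂ) / (q j : ℂ))) {Q P : ℕ}
    (hQ : Q = Finset.univ.lcm q) (hP : P = Finset.univ.gcd fun j => Q * (p j).natAbs / q j)
    (ζ : ℂ) :
    {a | ∃ n : Fin d → ℕ, a = ζ * ∏ j, (starRingEnd ℂ (θ j)) ^ n j} =
        (fun h : Circle => ζ * (h : ℂ)) ''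
          (Subgroup.zpowers (Circle.exp (2 * Real.pi / Q) ^ P) : Set Circle) ∧
      {a | ∃ n : ℕ,
          a = ζ * Complex.exp (2 * Real.pi * Complex.I * (n : ℂ) * (P : ℂ) / (Q : ℂ))} =
        (fun h : Circle => ζ * (h : ℂ)) ''
          (Subgroup.zpowers (Circle.exp (2 * Real.pi / Q) ^ P) : Set Circle) ∧
      (Subgroup.zpowers (Circle.exp (2 * Real.pi / Q) ^ P) : Set Circle).Finite := by
  have hQ0 : 0 < Q := by
    rw [hQ, Nat.pos_iff_ne_zero, Ne, Finset.lcm_eq_zero_iff]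
    rintro ⟨j, -, hj⟩
    exact (hq j).ne' hj
  have hQc : (Q : ℂ) ≠ 0 := Nat.cast_ne_zero.2 hQ0.ne'
  set ω : Circle := Circle.exp (2 * Real.pi / Q) with hω
  have hωc : (ω : ℂ) = Complex.exp (2 * Real.pi * Complex.I / Q) := by
    rw [hω, Circle.coe_exp]
    congr 1
    push_cast
    ring
  have hω1 : ω ^ Q = 1 := by
    ext
    rw [Circle.coe_pow, hωc, ← Complex.exp_nat_mul, mul_div_cancel₀ _ hQc, Complex.exp_two_pi_mul_I,
      Circle.coe_one]
  have hqQ : ∀ j, q j ∣ Q := fun j => hQ ▸ Finset.dvd_lcm (Finset.mem_univ j)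
  set a : Fin d → ℤ := fun j => ((Q / q j : ℕ) : ℤ) * p j with ha
  have hPa : P = Finset.univ.gcd fun j => (a j).natAbs := by
    rw [hP]
    congr 1
    ext j
    rw [ha, Int.natAbs_mul, Int.natAbs_natCast, Nat.div_mul_right_comm (hqQ j)]
  have hθω : ∀ j, starRingEnd ℂ (θ j) = (((ω ^ a j)⁻¹ : Circle) : ℂ) := by
    intro j
    rw [Circle.coe_inv_eq_conj, Circle.coe_zpow, hωc, ← Complex.exp_int_mul, hθ j]
    congr 2
    obtain ⟨k, hk⟩ := hqQ j
    have hqc : (q j : ℂ) ≠ 0 := Nat.cast_ne_zero.2 (hq j).ne'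
    have hkc : (k : ℂ) ≠ 0 := by
      rintro h
      rw [Nat.cast_eq_zero] at h
      rw [hk, h, mul_zero] at hQ0
      exact hQ0.ne' rfl
    have haj : a j = (k : ℤ) * p j := by
      change ((Q / q j : ℕ) : ℤ) * p j = _
      rw [hk, Nat.mul_div_cancel_left _ (hq j)]
    rw [haj, hk]
    push_cast
    field_simp
  have hprod : ∀ n : Fin d → ℕ, ((∏ j, ((ω ^ a j)⁻¹) ^ n j : Circle) : ℂ) =
      ∏ j, (((ω ^ a j)⁻¹ : Circle) : ℂ) ^ n j := by
    intro n
    exact (map_prod Circle.coeHom _ _).trans (Finset.prod_congr rfl fun j _ => map_pow _ _ _)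
  have hfin : IsOfFinOrder (ω ^ P) := (isOfFinOrder_iff_pow_eq_one.2 ⟨Q, hQ0, hω1⟩).pow
  refine ⟨?_, ?_, hfin.finite_zpowers⟩
  · ext b
    constructor
    · rintro ⟨n, rfl⟩
      refine ⟨∏ j, ((ω ^ a j)⁻¹) ^ n j, (exists_prod_inv_pow_iff hQ0 hω1 a hPa _).1 ⟨n, rfl⟩, ?_⟩
      simp only [hθω, hprod]
    · rintro ⟨h, hh, rfl⟩
      obtain ⟨n, rfl⟩ := (exists_prod_inv_pow_iff hQ0 hω1 a hPa _).2 hh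
      exact ⟨n, by simp only [hθω, hprod]⟩
  · have hpow : ∀ n : ℕ, (((ω ^ P) ^ n : Circle) : ℂ) =
        Complex.exp (2 * Real.pi * Complex.I * (n : ℂ) * (P : ℂ) / (Q : ℂ)) := by
      intro n
      rw [Circle.coe_pow, Circle.coe_pow, hωc, ← Complex.exp_nat_mul, ← Complex.exp_nat_mul]
      congr 1
      ring
    ext b
    constructor
    · rintro ⟨n, rfl⟩
      exact ⟨(ω ^ P) ^ n, Subgroup.npow_mem_zpowers _ _, by simp only [hpow]⟩
    · rintro ⟨h, hh, rfl⟩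
      obtain ⟨n, rfl⟩ := hfin.mem_powers_iff_mem_zpowers.2 hh
      exact ⟨n, by simp only [hpow]⟩

/-! ### The spectrum of metaplectic operators of unitary matrices -/

lemma hasEigenvector_bargmannAdjoint (hℏ : 0 < ℏ) {g : Matrix.unitaryGroup (Fin d) ℂ}
    {U : unitary (L2 d →L[ℂ] L2 d)} {ζ : ℂ}
    (hU : Implements ℏ U (fun w => (g : Matrix (Fin d) (Fin d) ℂ) *ᵥ w))
    (hζ : (U : L2 d →L[ℂ] L2 d) (groundState d hℏ) = ζ • groundState d hℏ) {θ : Fin d → ℂ}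
    {v : Module.Basis (Fin d) ℂ (EuclideanSpace ℂ (Fin d))}
    (hv : ∀ j, Matrix.toEuclideanLin (g : Matrix (Fin d) (Fin d) ℂ) (v j) = θ j • v j)
    (n : Fin d → ℕ) (hu : MemLp (bargmannAdjoint ℏ (eigenPolynomial v n)) 2 volume) :
    Module.End.HasEigenvector ((U : L2 d →L[ℂ] L2 d) : L2 d →ₗ[ℂ] L2 d)
      (ζ * ∏ j, (starRingEnd ℂ (θ j)) ^ n j) (hu.toLp _) :=
  ⟨Module.End.mem_eigenspace_iff.2 (apply_bargmannAdjoint hℏ hU hζ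
      (hasGrowth_eigenPolynomial v n) (differentiable_eigenPolynomial v n).continuous
      (eigenPolynomial_mulVec hv n) hu),
    bargmannAdjoint_eigenPolynomial_ne_zero hℏ v n hu⟩

end

end Metaplectic

open Metaplectic in
theorem theorem2 (d : ℕ) (ℏ : ℝ) (hℏ : 0 < ℏ) (g : Matrix.unitaryGroup (Fin d) ℂ)
    (θ : Fin d → ℂ)
    (hθ : (g : Matrix (Fin d) (Fin d) ℂ).charpoly.roots = Multiset.map θ Finset.univ.val) :
    (∃ U : unitary (Metaplectic.L2 d →L[ℂ] Metaplectic.L2 d),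
      Metaplectic.IsMetaplecticOperator ℏ g U) ∧
    ∀ U : unitary (Metaplectic.L2 d →L[ℂ] Metaplectic.L2 d),
      Metaplectic.IsMetaplecticOperator ℏ g U →
      -- `ζ` is the value of `det(g)^(-1/2)` that belongs to the choice of sign of `U = μ(g)`
      ∃ ζ : ℂ, ζ ^ 2 = ((g : Matrix (Fin d) (Fin d) ℂ).det)⁻¹ ∧
        -- the point spectrum
        Metaplectic.pointSpectrum (U : Metaplectic.L2 d →L[ℂ] Metaplectic.L2 d) =
          {a | ∃ n : Fin d → ℕ, a = ζ * ∏ j, (starRingEnd ℂ (θ j)) ^ n j} ∧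
        -- the eigenvectors
        (∀ v : Module.Basis (Fin d) ℂ (EuclideanSpace ℂ (Fin d)),
          (∀ j, Matrix.toEuclideanLin (g : Matrix (Fin d) (Fin d) ℂ) (v j) = θ j • v j) →
          ∀ n : Fin d → ℕ,
            ∃ hu : MeasureTheory.MemLp
                (Metaplectic.bargmannAdjoint ℏ (Metaplectic.eigenPolynomial v n)) 2
                MeasureTheory.volume,
              Module.End.HasEigenvector
                ((U : Metaplectic.L2 d →L[ℂ] Metaplectic.L2 d) :
                  Metaplectic.L2 d →ₗ[ℂ] Metaplectic.L2 d)
                (ζ * ∏ j, (starRingEnd ℂ (θ j)) ^ n j) (hu.toLp _)) ∧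
        -- the spectrum is the whole circle iff some eigenvalue is an irrational rotation
        ((∃ α : ℝ, Irrational α ∧
            Module.End.HasEigenvalue (Matrix.toLin' (g : Matrix (Fin d) (Fin d) ℂ))
              (Complex.exp (2 * Real.pi * Complex.I * α))) ↔
          spectrum ℂ (U : Metaplectic.L2 d →L[ℂ] Metaplectic.L2 d) = Metric.sphere (0 : ℂ) 1) ∧
        -- the case of rational rotations
        (∀ (p : Fin d → ℤ) (q : Fin d → ℕ), (∀ j, 0 < q j) →
          (∀ j, θ j = Complex.exp (2 * Real.pi * Complex.I * (p j : ℂ) / (q j : ℂ))) →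
          ∀ Q P : ℕ, Q = Finset.univ.lcm q →
            P = Finset.univ.gcd (fun j => Q * (p j).natAbs / q j) →
            Metaplectic.pointSpectrum (U : Metaplectic.L2 d →L[ℂ] Metaplectic.L2 d) =
              spectrum ℂ (U : Metaplectic.L2 d →L[ℂ] Metaplectic.L2 d) ∧
            spectrum ℂ (U : Metaplectic.L2 d →L[ℂ] Metaplectic.L2 d) =
              {a | ∃ n : ℕ,
                a = ζ * Complex.exp (2 * Real.pi * Complex.I * (n : ℂ) * (P : ℂ) / (Q : ℂ))} ∧
            ∃ H : Subgroup Circle, (H : Set Circle).Finite ∧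
              spectrum ℂ (U : Metaplectic.L2 d →L[ℂ] Metaplectic.L2 d) =
                (fun h : Circle => ζ * (h : ℂ)) '' (H : Set Circle)) := by
  refine ⟨exists_isMetaplecticOperator hℏ g, fun U hU => ?_⟩
  obtain ⟨ζ, hζ2, hζ⟩ := exists_apply_groundState hℏ hU
  obtain ⟨v, hv⟩ := exists_eigenbasis g hθ
  have hnorm := norm_eq_one_of_eigenbasis hv
  have hζ1 : ‖ζ‖ = 1 := by
    have h1 : ‖ζ‖ ^ 2 = 1 := by rw [← norm_pow, hζ2, norm_inv, norm_det_eq_one, inv_one]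
    exact (pow_eq_one_iff_of_nonneg (norm_nonneg _) two_ne_zero).1 h1
  -- the Bargmann adjoints of the monomials in the dual coordinates form a total family
  set lam : (Fin d → ℕ) → ℂ := fun n => ζ * ∏ j, (starRingEnd ℂ (θ j)) ^ n j with hlam
  have hmem : ∀ (v : Module.Basis (Fin d) ℂ (EuclideanSpace ℂ (Fin d))) n,
      MemLp (bargmannAdjoint ℏ (eigenPolynomial v n)) 2 volume := fun v n =>
    memLp_bargmannAdjoint hℏ (hasGrowth_eigenPolynomial v n)
      (differentiable_eigenPolynomial v n).continuous
  have heig := fun n => hasEigenvector_bargmannAdjoint hℏ hU.2 hζ hv n (hmem v n)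
  have he : ∀ n, (hmem v n).toLp _ ≠ 0 := fun n => (heig n).2
  have hUe : ∀ n, (U : L2 d →L[ℂ] L2 d) ((hmem v n).toLp _) = lam n • (hmem v n).toLp _ :=
    fun n => (heig n).apply_eq_smul
  have htot : ∀ f : L2 d, (∀ n, inner ℂ f ((hmem v n).toLp _) = 0) → f = 0 := fun f hf =>
    eq_zero_of_inner_bargmannAdjoint hℏ v fun n _ => hf n
  have hpt : pointSpectrum (U : L2 d →L[ℂ] L2 d) = {a | ∃ n, a = lam n} :=
    Set.ext fun a => hasEigenvalue_iff_of_total he hUe htot a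
  have hpts : pointSpectrum (U : L2 d →L[ℂ] L2 d) ⊆ spectrum ℂ (U : L2 d →L[ℂ] L2 d) :=
    fun a ha => mem_spectrum_of_hasEigenvalue ha
  have hrat : ∀ N : Fin d → ℕ, (∀ j, 0 < N j) → (∀ j, θ j ^ N j = 1) →
      (Set.range lam).Finite ∧ pointSpectrum (U : L2 d →L[ℂ] L2 d) =
        spectrum ℂ (U : L2 d →L[ℂ] L2 d) := by
    intro N hN hθN
    have hfin : (Set.range lam).Finite := finite_range_prod_pow hN hθN ζ
    refine ⟨hfin, hpts.antisymm ((spectrum_subset_of_finite hUe htot hfin).trans ?_)⟩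
    rw [hpt]
    rintro _ ⟨n, rfl⟩
    exact ⟨n, rfl⟩
  refine ⟨ζ, hζ2, hpt, fun v' hv' n =>
    ⟨hmem v' n, hasEigenvector_bargmannAdjoint hℏ hU.2 hζ hv' n (hmem v' n)⟩, ⟨?_, ?_⟩, ?_⟩
  · rintro ⟨α, hα, hev⟩
    obtain ⟨j, hj⟩ := (hasEigenvalue_toLin'_iff g hθ _).1 hev
    refine (spectrum.subset_circle_of_unitary U.2).antisymm
      (sphere_subset_of_irrational (spectrum.isClosed _) hζ1 hα fun n => hpts ?_)
    rw [hpt]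
    refine ⟨Pi.single j n, ?_⟩
    rw [hlam]
    dsimp only
    rw [Finset.prod_eq_single j, Pi.single_eq_same, hj]
    · intro i _ hij
      rw [Pi.single_eq_of_ne hij, pow_zero]
    · exact fun h => absurd (Finset.mem_univ j) h
  · -- if all eigenvalues of `g` are roots of unity, the spectrum is finite
    intro hsp
    by_contra hirr
    push Not at hirr
    have hN : ∀ j, ∃ N : ℕ, 0 < N ∧ θ j ^ N = 1 := by
      intro j
      obtain ⟨α, hα⟩ := exists_circle_exp (hnorm j)
      have h1 : ¬ Irrational α := fun h =>
        hirr α h ((hasEigenvalue_toLin'_iff g hθ _).2 ⟨j, hα⟩)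
      rw [hα]
      exact exists_pow_eq_one_of_not_irrational h1
    choose N hN hθN using hN
    obtain ⟨hfin, heq⟩ := hrat N hN hθN
    refine infinite_sphere ?_
    rw [← hsp, ← heq, hpt]
    exact hfin.subset (by rintro _ ⟨n, rfl⟩; exact ⟨n, rfl⟩)
  · intro p q hq hθpq Q P hQ hP
    have hθq : ∀ j, θ j ^ q j = 1 := by
      intro j
      have hqc : (q j : ℂ) ≠ 0 := Nat.cast_ne_zero.2 (hq j).ne'
      rw [hθpq j, ← Complex.exp_nat_mul, Complex.exp_eq_one_iff]
      exact ⟨p j, by field_simp⟩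
    obtain ⟨-, heq⟩ := hrat q hq hθq
    obtain ⟨h1, h2, h3⟩ := eigenvalues_eq_image_zpowers hq hθpq hQ hP ζ
    have h4 := hpt.trans h1
    exact ⟨heq, heq ▸ h4.trans h2.symm, _, h3, heq ▸ h4⟩
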